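/- Say that a function $G:\mathbb{R}\to\mathbb{R}_+$ has property $\mathcal{P}$ if: (1) $G$ is nonzero, nondecreasing and convex on $[0,\infty)$; (2) $G(0)=0$, $G(1)=1$ and $G(x)=G(-x)$ for all $x$; (3) there is $s>0$ with $G(x)=sx+(1-s)$ for all $x>1$; (4) $G$ is twice differentiable on $(0,\delta)$ for some $\delta>0$, the finite limits $G'_+(0)=\lim_{h\to0^+}G(h)/h$ and $G''_+(0)=\lim_{h\to0^+}(G'(h)-G'_+(0))/h$ exist, and $G'_+(0)>0$ or $G''_+(0)>0$; (5) there is $C>0$ with $G(y)\le C(y/x)^2G(x)$ for all $0<x<y$. For $x\in\mathbb{R}^n$ let $\|x\|_G=\inf\{\alpha>0:\sum_{i=1}^nG(|x_i|/\alpha)\le1\}$. Write $\mathrm{nnz}$ for the number of nonzero entries and $M^\dagger$ for the Moore–Penrose pseudoinverse. Algorithm. Given $A\in\mathbb{R}^{n\times d}$ and $b\in\mathbb{R}^n$, put $t_1=k_1d^2$ and $t_2=k_2d$, where $k_1,k_2$ are fixed positive integers. Draw independently: a diagonal matrix $D\in\mathbb{R}^{n\times n}$ with i.i.d. diagonal entries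 of cumulative distribution function $1-e^{-G(t)}$ ($t\ge0$); a sparse embedding matrix $\Pi_1=\Phi Y\in\mathbb{R}^{t_1\times n}$, where $Y$ is diagonal with i.i.d. uniform $\pm1$ diagonal entries and $\Phi\in\{0,1\}^{t_1\times n}$ has in every column $i$ exactly one $1$, in row $h(i)$, with $h(1),\dots,h(n)$ i.i.d. uniform on $\{1,\dots,t_1\}$; and $\Pi_2\in\mathbb{R}^{t_2\times t_1}$ with i.i.d. standard Gaussian entries scaled by $1/\sqrt{t_2}$. Output $$\hat x=(\Pi_2\Pi_1D^{-1}A)^\dagger\,\Pi_2\Pi_1D^{-1}b.$$ Theorem. There are absolute constants $c_1,c_2$ such that, for all $k_1\ge c_1$ and $k_2\ge c_2$, the following hold. (a) For every $G$ with property $\mathcal{P}$ there is a constant $\beta_G>0$, depending only on $G$, such that for all $n\ge2$, $d\ge1$, $A\in\mathbb{R}^{n\times d}$ and $b\in\mathbb{R}^n$ the minimum $\min_{x\in\mathbb{R}^d}\|Ax-b\|_G$ is attained and, with probability at least $0.8$, $$\|A\hat x-b\|_G\le\beta_G\,d\,\log^2 n\cdot\min_{x\in\mathbb{R}^d}\|Ax-b\|_G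 .$$ (b) On a randomized real RAM (unit cost for arithmetic and comparisons of reals, for index arithmetic, for memory accesses, and for each random number drawn from one of the above distributions) there is a single program that, for all $n$, all $d\ge1$ and all $A,b$ given as lists of their nonzero entries, always computes $\hat x$ exactly in $O(\mathrm{nnz}(A)+\mathrm{nnz}(b))+\mathrm{poly}(d)$ steps; if $n\le\mathrm{nnz}(A)$ (for instance if $A$ has no zero row), this is $O(\mathrm{nnz}(A))+\mathrm{poly}(d)$. The constant and the polynomial depend only on $k_1,k_2$. -/

import Mathlib

open MeasureTheory ProbabilityTheory Filter Topology Matrix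

/-! ## Orlicz norms -/

/-- The admissible functions `G` (property `𝒫`): even, with `G 0 = 0` and `G 1 = 1`, nondecreasing
and convex on `[0, ∞)`, affine beyond `1`, twice differentiable near `0` on the right with a first
or second right derivative at `0` that is positive, and of at most quadratic growth. -/
structure PropertyP (G : ℝ → ℝ) : Prop where
  nonneg : ∀ x, 0 ≤ G x
  monotoneOn : MonotoneOn G (Set.Ici 0)
  convexOn : ConvexOn ℝ (Set.Ici 0) G
  map_zero : G 0 = 0
  map_one : G 1 = 1
  even : ∀ x, G (-x) = G x
  linear : ∃ s : ℝ, 0 < s ∧ ∀ x, 1 < x → G x = s * x + (1 - s)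
  smooth : ∃ δ : ℝ, 0 < δ ∧
    (∀ x ∈ Set.Ioo 0 δ, DifferentiableAt ℝ G x ∧ DifferentiableAt ℝ (deriv G) x) ∧
    ∃ g₁ g₂ : ℝ, HasDerivWithinAt G g₁ (Set.Ici 0) 0 ∧
      Tendsto (fun h => (deriv G h - g₁) / h) (𝓝[>] 0) (𝓝 g₂) ∧ (0 < g₁ ∨ 0 < g₂)
  growth : ∃ C : ℝ, 0 < C ∧ ∀ x y, 0 < x → x < y → G y ≤ C * (y / x) ^ 2 * G x

/-- The Orlicz norm `‖x‖_G = inf {α > 0 | ∑ i, G (|x i| / α) ≤ 1}` on `ℝⁿ`. -/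
noncomputable def orliczNorm (G : ℝ → ℝ) {n : ℕ} (x : Fin n → ℝ) : ℝ :=
  sInf {α : ℝ | 0 < α ∧ ∑ i, G (|x i| / α) ≤ 1}

/-! ## The distribution with CDF `1 - exp (-G t)` -/

theorem PropertyP.continuousOn {G : ℝ → ℝ} (hG : PropertyP G) : ContinuousOn G (Set.Ici 0) := by
  intro x hx
  rcases eq_or_lt_of_le (Set.mem_Ici.1 hx) with h | h
  · subst h
    obtain ⟨_, _, _, _, _, hd, _⟩ := hG.smooth
    exact hd.continuousWithinAt
  · have h1 : ContinuousOn G (interior (Set.Ici 0)) := hG.convexOn.continuousOn_interior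
    rw [interior_Ici] at h1
    exact (h1.continuousAt (Ioi_mem_nhds h)).continuousWithinAt

/-- The cumulative distribution function `t ↦ 1 - exp (-G t)` for `t ≥ 0`, and `0` for `t < 0`. -/
noncomputable def orliczCDF {G : ℝ → ℝ} (hG : PropertyP G) : StieltjesFunction ℝ where
  toFun t := if 0 ≤ t then 1 - Real.exp (-G t) else 0
  mono' := by
    intro a b hab
    by_cases ha : 0 ≤ a
    · have hb : 0 ≤ b := ha.trans hab
      simp only [ha, hb, if_true]
      have := hG.monotoneOn (Set.mem_Ici.2 ha) (Set.mem_Ici.2 hb) hab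
      have := Real.exp_le_exp.2 (neg_le_neg this)
      linarith
    · by_cases hb : 0 ≤ b
      · simp only [ha, hb, if_true, if_false]
        have := Real.exp_le_one_iff.2 (neg_nonpos.2 (hG.nonneg b))
        linarith
      · simp [ha, hb]
  right_continuous' := by
    intro x
    by_cases hx : 0 ≤ x
    · have h1 : ContinuousWithinAt (fun t => 1 - Real.exp (-G t)) (Set.Ici x) x := by
        have := (hG.continuousOn x hx).mono (Set.Ici_subset_Ici.2 hx)
        exact continuousWithinAt_const.sub (Real.continuous_exp.continuousAt.comp_continuousWithinAt
          this.neg)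
      refine h1.congr (fun y hy => ?_) ?_
      · simp [hx.trans hy]
      · simp [hx]
    · have h1 : ContinuousWithinAt (fun _ : ℝ => (0 : ℝ)) (Set.Ici x) x := continuousWithinAt_const
      refine h1.congr_of_eventuallyEq ?_ (by simp [hx])
      filter_upwards [nhdsWithin_le_nhds (Iio_mem_nhds (not_le.1 hx))] with y hy
      simp [not_le.2 (Set.mem_Iio.1 hy)]

/-- The distribution on `ℝ` with cumulative distribution function `orliczCDF hG`. -/
noncomputable def orliczLaw {G : ℝ → ℝ} (hG : PropertyP G) : Measure ℝ := (orliczCDF hG).measure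

theorem isProbabilityMeasure_orliczLaw {G : ℝ → ℝ} (hG : PropertyP G) :
    IsProbabilityMeasure (orliczLaw hG) := by
  refine (orliczCDF hG).isProbabilityMeasure ?_ ?_
  · refine tendsto_const_nhds.congr' ?_
    filter_upwards [eventually_lt_atBot (0 : ℝ)] with t ht
    simp [orliczCDF, not_le.2 ht]
  · obtain ⟨s, hs, hlin⟩ := hG.linear
    have h0 : Tendsto (fun t : ℝ => 1 - Real.exp (-(s * t + (1 - s)))) atTop (𝓝 (1 - 0)) := by
      refine tendsto_const_nhds.sub (Real.tendsto_exp_neg_atTop_nhds_zero.comp ?_)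
      exact tendsto_atTop_add_const_right _ _ (tendsto_id.const_mul_atTop hs)
    rw [sub_zero] at h0
    refine h0.congr' ?_
    filter_upwards [eventually_gt_atTop (1 : ℝ)] with t ht
    have : (0 : ℝ) ≤ t := by linarith
    simp [orliczCDF, this, hlin t ht]

/-! ## Moore-Penrose pseudoinverse -/

/-- The four Penrose equations: `X` is a Moore-Penrose pseudoinverse of the real matrix `M`. -/
structure IsMoorePenrose {m n : ℕ} (M : Matrix (Fin m) (Fin n) ℝ)
    (X : Matrix (Fin n) (Fin m) ℝ) : Prop where
  mul_mul_left : M * X * M = M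
  mul_mul_right : X * M * X = X
  symm_left : (M * X)ᵀ = M * X
  symm_right : (X * M)ᵀ = X * M

theorem exists_isMoorePenrose {m n : ℕ} (M : Matrix (Fin m) (Fin n) ℝ) :
    ∃ X, IsMoorePenrose M X := by
  have hH : (Mᵀ * M).IsHermitian := by
    simpa [conjTranspose_eq_transpose_of_trivial] using isHermitian_conjTranspose_mul_self M
  obtain ⟨P, hPs, hPHP, hHPH, hcomm⟩ : ∃ P : Matrix (Fin n) (Fin n) ℝ, Pᵀ = P ∧
      P * (Mᵀ * M) * P = P ∧ (Mᵀ * M) * P * (Mᵀ * M) = Mᵀ * M ∧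
      P * (Mᵀ * M) = (Mᵀ * M) * P := by
    obtain ⟨U, l, hUU, hspec⟩ : ∃ (U : Matrix (Fin n) (Fin n) ℝ) (l : Fin n → ℝ),
        Uᵀ * U = 1 ∧ Mᵀ * M = U * diagonal l * Uᵀ := by
      refine ⟨(hH.eigenvectorUnitary : Matrix (Fin n) (Fin n) ℝ), hH.eigenvalues, ?_, ?_⟩
      · have := Unitary.coe_star_mul_self hH.eigenvectorUnitary
        simpa [star_eq_conjTranspose, conjTranspose_eq_transpose_of_trivial] using this
      · have := hH.spectral_theorem
        simpa [Unitary.conjStarAlgAut_apply, star_eq_conjTranspose,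
          conjTranspose_eq_transpose_of_trivial, Function.comp_def] using this
    have key : ∀ D E : Matrix (Fin n) (Fin n) ℝ,
        (U * D * Uᵀ) * (U * E * Uᵀ) = U * (D * E) * Uᵀ := by
      intro D E
      calc (U * D * Uᵀ) * (U * E * Uᵀ) = U * D * (Uᵀ * U) * E * Uᵀ := by
            simp only [Matrix.mul_assoc]
        _ = U * (D * E) * Uᵀ := by rw [hUU]; simp only [Matrix.mul_assoc, Matrix.one_mul]
    refine ⟨U * diagonal (fun i => (l i)⁻¹) * Uᵀ, ?_, ?_, ?_, ?_⟩
    · simp [transpose_mul, Matrix.mul_assoc]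
    · rw [hspec, key, key, diagonal_mul_diagonal, diagonal_mul_diagonal]
      congr 3; ext i
      by_cases h : l i = 0 <;> simp [h]
    · rw [hspec, key, key, diagonal_mul_diagonal, diagonal_mul_diagonal]
      congr 3; ext i
      by_cases h : l i = 0 <;> simp [h]
    · rw [hspec, key, key, diagonal_mul_diagonal, diagonal_mul_diagonal]
      congr 3; ext i
      exact mul_comm _ _
  have hM : M * (P * (Mᵀ * M)) = M := by
    have h0 : Mᴴ * M * (P * (Mᵀ * M) - 1) = 0 := by
      rw [conjTranspose_eq_transpose_of_trivial, Matrix.mul_sub, Matrix.mul_one,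
        ← Matrix.mul_assoc (Mᵀ * M), hHPH, sub_self]
    have h1 := (conjTranspose_mul_self_mul_eq_zero M _).1 h0
    rwa [Matrix.mul_sub, Matrix.mul_one, sub_eq_zero] at h1
  refine ⟨P * Mᵀ, ?_, ?_, ?_, ?_⟩
  · simpa only [Matrix.mul_assoc] using hM
  · calc P * Mᵀ * M * (P * Mᵀ) = (P * (Mᵀ * M) * P) * Mᵀ := by simp only [Matrix.mul_assoc]
      _ = P * Mᵀ := by rw [hPHP]
  · simp [transpose_mul, hPs, Matrix.mul_assoc]
  · rw [Matrix.mul_assoc, transpose_mul, hPs, transpose_mul, transpose_transpose, hcomm]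

/-- The Moore-Penrose pseudoinverse `M†` (the Penrose equations have exactly one solution). -/
noncomputable def pinv {m n : ℕ} (M : Matrix (Fin m) (Fin n) ℝ) : Matrix (Fin n) (Fin m) ℝ :=
  (exists_isMoorePenrose M).choose

/-! ## The random sketch and the sketched least-squares solution -/

/-- The random choices of the algorithm: the diagonal entries of `D`, the hash values and the signs
of the sparse embedding `Π₁`, and the unscaled entries of the Gaussian matrix `Π₂`. -/
abbrev Sample (n t₁ t₂ : ℕ) : Type :=
  (Fin n → ℝ) × (Fin n → Fin t₁) × (Fin n → Bool) × (Fin t₂ → Fin t₁ → ℝ)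

/-- The joint law of the random choices. All of them are independent; the entries of `D` have
CDF `1 - exp (-G t)`, hash values and signs are uniform, the Gaussian entries are standard. -/
noncomputable def sampleLaw {G : ℝ → ℝ} (hG : PropertyP G) (n t₁ t₂ : ℕ) :
    Measure (Sample n t₁ t₂) :=
  (Measure.pi fun _ => orliczLaw hG).prod <|
    (Measure.pi fun _ => uniformOn (Set.univ : Set (Fin t₁))).prod <|
      (Measure.pi fun _ => uniformOn (Set.univ : Set Bool)).prod <|
        Measure.pi fun _ => Measure.pi fun _ => gaussianReal 0 1

/-- The value `±1` of a random sign. -/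
def signValue (s : Bool) : ℝ := if s then 1 else -1

/-- The inverse of the diagonal matrix with diagonal `u` (whose entries are almost surely
positive). -/
noncomputable def diagInv {n : ℕ} (u : Fin n → ℝ) : Matrix (Fin n) (Fin n) ℝ :=
  Matrix.diagonal fun i => (u i)⁻¹

/-- The sparse embedding matrix `Φ Y`: `Y` is the diagonal matrix of the signs, and `Φ` is the
0-1 matrix whose only nonzero entry in column `i` is in row `h i`. -/
def sparseEmbedding {n t : ℕ} (h : Fin n → Fin t) (σ : Fin n → Bool) :
    Matrix (Fin t) (Fin n) ℝ :=
  (Matrix.of fun k i => if h i = k then (1 : ℝ) else 0) *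
    Matrix.diagonal fun i => signValue (σ i)

/-- The Gaussian sketching matrix with `t₂` rows: entries `g` scaled by `1 / √t₂`. -/
noncomputable def gaussianMatrix {t₁ t₂ : ℕ} (g : Fin t₂ → Fin t₁ → ℝ) :
    Matrix (Fin t₂) (Fin t₁) ℝ :=
  (1 / Real.sqrt t₂) • Matrix.of g

/-- The sketching matrix `Π₂ Π₁ D⁻¹`. -/
noncomputable def sketchMatrix {n t₁ t₂ : ℕ} (ω : Sample n t₁ t₂) : Matrix (Fin t₂) (Fin n) ℝ :=
  gaussianMatrix ω.2.2.2 * sparseEmbedding ω.2.1 ω.2.2.1 * diagInv ω.1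

/-- The output `x̂ = (Π₂ Π₁ D⁻¹ A)† Π₂ Π₁ D⁻¹ b` of the algorithm. -/
noncomputable def sketchedSolution {n d t₁ t₂ : ℕ} (A : Matrix (Fin n) (Fin d) ℝ)
    (b : Fin n → ℝ) (ω : Sample n t₁ t₂) : Fin d → ℝ :=
  pinv (sketchMatrix ω * A) *ᵥ (sketchMatrix ω *ᵥ b)

/-! ## Machine model: a randomized real RAM with a step count

Programs are finite texts, the same for all input sizes. The memory consists of one-dimensional
arrays of natural numbers and two-dimensional arrays of reals; each array has a fixed name, and
cells are accessed by computed natural-number indices. One step is charged for every node of an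
expression that is evaluated (arithmetic operation, constant, memory access, random draw), for
every assignment, comparison and loop, and for every loop iteration. Reals can only be combined
arithmetically and compared; they cannot be converted into natural numbers. -/

/-- The memory: natural-number arrays `nat name i` and real arrays `real name i j`. -/
structure Memory where
  nat : ℕ → ℕ → ℕ
  real : ℕ → ℕ → ℕ → ℝ

/-- The random numbers available to a program, as families of independent draws: `orlicz i` from
the distribution with CDF `1 - exp (-G t)`, `unif m i` uniform on `{0, …, m - 1}`, `sign i` a
uniform sign `±1`, `gauss i j` a standard Gaussian. A draw costs one step when it is used. -/
structure RandomTape where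
  orlicz : ℕ → ℝ
  unif : ℕ → ℕ → ℕ
  sign : ℕ → ℝ
  gauss : ℕ → ℕ → ℝ

/-- Natural-number expressions. -/
inductive NatExpr : Type
  | const (k : ℕ)
  | cell (a : ℕ) (i : NatExpr)
  | add (e f : NatExpr)
  | sub (e f : NatExpr)
  | unif (m i : NatExpr)

/-- Real expressions. -/
inductive RealExpr : Type
  | const (q : ℚ)
  | cell (a : ℕ) (i j : NatExpr)
  | add (e f : RealExpr)
  | sub (e f : RealExpr)
  | mul (e f : RealExpr)
  | div (e f : RealExpr)
  | orlicz (i : NatExpr)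
  | sign (i : NatExpr)
  | gauss (i j : NatExpr)

/-- Value of a natural-number expression. -/
def NatExpr.eval (ρ : RandomTape) (s : Memory) : NatExpr → ℕ
  | .const k => k
  | .cell a i => s.nat a (i.eval ρ s)
  | .add e f => e.eval ρ s + f.eval ρ s
  | .sub e f => e.eval ρ s - f.eval ρ s
  | .unif m i => ρ.unif (m.eval ρ s) (i.eval ρ s)

/-- Number of nodes of a natural-number expression. -/
def NatExpr.cost : NatExpr → ℕ
  | .const _ => 1
  | .cell _ i => i.cost + 1
  | .add e f => e.cost + f.cost + 1
  | .sub e f => e.cost + f.cost + 1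
  | .unif m i => m.cost + i.cost + 1

/-- Value of a real expression. -/
noncomputable def RealExpr.eval (ρ : RandomTape) (s : Memory) : RealExpr → ℝ
  | .const q => (q : ℝ)
  | .cell a i j => s.real a (i.eval ρ s) (j.eval ρ s)
  | .add e f => e.eval ρ s + f.eval ρ s
  | .sub e f => e.eval ρ s - f.eval ρ s
  | .mul e f => e.eval ρ s * f.eval ρ s
  | .div e f => e.eval ρ s / f.eval ρ s
  | .orlicz i => ρ.orlicz (i.eval ρ s)
  | .sign i => ρ.sign (i.eval ρ s)
  | .gauss i j => ρ.gauss (i.eval ρ s) (j.eval ρ s)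

/-- Number of nodes of a real expression. -/
def RealExpr.cost : RealExpr → ℕ
  | .const _ => 1
  | .cell _ i j => i.cost + j.cost + 1
  | .add e f => e.cost + f.cost + 1
  | .sub e f => e.cost + f.cost + 1
  | .mul e f => e.cost + f.cost + 1
  | .div e f => e.cost + f.cost + 1
  | .orlicz i => i.cost + 1
  | .sign i => i.cost + 1
  | .gauss i j => i.cost + j.cost + 1

/-- Programs. `loop x e c` runs `c` with cell `0` of the array `x` set to `0, 1, …, e - 1` in turn,
the bound `e` being evaluated once. -/
inductive Program : Type
  | skip
  | seq (c₁ c₂ : Program)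
  | setNat (a : ℕ) (i e : NatExpr)
  | setReal (a : ℕ) (i j : NatExpr) (e : RealExpr)
  | ifNatLt (e f : NatExpr) (c₁ c₂ : Program)
  | ifRealLt (e f : RealExpr) (c₁ c₂ : Program)
  | loop (x : ℕ) (e : NatExpr) (c : Program)

/-- Write a value into a cell of a natural-number array. -/
def Memory.writeNat (s : Memory) (a i v : ℕ) : Memory :=
  { s with nat := fun a' i' => if a' = a ∧ i' = i then v else s.nat a' i' }

/-- Write a value into a cell of a real array. -/
noncomputable def Memory.writeReal (s : Memory) (a i j : ℕ) (v : ℝ) : Memory :=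
  { s with real := fun a' i' j' => if a' = a ∧ i' = i ∧ j' = j then v else s.real a' i' j' }

/-- Final memory and number of steps of a run of a program. -/
noncomputable def Program.run (ρ : RandomTape) : Program → Memory → Memory × ℕ
  | .skip, s => (s, 1)
  | .seq c₁ c₂, s =>
      let r₁ := c₁.run ρ s
      let r₂ := c₂.run ρ r₁.1
      (r₂.1, r₁.2 + r₂.2)
  | .setNat a i e, s => (s.writeNat a (i.eval ρ s) (e.eval ρ s), i.cost + e.cost + 1)
  | .setReal a i j e, s =>
      (s.writeReal a (i.eval ρ s) (j.eval ρ s) (e.eval ρ s), i.cost + j.cost + e.cost + 1)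
  | .ifNatLt e f c₁ c₂, s =>
      let r := if e.eval ρ s < f.eval ρ s then c₁.run ρ s else c₂.run ρ s
      (r.1, e.cost + f.cost + 1 + r.2)
  | .ifRealLt e f c₁ c₂, s =>
      let r := if e.eval ρ s < f.eval ρ s then c₁.run ρ s else c₂.run ρ s
      (r.1, e.cost + f.cost + 1 + r.2)
  | .loop x e c, s =>
      Nat.rec (s, e.cost + 1)
        (fun i r =>
          let r' := c.run ρ (r.1.writeNat x 0 i)
          (r'.1, r.2 + 1 + r'.2))
        (e.eval ρ s)

/-! ## Input and output of the regression program -/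

/-- Number of nonzero entries of a matrix. -/
noncomputable def nnz {n d : ℕ} (A : Matrix (Fin n) (Fin d) ℝ) : ℕ :=
  Nat.card {p : Fin n × Fin d // A p.1 p.2 ≠ 0}

/-- Number of nonzero entries of a vector. -/
noncomputable def nnzVec {n : ℕ} (b : Fin n → ℝ) : ℕ :=
  Nat.card {i : Fin n // b i ≠ 0}

/-- The memory holds the input `(A, b)` in sparse form: cells `0`-`3` of natural-number array `0`
hold `n`, `d` and the numbers of nonzero entries; natural-number arrays `1`, `2` and real array `0`
list row, column and value of every nonzero entry of `A` exactly once, in any order; natural-number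
array `3` and real array `1` list index and value of every nonzero entry of `b` likewise. -/
structure EncodesInput {n d : ℕ} (A : Matrix (Fin n) (Fin d) ℝ) (b : Fin n → ℝ)
    (s : Memory) : Prop where
  rows : s.nat 0 0 = n
  cols : s.nat 0 1 = d
  nnzA : s.nat 0 2 = nnz A
  nnzb : s.nat 0 3 = nnzVec b
  listA : ∃ e : Fin (nnz A) ≃ {p : Fin n × Fin d // A p.1 p.2 ≠ 0}, ∀ k : Fin (nnz A),
    s.nat 1 k = (e k).1.1 ∧ s.nat 2 k = (e k).1.2 ∧ s.real 0 k 0 = A (e k).1.1 (e k).1.2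
  listb : ∃ e : Fin (nnzVec b) ≃ {i : Fin n // b i ≠ 0}, ∀ k : Fin (nnzVec b),
    s.nat 3 k = (e k).1 ∧ s.real 1 k 0 = b (e k).1

/-- The memory holds the vector `x` in real array `2`. -/
def HoldsOutput {d : ℕ} (x : Fin d → ℝ) (s : Memory) : Prop :=
  ∀ j : Fin d, s.real 2 j 0 = x j

/-- The random choices `ω` are the ones that a program reads from the tape `ρ`. -/
structure TapeAgrees {n t₁ t₂ : ℕ} (ρ : RandomTape) (ω : Sample n t₁ t₂) : Prop where
  orlicz : ∀ i : Fin n, ρ.orlicz i = ω.1 i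
  unif : ∀ i : Fin n, ρ.unif t₁ i = ω.2.1 i
  sign : ∀ i : Fin n, ρ.sign i = signValue (ω.2.2.1 i)
  gauss : ∀ (i : Fin t₂) (j : Fin t₁), ρ.gauss i j = ω.2.2.2 i j

/-! ## Elementary properties of admissible functions -/

namespace PropertyP

variable {G : ℝ → ℝ}

/-! Accuracy. If the entries `u i` of `D` are independent with CDF `1 - exp (-G)`, then the
probability that `|x i| / u i < c` for every `i` is exactly `exp (-∑ G (|x i| / c))`, and the
exponent is the sum that defines `‖x‖_G`. So `‖D⁻¹ x‖_∞` is unlikely to be much smaller than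
`‖x‖_G`: convexity turns a factor `2 t` below the norm into failure probability `exp (-t)`
(`pi_orliczLaw_contract_le`). With `t` of order `d log n` this survives a union bound over a net of
the column space, whose mesh is only polynomially small in `n` because `‖·‖_∞ ≤ ‖·‖_G ≤ n ‖·‖_∞`
and, with high probability, every `u i` exceeds `1 / (40 n)` (`exists_no_contraction`).

In the other direction one fixed vector suffices: the optimal residual `r = A x - b`. The second
moment of `1 / u` may be infinite, but after truncation it is a sum of `O(log n)` dyadic levels,
each controlled by the quadratic growth of `G`, so `‖D⁻¹ r‖₂ ≤ O(√log n) ‖r‖_G` with high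
probability (`exists_dilation`).

The sketch `Π₂ Π₁` distorts the `ℓ₂` norm on the range of `D⁻¹ A`, and on the line of `D⁻¹ r`, by
constants only. For `Π₁` this is a second-moment computation with random signs and hash collisions
(`sparseEmbedding_subspace`); for `Π₂` it is a Chernoff bound and a net (`gaussianMatrix_subspace`).
Since `M M†` is an orthogonal projection, the sketched `A (x̂ - x)` is no longer than the sketched
`r` (`pinv_mulVec_sub_le`). Chaining lower bound, projection and upper bound controls `‖A (x̂ -
x)‖_G` by `O(d log^{3/2} n) ‖r‖_G`, which is then weakened to `log² n`; the triangle inequality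
finishes. Four bad events of probability at most `1/20` leave `0.8`.

Running time. Each nonzero entry of `A` and `b` is added to one cell of the sparse sketch in
constant time; everything afterwards has size polynomial in `d`. The pseudoinverse is applied
exactly with rational operations only: one `B`-orthogonalises the columns of the Gram matrix `B = Mᵀ
M` and adds up rank-one terms (`IsPartialInverse.extend`). The convention `x / 0 = 0` skips
dependent columns, so no rank test is needed, and the factor `1 / √t₂` cancels, so no square root is
needed (`partialInverse_mulVec_eq_pinv`). -/

theorem mul_le_map_mul (hG : PropertyP G) {t x : ℝ} (ht : 1 ≤ t) (hx : 0 ≤ x) :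
    t * G x ≤ G (t * x) := by
  have ht0 : 0 < t := by linarith
  have h := hG.convexOn.2 (Set.mem_Ici.2 (mul_nonneg ht0.le hx)) (Set.mem_Ici.2 le_rfl)
    (inv_nonneg.2 ht0.le) (sub_nonneg.2 (inv_le_one_of_one_le₀ ht)) (by ring)
  simp only [smul_eq_mul, mul_zero, add_zero, hG.map_zero] at h
  rw [inv_mul_cancel_left₀ ht0.ne'] at h
  calc t * G x ≤ t * (t⁻¹ * G (t * x)) := mul_le_mul_of_nonneg_left h ht0.le
    _ = G (t * x) := mul_inv_cancel_left₀ ht0.ne' _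

theorem map_mul_le (hG : PropertyP G) {t x : ℝ} (ht0 : 0 ≤ t) (ht : t ≤ 1) (hx : 0 ≤ x) :
    G (t * x) ≤ t * G x := by
  have h := hG.convexOn.2 (Set.mem_Ici.2 hx) (Set.mem_Ici.2 le_rfl) ht0 (sub_nonneg.2 ht)
    (by ring)
  simpa [hG.map_zero] using h

theorem map_le_self (hG : PropertyP G) {x : ℝ} (hx0 : 0 ≤ x) (hx : x ≤ 1) : G x ≤ x := by
  simpa [hG.map_one] using hG.map_mul_le hx0 hx zero_le_one

/-- Beyond `1` the function is affine with positive slope and starts from the value `1`. This is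
what makes the Orlicz norm dominate the sup norm. -/
theorem le_one_of_map_le_one (hG : PropertyP G) {x : ℝ} (hx : G x ≤ 1) : x ≤ 1 := by
  by_contra! h
  obtain ⟨s, hs, hl⟩ := hG.linear
  rw [hl x h] at hx
  nlinarith

theorem mono (hG : PropertyP G) {x y : ℝ} (hx : 0 ≤ x) (hxy : x ≤ y) : G x ≤ G y :=
  hG.monotoneOn (Set.mem_Ici.2 hx) (Set.mem_Ici.2 (hx.trans hxy)) hxy

end PropertyP

/-! ## The Orlicz norm -/

section OrliczNorm

variable {G : ℝ → ℝ} {n : ℕ}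

theorem orliczNorm_nonneg (x : Fin n → ℝ) : 0 ≤ orliczNorm G x :=
  Real.sInf_nonneg fun _ h => h.1.le

theorem orliczNorm_le_of_sum_le {x : Fin n → ℝ} {a : ℝ} (ha : 0 < a)
    (h : ∑ i, G (|x i| / a) ≤ 1) : orliczNorm G x ≤ a :=
  csInf_le ⟨0, fun _ h => h.1.le⟩ ⟨ha, h⟩

theorem one_lt_sum_of_lt_orliczNorm {x : Fin n → ℝ} {a : ℝ} (ha : 0 < a)
    (h : a < orliczNorm G x) : 1 < ∑ i, G (|x i| / a) := by
  by_contra! h1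
  exact absurd (orliczNorm_le_of_sum_le ha h1) (not_le.2 h)

theorem sum_le_one_of_norm_le (hG : PropertyP G) {x : Fin n → ℝ} {a : ℝ} (ha : 0 < a)
    (h : n * ‖x‖ ≤ a) : ∑ i, G (|x i| / a) ≤ 1 := by
  rcases Nat.eq_zero_or_pos n with rfl | hn
  · simp
  have hn' : (1 : ℝ) ≤ n := by exact_mod_cast hn
  have h1 : ∀ i, G (|x i| / a) ≤ 1 / n := by
    intro i
    have h2 : |x i| / a ≤ 1 / n := by
      rw [div_le_div_iff₀ ha (by linarith)]
      have := norm_le_pi_norm x i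
      rw [Real.norm_eq_abs] at this
      nlinarith
    exact (hG.map_le_self (by positivity)
      (h2.trans (by rw [div_le_one (by linarith)]; exact hn'))).trans h2
  calc ∑ i, G (|x i| / a) ≤ ∑ _i : Fin n, (1 : ℝ) / n := Finset.sum_le_sum fun i _ => h1 i
    _ = 1 := by
      rw [Finset.sum_const, Finset.card_univ, Fintype.card_fin, nsmul_eq_mul]
      field_simp

theorem orliczNorm_set_nonempty (hG : PropertyP G) (x : Fin n → ℝ) :
    {α : ℝ | 0 < α ∧ ∑ i, G (|x i| / α) ≤ 1}.Nonempty :=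
  have h : 0 < n * ‖x‖ + 1 := by positivity
  ⟨n * ‖x‖ + 1, h, sum_le_one_of_norm_le hG h (by linarith)⟩

/-- The strict inequality avoids any discussion of whether the infimum is attained; later uses leave
room by an `ε` or a factor `2`. -/
theorem sum_le_one_of_orliczNorm_lt (hG : PropertyP G) {x : Fin n → ℝ} {a : ℝ}
    (h : orliczNorm G x < a) : ∑ i, G (|x i| / a) ≤ 1 := by
  obtain ⟨b, ⟨hb, hs⟩, hba⟩ := exists_lt_of_csInf_lt (orliczNorm_set_nonempty hG x) h
  have ha := hb.trans hba
  refine (Finset.sum_le_sum fun i _ => hG.mono (by positivity) ?_).trans hs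
  exact div_le_div_of_nonneg_left (abs_nonneg _) hb hba.le

theorem orliczNorm_le_mul_norm (hG : PropertyP G) (x : Fin n → ℝ) :
    orliczNorm G x ≤ n * ‖x‖ := by
  refine le_of_forall_pos_le_add fun ε hε => ?_
  have h : 0 < n * ‖x‖ + ε := by positivity
  exact orliczNorm_le_of_sum_le h (sum_le_one_of_norm_le hG h (by linarith))

theorem norm_le_orliczNorm (hG : PropertyP G) (x : Fin n → ℝ) : ‖x‖ ≤ orliczNorm G x := by
  rw [pi_norm_le_iff_of_nonneg (orliczNorm_nonneg x)]
  intro i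
  refine le_of_forall_pos_le_add fun ε hε => ?_
  have h0 : 0 < orliczNorm G x + ε := by linarith [orliczNorm_nonneg (G := G) x]
  have h := sum_le_one_of_orliczNorm_lt hG (x := x) (a := orliczNorm G x + ε) (by linarith)
  have h1 : G (|x i| / (orliczNorm G x + ε)) ≤ 1 :=
    (Finset.single_le_sum (f := fun i => G (|x i| / (orliczNorm G x + ε)))
      (fun j _ => hG.nonneg _) (Finset.mem_univ i)).trans h
  have := hG.le_one_of_map_le_one h1
  rwa [div_le_one h0] at this

/-- Convexity of `G` with weights `a / (a + b)` and `b / (a + b)`, where `a`, `b` slightly exceed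
the two norms. -/
theorem orliczNorm_add_le (hG : PropertyP G) (x y : Fin n → ℝ) :
    orliczNorm G (x + y) ≤ orliczNorm G x + orliczNorm G y := by
  refine le_of_forall_pos_le_add fun ε hε => ?_
  set a := orliczNorm G x + ε / 2 with ha
  set b := orliczNorm G y + ε / 2 with hb
  have ha0 : 0 < a := by linarith [orliczNorm_nonneg (G := G) x]
  have hb0 : 0 < b := by linarith [orliczNorm_nonneg (G := G) y]
  have hxa := sum_le_one_of_orliczNorm_lt hG (x := x) (a := a) (by linarith)
  have hyb := sum_le_one_of_orliczNorm_lt hG (x := y) (a := b) (by linarith)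
  have hab : 0 < a + b := by linarith
  have key : ∑ i, G (|(x + y) i| / (a + b)) ≤ 1 := by
    have h1 : ∀ i, G (|(x + y) i| / (a + b)) ≤
        a / (a + b) * G (|x i| / a) + b / (a + b) * G (|y i| / b) := by
      intro i
      have h2 := hG.convexOn.2 (Set.mem_Ici.2 (show 0 ≤ |x i| / a by positivity))
        (Set.mem_Ici.2 (show 0 ≤ |y i| / b by positivity))
        (show 0 ≤ a / (a + b) by positivity) (show 0 ≤ b / (a + b) by positivity)
        (by field_simp)
      simp only [smul_eq_mul] at h2
      refine (hG.mono (by positivity) ?_).trans h2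
      have h3 : a / (a + b) * (|x i| / a) + b / (a + b) * (|y i| / b) =
          (|x i| + |y i|) / (a + b) := by field_simp
      rw [h3]
      gcongr
      exact abs_add_le _ _
    calc ∑ i, G (|(x + y) i| / (a + b)) ≤
        ∑ i, (a / (a + b) * G (|x i| / a) + b / (a + b) * G (|y i| / b)) :=
          Finset.sum_le_sum fun i _ => h1 i
      _ = a / (a + b) * ∑ i, G (|x i| / a) + b / (a + b) * ∑ i, G (|y i| / b) := by
          rw [Finset.sum_add_distrib, Finset.mul_sum, Finset.mul_sum]
      _ ≤ a / (a + b) * 1 + b / (a + b) * 1 := by gcongr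
      _ = 1 := by field_simp
  have := orliczNorm_le_of_sum_le hab key
  linarith

theorem orliczNorm_smul_le (hG : PropertyP G) (c : ℝ) (x : Fin n → ℝ) :
    orliczNorm G (c • x) ≤ |c| * orliczNorm G x := by
  rcases eq_or_ne c 0 with rfl | hc
  · have := orliczNorm_le_mul_norm hG (0 : Fin n → ℝ)
    simpa using this
  have hc' : 0 < |c| := abs_pos.2 hc
  refine le_of_forall_pos_le_add fun ε hε => ?_
  have h := sum_le_one_of_orliczNorm_lt hG (x := x) (a := orliczNorm G x + ε / |c|)
    (by linarith [show 0 < ε / |c| by positivity])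
  have h0 := orliczNorm_nonneg (G := G) x
  have := orliczNorm_le_of_sum_le (G := G) (x := c • x)
    (a := |c| * (orliczNorm G x + ε / |c|)) (by positivity) (by
      refine le_trans (le_of_eq ?_) h
      refine Finset.sum_congr rfl fun i _ => ?_
      congr 1
      rw [Pi.smul_apply, smul_eq_mul, abs_mul, mul_div_mul_left _ _ hc'.ne'])
  refine this.trans (le_of_eq ?_)
  field_simp

theorem orliczNorm_sub_le_add (hG : PropertyP G) (x y : Fin n → ℝ) :
    orliczNorm G x ≤ orliczNorm G y + orliczNorm G (x - y) := by
  simpa using orliczNorm_add_le hG y (x - y)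

theorem continuous_orliczNorm (hG : PropertyP G) :
    Continuous (orliczNorm G : (Fin n → ℝ) → ℝ) := by
  have : LipschitzWith n (orliczNorm G : (Fin n → ℝ) → ℝ) := by
    refine LipschitzWith.of_le_add_mul _ fun x y => ?_
    rw [dist_eq_norm]
    exact (orliczNorm_sub_le_add hG x y).trans
      (add_le_add le_rfl (by simpa using orliczNorm_le_mul_norm hG (x - y)))
  exact this.continuous

/-- The minimum is taken over the range of `A`, not over `x`: `A` may have a kernel, so the
objective is coercive only as a function of `A x`. -/
theorem exists_orliczNorm_minimizer (hG : PropertyP G) {d : ℕ} (A : Matrix (Fin n) (Fin d) ℝ)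
    (b : Fin n → ℝ) : ∃ xmin : Fin d → ℝ,
      ∀ x, orliczNorm G (A.mulVec xmin - b) ≤ orliczNorm G (A.mulVec x - b) := by
  let V := LinearMap.range A.mulVecLin
  have hc : Continuous fun v : V => orliczNorm G ((v : Fin n → ℝ) - b) :=
    (continuous_orliczNorm hG).comp (by fun_prop)
  have ht : Tendsto (fun v : V => orliczNorm G ((v : Fin n → ℝ) - b)) (cocompact V) atTop := by
    refine tendsto_atTop_mono (f := fun v : V => ‖v‖ - ‖b‖) (fun v => ?_)
      (tendsto_atTop_add_const_right _ _ (tendsto_norm_cocompact_atTop (E := V)))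
    exact (norm_sub_norm_le (v : Fin n → ℝ) b).trans (norm_le_orliczNorm hG _)
  obtain ⟨v, hv⟩ := hc.exists_forall_le ht
  obtain ⟨x, hx⟩ := v.2
  refine ⟨x, fun y => ?_⟩
  have := hv ⟨A.mulVecLin y, y, rfl⟩
  rw [← hx] at this
  simpa using this

end OrliczNorm

/-! ## Tail probabilities of the exponential-type law -/

section Law

variable {G : ℝ → ℝ} (hG : PropertyP G)

theorem tendsto_orliczCDF_atBot : Tendsto (orliczCDF hG) atBot (𝓝 0) := by
  refine tendsto_const_nhds.congr' ?_
  filter_upwards [eventually_lt_atBot (0 : ℝ)] with t ht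
  simp [orliczCDF, not_le.2 ht]

theorem orliczLaw_Iic {a : ℝ} (ha : 0 ≤ a) :
    orliczLaw hG (Set.Iic a) = ENNReal.ofReal (1 - Real.exp (-G a)) := by
  rw [orliczLaw, StieltjesFunction.measure_Iic _ (tendsto_orliczCDF_atBot hG)]
  simp [orliczCDF, ha]

theorem orliczLaw_Iic_le {a : ℝ} (ha : 0 ≤ a) :
    orliczLaw hG (Set.Iic a) ≤ ENNReal.ofReal (G a) := by
  rw [orliczLaw_Iic hG ha]
  refine ENNReal.ofReal_le_ofReal ?_
  have := Real.add_one_le_exp (-G a)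
  linarith

theorem orliczLaw_Ioi {a : ℝ} (ha : 0 ≤ a) :
    orliczLaw hG (Set.Ioi a) = ENNReal.ofReal (Real.exp (-G a)) := by
  have := isProbabilityMeasure_orliczLaw hG
  rw [← Set.compl_Iic, prob_compl_eq_one_sub measurableSet_Iic, orliczLaw_Iic hG ha]
  have h : Real.exp (-G a) ≤ 1 := Real.exp_le_one_iff.2 (neg_nonpos.2 (hG.nonneg a))
  rw [← ENNReal.ofReal_one, ← ENNReal.ofReal_sub _ (by linarith)]
  congr 1; ring

theorem pi_orliczLaw_forall_lt {n : ℕ} {a : Fin n → ℝ} (ha : ∀ i, 0 ≤ a i) :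
    Measure.pi (fun _ : Fin n => orliczLaw hG) {u | ∀ i, a i < u i} =
      ENNReal.ofReal (Real.exp (-∑ i, G (a i))) := by
  have := isProbabilityMeasure_orliczLaw hG
  have : {u : Fin n → ℝ | ∀ i, a i < u i} = Set.univ.pi fun i => Set.Ioi (a i) := by
    ext u; simp
  rw [this, Measure.pi_pi, ← Finset.sum_neg_distrib, Real.exp_sum,
    ENNReal.ofReal_prod_of_nonneg fun i _ => (Real.exp_pos _).le]
  exact Finset.prod_congr rfl fun i _ => orliczLaw_Ioi hG (ha i)

theorem pi_orliczLaw_le {n : ℕ} (i : Fin n) {a : ℝ} (ha : 0 ≤ a) :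
    Measure.pi (fun _ : Fin n => orliczLaw hG) {u | u i ≤ a} ≤ ENNReal.ofReal (G a) := by
  have := isProbabilityMeasure_orliczLaw hG
  have h := (measurePreserving_eval (fun _ : Fin n => orliczLaw hG) i).measure_preimage
    (measurableSet_Iic (a := a)).nullMeasurableSet
  exact (le_of_eq h).trans (orliczLaw_Iic_le hG ha)

/-- Union bound with `1 - exp (-y) ≤ y`. -/
theorem pi_orliczLaw_exists_le {n : ℕ} {a : Fin n → ℝ} (ha : ∀ i, 0 ≤ a i) :
    Measure.pi (fun _ : Fin n => orliczLaw hG) {u | ∃ i, u i ≤ a i} ≤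
      ENNReal.ofReal (∑ i, G (a i)) := by
  rw [Set.ofPred_exists, ENNReal.ofReal_sum_of_nonneg fun i _ => hG.nonneg _]
  exact (measure_iUnion_fintype_le _ _).trans
    (Finset.sum_le_sum fun i _ => pi_orliczLaw_le hG i (ha i))

end Law

/-! ## Dilation of a fixed vector -/

section Dilation

variable {G : ℝ → ℝ}

/-- For `v = w / u < 40`, the first level `40 / 2 ^ k` not above `v` is within a factor `2` of `v`,
so its term alone dominates `v ^ 2`; below the last level, `v ^ 2 ≤ 1 / n`. Each level is tested in
the form `u ≤ w / τ`, whose probability is at most `G (w / τ)`. -/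
theorem sq_le_dyadic_sum {n M : ℕ} (hn : 0 < n) (hM : 40 * n ≤ 2 ^ M) {w u : ℝ} (hw : 0 ≤ w)
    (hu : w / 40 < u) :
    (w / u) ^ 2 ≤ 1 / n + ∑ k ∈ Finset.range (M + 1),
      if u ≤ w / (40 / 2 ^ k) then 4 * (40 / 2 ^ k : ℝ) ^ 2 else 0 := by
  have hu0 : 0 < u := lt_of_le_of_lt (by positivity) hu
  set v := w / u with hv
  have hv0 : 0 ≤ v := by positivity
  have hv40 : v < 40 := by
    rw [hv, div_lt_iff₀ hu0]; linarith
  have hn' : (1 : ℝ) ≤ n := by exact_mod_cast hn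
  have hiff : ∀ k : ℕ, u ≤ w / (40 / 2 ^ k : ℝ) ↔ (40 / 2 ^ k : ℝ) ≤ v := by
    intro k
    rw [hv, le_div_iff₀ (by positivity), le_div_iff₀ hu0, mul_comm]
  have hnonneg : ∀ k ∈ Finset.range (M + 1),
      (0 : ℝ) ≤ if u ≤ w / (40 / 2 ^ k) then 4 * (40 / 2 ^ k : ℝ) ^ 2 else 0 := by
    intro k _
    split_ifs <;> positivity
  by_cases h : ∃ k, (40 / 2 ^ k : ℝ) ≤ v ∧ k ≤ M
  · classical
    have h1 := Nat.find_spec h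
    -- Level `0` is excluded by `v < 40`, so the first level reached has a predecessor that was not
    -- reached.
    have h2 : Nat.find h ≠ 0 := by
      intro h0
      rw [h0] at h1
      norm_num at h1
      linarith
    obtain ⟨k, hk⟩ := Nat.exists_eq_succ_of_ne_zero h2
    have h3 := Nat.find_min h (m := k) (by omega)
    rw [hk] at h1
    have h4 : v < 40 / 2 ^ k := by
      by_contra! h5
      exact h3 ⟨h5, by omega⟩
    have h6 : v ^ 2 ≤ 4 * (40 / 2 ^ (k + 1) : ℝ) ^ 2 := by
      have : (40 / 2 ^ k : ℝ) = 2 * (40 / 2 ^ (k + 1)) := by rw [pow_succ]; field_simp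
      rw [this] at h4
      nlinarith
    have h7 := Finset.single_le_sum hnonneg (Finset.mem_range.2 (show k + 1 < M + 1 by omega))
    simp only [(hiff (k + 1)).2 h1.1, if_true] at h7
    have : (0 : ℝ) ≤ 1 / n := by positivity
    linarith
  · push Not at h
    have h1 : v < 40 / 2 ^ M := by
      by_contra! h2
      exact absurd (h M h2) (lt_irrefl _)
    have h3 : (40 / 2 ^ M : ℝ) ≤ 1 / n := by
      rw [div_le_div_iff₀ (by positivity) (by linarith)]
      have : ((40 * n : ℕ) : ℝ) ≤ ((2 ^ M : ℕ) : ℝ) := by exact_mod_cast hM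
      push_cast at this
      linarith
    have h4 : v ^ 2 ≤ 1 / n := by
      have h5 : (1 : ℝ) / n ≤ 1 := by rw [div_le_one (by linarith)]; exact hn'
      nlinarith
    linarith [Finset.sum_nonneg hnonneg]

/-- Level `τ` contributes a second moment of order `τ ^ 2 * G (w / τ)`; the bound is uniform over
the levels. For `τ < 1` it is the quadratic growth condition with ratio `1 / τ`, for `1 ≤ τ ≤ 40`
monotonicity and `40 ^ 2 = 1600`. -/
theorem PropertyP.exists_map_div_le (hG : PropertyP G) : ∃ C : ℝ, 0 < C ∧ ∀ w τ : ℝ, 0 ≤ w →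
    0 < τ → τ ≤ 40 → τ ^ 2 * G (w / τ) ≤ C * G w := by
  obtain ⟨C, hC, hgr⟩ := hG.growth
  refine ⟨max C 1600, by positivity, fun w τ hw hτ hτ40 => ?_⟩
  have hGw := hG.nonneg w
  rcases hw.eq_or_lt with rfl | hw
  · simp [hG.map_zero]
  rcases lt_or_ge τ 1 with h1 | h1
  · have h2 := hgr w (w / τ) hw (by rw [lt_div_iff₀ hτ]; nlinarith)
    calc τ ^ 2 * G (w / τ) ≤ τ ^ 2 * (C * (w / τ / w) ^ 2 * G w) := by gcongr
      _ = C * G w := by field_simp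
      _ ≤ max C 1600 * G w := by gcongr; exact le_max_left _ _
  · calc τ ^ 2 * G (w / τ) ≤ 1600 * G w := by
          refine mul_le_mul (by nlinarith) (hG.mono (by positivity) ?_) (hG.nonneg _) (by norm_num)
          exact div_le_self hw.le h1
      _ ≤ max C 1600 * G w := by gcongr; exact le_max_right _ _

/-- Truncation, then Markov. Some `w i / u i` reaches `40` with probability at most `∑ G (w i / 40)
≤ 1 / 40`. Otherwise the dyadic sum `X` applies; its mean is at most `4 C (M + 1)`, and exceeding it
`40`-fold has probability at most `1 / 40`. The extra `1` in the constant collects the `n` terms `1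
/ n`. -/
theorem exists_dilation_of_sum_le_one (hG : PropertyP G) : ∃ K : ℝ, 0 < K ∧ ∀ n M : ℕ, 0 < n →
    40 * n ≤ 2 ^ M → ∀ w : Fin n → ℝ, (∀ i, 0 ≤ w i) → ∑ i, G (w i) ≤ 1 →
    ∃ E : Set (Fin n → ℝ), MeasurableSet E ∧
      Measure.pi (fun _ : Fin n => orliczLaw hG) Eᶜ ≤ ENNReal.ofReal (1 / 20) ∧
      ∀ u ∈ E, ∑ i, (w i / u i) ^ 2 ≤ K * (M + 1) := by
  obtain ⟨C, hC, hCG⟩ := hG.exists_map_div_le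
  refine ⟨160 * C + 1, by positivity, fun n M hn hM w hw hsum => ?_⟩
  have := isProbabilityMeasure_orliczLaw hG
  set μ := Measure.pi (fun _ : Fin n => orliczLaw hG)
  have hn' : (1 : ℝ) ≤ n := by exact_mod_cast hn
  let X : (Fin n → ℝ) → ENNReal := fun u => ∑ i, ∑ k ∈ Finset.range (M + 1),
    Set.indicator {u : Fin n → ℝ | u i ≤ w i / (40 / 2 ^ k)}
      (fun _ => ENNReal.ofReal (4 * (40 / 2 ^ k : ℝ) ^ 2)) u
  have hms : ∀ (i : Fin n) (a : ℝ), MeasurableSet {u : Fin n → ℝ | u i ≤ a} := fun i a =>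
    measurableSet_le (measurable_pi_apply i) measurable_const
  have hXm : Measurable X := by
    refine Finset.measurable_sum _ fun i _ => Finset.measurable_sum _ fun k _ => ?_
    exact measurable_const.indicator (hms i _)
  have hXint : ∫⁻ u, X u ∂μ ≤ ENNReal.ofReal (4 * C * (M + 1)) := by
    have h1 : ∫⁻ u, X u ∂μ = ∑ i, ∑ k ∈ Finset.range (M + 1),
        ENNReal.ofReal (4 * (40 / 2 ^ k : ℝ) ^ 2) * μ {u | u i ≤ w i / (40 / 2 ^ k)} := by
      rw [lintegral_finsetSum _ fun i _ => Finset.measurable_sum _ fun k _ =>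
        measurable_const.indicator (hms i _)]
      refine Finset.sum_congr rfl fun i _ => ?_
      rw [lintegral_finsetSum _ fun k _ => measurable_const.indicator (hms i _)]
      exact Finset.sum_congr rfl fun k _ => lintegral_indicator_const (hms i _) _
    have h2 : ∀ i, ∀ k ∈ Finset.range (M + 1),
        ENNReal.ofReal (4 * (40 / 2 ^ k : ℝ) ^ 2) * μ {u | u i ≤ w i / (40 / 2 ^ k)} ≤
          ENNReal.ofReal (4 * C * G (w i)) := by
      intro i k _
      have hwi := hw i
      calc ENNReal.ofReal (4 * (40 / 2 ^ k : ℝ) ^ 2) * μ {u | u i ≤ w i / (40 / 2 ^ k)} ≤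
          ENNReal.ofReal (4 * (40 / 2 ^ k : ℝ) ^ 2) *
            ENNReal.ofReal (G (w i / (40 / 2 ^ k))) := by
            gcongr
            exact pi_orliczLaw_le hG i (by positivity)
        _ = ENNReal.ofReal (4 * (40 / 2 ^ k : ℝ) ^ 2 * G (w i / (40 / 2 ^ k))) :=
            (ENNReal.ofReal_mul (by positivity)).symm
        _ ≤ ENNReal.ofReal (4 * C * G (w i)) := by
            refine ENNReal.ofReal_le_ofReal ?_
            have := hCG (w i) (40 / 2 ^ k) hwi (by positivity)
              (div_le_self (by norm_num) (one_le_pow₀ (by norm_num)))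
            linarith
    rw [h1]
    calc _ ≤ ∑ i, ∑ _k ∈ Finset.range (M + 1), ENNReal.ofReal (4 * C * G (w i)) :=
          Finset.sum_le_sum fun i _ => Finset.sum_le_sum (h2 i)
      _ = ENNReal.ofReal (∑ i, ∑ _k ∈ Finset.range (M + 1), 4 * C * G (w i)) := by
          have h0 : ∀ i, 0 ≤ 4 * C * G (w i) := fun i => by have := hG.nonneg (w i); positivity
          rw [ENNReal.ofReal_sum_of_nonneg fun i _ => Finset.sum_nonneg fun _ _ => h0 i]
          exact Finset.sum_congr rfl fun i _ =>
            (ENNReal.ofReal_sum_of_nonneg fun _ _ => h0 i).symm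
      _ ≤ ENNReal.ofReal (4 * C * (M + 1)) := by
          refine ENNReal.ofReal_le_ofReal ?_
          simp only [Finset.sum_const, Finset.card_range, nsmul_eq_mul]
          rw [← Finset.mul_sum, ← Finset.mul_sum]
          push_cast
          have : (0 : ℝ) ≤ (M + 1) * (4 * C) := by positivity
          nlinarith
  refine ⟨{u | ∀ i, w i / 40 < u i} ∩ {u | X u < ENNReal.ofReal (160 * C * (M + 1))}, ?_, ?_, ?_⟩
  · refine MeasurableSet.inter ?_ (measurableSet_lt hXm measurable_const)
    rw [Set.ofPred_forall]
    exact MeasurableSet.iInter fun i => measurableSet_lt measurable_const (measurable_pi_apply i)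
  · have h1 : μ {u | ∃ i, u i ≤ w i / 40} ≤ ENNReal.ofReal (1 / 40) := by
      refine (pi_orliczLaw_exists_le hG fun i => by have := hw i; positivity).trans ?_
      refine ENNReal.ofReal_le_ofReal ?_
      calc ∑ i, G (w i / 40) ≤ ∑ i, 1 / 40 * G (w i) := by
            refine Finset.sum_le_sum fun i _ => ?_
            have := hG.map_mul_le (t := 1 / 40) (by norm_num) (by norm_num) (hw i)
            rwa [one_div_mul_eq_div] at this
        _ ≤ 1 / 40 := by rw [← Finset.mul_sum]; linarith
    have h2 : μ {u | ENNReal.ofReal (160 * C * (M + 1)) ≤ X u} ≤ ENNReal.ofReal (1 / 40) := by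
      have hpos : (0 : ℝ) < 160 * C * (M + 1) := by positivity
      refine (meas_ge_le_lintegral_div hXm.aemeasurable
        (by simpa using hpos) ENNReal.ofReal_ne_top).trans ?_
      refine (ENNReal.div_le_div_right hXint _).trans ?_
      rw [← ENNReal.ofReal_div_of_pos hpos]
      refine ENNReal.ofReal_le_ofReal (le_of_eq ?_)
      field_simp
      norm_num
    calc _ ≤ μ ({u | ∃ i, u i ≤ w i / 40} ∪ {u | ENNReal.ofReal (160 * C * (M + 1)) ≤ X u}) := by
          refine measure_mono fun u hu => ?_
          simp only [Set.mem_compl_iff, Set.mem_inter_iff, Set.mem_ofPred_eq, not_and_or,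
            not_forall, not_lt] at hu
          exact hu
      _ ≤ ENNReal.ofReal (1 / 40) + ENNReal.ofReal (1 / 40) :=
          (measure_union_le _ _).trans (add_le_add h1 h2)
      _ = ENNReal.ofReal (1 / 20) := by
          rw [← ENNReal.ofReal_add (by norm_num) (by norm_num)]; norm_num
  · rintro u ⟨hu1, hu2⟩
    have hX : X u = ENNReal.ofReal (∑ i, ∑ k ∈ Finset.range (M + 1),
        if u i ≤ w i / (40 / 2 ^ k) then 4 * (40 / 2 ^ k : ℝ) ^ 2 else 0) := by
      have h0 : ∀ (i : Fin n) (k : ℕ),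
          (0 : ℝ) ≤ if u i ≤ w i / (40 / 2 ^ k) then 4 * (40 / 2 ^ k : ℝ) ^ 2 else 0 := by
        intro i k; split_ifs <;> positivity
      rw [ENNReal.ofReal_sum_of_nonneg fun i _ => Finset.sum_nonneg fun k _ => h0 i k]
      refine Finset.sum_congr rfl fun i _ => ?_
      rw [ENNReal.ofReal_sum_of_nonneg fun k _ => h0 i k]
      refine Finset.sum_congr rfl fun k _ => ?_
      simp only [Set.indicator_apply, Set.mem_ofPred_eq]
      split_ifs <;> simp
    simp only [Set.mem_ofPred_eq] at hu1 hu2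
    rw [hX, ENNReal.ofReal_lt_ofReal_iff (by positivity)] at hu2
    calc ∑ i, (w i / u i) ^ 2 ≤ ∑ i, (1 / (n : ℝ) + ∑ k ∈ Finset.range (M + 1),
          if u i ≤ w i / (40 / 2 ^ k) then 4 * (40 / 2 ^ k : ℝ) ^ 2 else 0) :=
          Finset.sum_le_sum fun i _ => sq_le_dyadic_sum hn hM (hw i) (hu1 i)
      _ ≤ 1 + 160 * C * (M + 1) := by
          rw [Finset.sum_add_distrib]
          refine add_le_add (le_of_eq ?_) hu2.le
          rw [Finset.sum_const, Finset.card_univ, Fintype.card_fin, nsmul_eq_mul]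
          field_simp
      _ ≤ (160 * C + 1) * (M + 1) := by
          have : (0 : ℝ) ≤ M := Nat.cast_nonneg _
          nlinarith

theorem exists_dilation (hG : PropertyP G) : ∃ K : ℝ, 0 < K ∧ ∀ n : ℕ, 0 < n →
    ∀ r : Fin n → ℝ, ∃ E : Set (Fin n → ℝ), MeasurableSet E ∧
      Measure.pi (fun _ : Fin n => orliczLaw hG) Eᶜ ≤ ENNReal.ofReal (1 / 20) ∧
      ∀ u ∈ E, ∑ i, ((u i)⁻¹ * r i) ^ 2 ≤ K * (Nat.log 2 n + 1) * orliczNorm G r ^ 2 := by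
  obtain ⟨K, hK, h⟩ := exists_dilation_of_sum_le_one hG
  refine ⟨32 * K, by positivity, fun n hn r => ?_⟩
  rcases (orliczNorm_nonneg (G := G) r).eq_or_lt with h0 | h0
  · refine ⟨Set.univ, MeasurableSet.univ, by simp, fun u _ => ?_⟩
    have hr : r = 0 := norm_le_zero_iff.1 (h0 ▸ norm_le_orliczNorm hG r)
    subst hr
    simp [← h0]
  -- `2 ^ (log₂ n + 7) = 64 * 2 ^ (log₂ n + 1) > 64 n`, enough for the required `40 n`. Normalising
  -- by twice the norm ensures that the sum is at most `1`.
  obtain ⟨E, hE, hμ, hu⟩ := h n (Nat.log 2 n + 7) hn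
    (by
      have := Nat.lt_pow_succ_log_self (b := 2) (by norm_num) n
      rw [pow_add]
      rw [pow_succ] at this
      omega)
    (fun i => |r i| / (2 * orliczNorm G r)) (fun i => by positivity)
    (sum_le_one_of_orliczNorm_lt hG (by linarith))
  refine ⟨E, hE, hμ, fun u huE => ?_⟩
  have h1 := hu u huE
  have h2 : ∀ i, ((u i)⁻¹ * r i) ^ 2 =
      4 * orliczNorm G r ^ 2 * (|r i| / (2 * orliczNorm G r) / u i) ^ 2 := by
    intro i
    rw [div_div, div_pow, sq_abs]
    by_cases hui : u i = 0
    · simp [hui]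
    field_simp
    ring
  simp only [h2]
  rw [← Finset.mul_sum]
  have h3 : (0 : ℝ) ≤ Nat.log 2 n := Nat.cast_nonneg _
  push_cast at h1
  calc 4 * orliczNorm G r ^ 2 * ∑ i, (|r i| / (2 * orliczNorm G r) / u i) ^ 2 ≤
      4 * orliczNorm G r ^ 2 * (K * (Nat.log 2 n + 7 + 1)) := by gcongr
    _ ≤ 4 * orliczNorm G r ^ 2 * (K * (8 * (Nat.log 2 n + 1))) := by gcongr; linarith
    _ = 32 * K * (Nat.log 2 n + 1) * orliczNorm G r ^ 2 := by ring

end Dilation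

/-! ## Nets in finite-dimensional normed spaces -/

section Net

variable (E : Type*) [NormedAddCommGroup E] [NormedSpace ℝ E] [FiniteDimensional ℝ E]

/-- A maximal `1`-separated subset of the ball of radius `2`, scaled by `1/2`; this is the
normalisation of the Besicovitch packing bound `5 ^ dim`, which also ensures that a set of greatest
cardinality exists. -/
theorem exists_half_net : ∃ F : Finset E, F.card ≤ 5 ^ Module.finrank ℝ E ∧
    ∀ x : E, ‖x‖ ≤ 1 → ∃ y ∈ F, ‖x - y‖ ≤ 1 / 2 := by
  classical
  let P : Finset E → Prop := fun s =>
    (∀ c ∈ s, ‖c‖ ≤ 2) ∧ ∀ c ∈ s, ∀ d ∈ s, c ≠ d → 1 ≤ ‖c - d‖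
  have hP : ∀ s, P s → s.card ≤ 5 ^ Module.finrank ℝ E := fun s hs =>
    Besicovitch.card_le_of_separated s hs.1 hs.2
  let Q : ℕ → Prop := fun m => ∃ s, P s ∧ s.card = m
  have hQ0 : Q 0 := ⟨∅, ⟨by simp, by simp⟩, rfl⟩
  obtain ⟨s, hs, hcard⟩ := Nat.findGreatest_spec (P := Q) (Nat.zero_le (5 ^ Module.finrank ℝ E)) hQ0
  refine ⟨s.image fun c => (2⁻¹ : ℝ) • c, Finset.card_image_le.trans (hP s hs), fun x hx => ?_⟩
  by_contra! hcon
  have hfar : ∀ c ∈ s, 1 < ‖(2 : ℝ) • x - c‖ := by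
    intro c hc
    have h1 := hcon _ (Finset.mem_image_of_mem _ hc)
    have h2 : (2 : ℝ) • x - c = (2 : ℝ) • (x - (2⁻¹ : ℝ) • c) := by
      rw [smul_sub, smul_smul]; norm_num
    rw [h2, norm_smul]
    norm_num
    linarith
  have hnot : (2 : ℝ) • x ∉ s := fun h => by
    have := hfar _ h
    simp at this
    linarith
  have hP' : P (insert ((2 : ℝ) • x) s) := by
    constructor
    · intro c hc
      rcases Finset.mem_insert.1 hc with rfl | hc
      · rw [norm_smul]; norm_num; linarith
      · exact hs.1 c hc
    · intro c hc d hd hcd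
      rcases Finset.mem_insert.1 hc with rfl | hc <;> rcases Finset.mem_insert.1 hd with rfl | hd
      · exact absurd rfl hcd
      · exact (hfar d hd).le
      · rw [norm_sub_rev]; exact (hfar c hc).le
      · exact hs.2 c hc d hd hcd
  have h1 : (insert ((2 : ℝ) • x) s).card = s.card + 1 := Finset.card_insert_of_notMem hnot
  have h2 := Nat.le_findGreatest (P := Q) (hP _ hP') ⟨_, hP', rfl⟩
  omega

/-- Approximate, blow the error up to the unit ball, approximate again: each round halves the error
and multiplies the cardinality by `5 ^ dim`. -/
theorem exists_net (k : ℕ) : ∃ F : Finset E, F.card ≤ 5 ^ (k * Module.finrank ℝ E) ∧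
    ∀ x : E, ‖x‖ ≤ 1 → ∃ y ∈ F, ‖x - y‖ ≤ 1 / 2 ^ k := by
  classical
  induction k with
  | zero => exact ⟨{0}, by simp, fun x hx => ⟨0, by simp, by simpa using hx⟩⟩
  | succ k ih =>
    obtain ⟨F, hF, hFnet⟩ := ih
    obtain ⟨F₁, hF₁, hF₁net⟩ := exists_half_net E
    refine ⟨(F ×ˢ F₁).image fun p => p.1 + (1 / 2 ^ k : ℝ) • p.2, ?_, fun x hx => ?_⟩
    · refine Finset.card_image_le.trans ?_
      rw [Finset.card_product, add_mul, one_mul, pow_add]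
      exact Nat.mul_le_mul hF hF₁
    · obtain ⟨y, hy, hxy⟩ := hFnet x hx
      obtain ⟨z, hz, hyz⟩ := hF₁net ((2 ^ k : ℝ) • (x - y)) (by
        rw [norm_smul, Real.norm_of_nonneg (by positivity)]
        rwa [le_div_iff₀ (by positivity), mul_comm] at hxy)
      refine ⟨_, Finset.mem_image_of_mem _ (Finset.mk_mem_product hy hz), ?_⟩
      have h1 : x - (y + (1 / 2 ^ k : ℝ) • z) =
          (1 / 2 ^ k : ℝ) • ((2 ^ k : ℝ) • (x - y) - z) := by
        rw [smul_sub, smul_smul, one_div, inv_mul_cancel₀ (by positivity), one_smul]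
        abel
      rw [h1, norm_smul, Real.norm_of_nonneg (by positivity), pow_succ]
      calc 1 / 2 ^ k * ‖(2 ^ k : ℝ) • (x - y) - z‖ ≤ 1 / 2 ^ k * (1 / 2) := by gcongr
        _ = 1 / (2 ^ k * 2) := by rw [div_mul_div_comm, one_mul]

end Net

/-! ## No contraction on a subspace -/

section Contraction

variable {G : ℝ → ℝ}

/-- At half the norm the defining sum exceeds `1`, and `t * G y ≤ G (t * y)` by convexity, so the
exponent in the exact product formula is at least `t`. -/
theorem pi_orliczLaw_contract_le (hG : PropertyP G) {n : ℕ} {x : Fin n → ℝ} {t : ℝ} (ht : 1 ≤ t)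
    (hx : 0 < orliczNorm G x) :
    Measure.pi (fun _ : Fin n => orliczLaw hG) {u | ∀ i, 2 * t * |x i| / orliczNorm G x < u i} ≤
      ENNReal.ofReal (Real.exp (-t)) := by
  rw [pi_orliczLaw_forall_lt hG fun i => by positivity]
  refine ENNReal.ofReal_le_ofReal (Real.exp_le_exp.2 (neg_le_neg ?_))
  have h1 := one_lt_sum_of_lt_orliczNorm (G := G) (x := x) (a := orliczNorm G x / 2)
    (by linarith) (by linarith)
  calc t ≤ t * ∑ i, G (|x i| / (orliczNorm G x / 2)) := by nlinarith
    _ = ∑ i, t * G (|x i| / (orliczNorm G x / 2)) := Finset.mul_sum _ _ _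
    _ ≤ ∑ i, G (2 * t * |x i| / orliczNorm G x) := by
      refine Finset.sum_le_sum fun i _ => ?_
      refine (hG.mul_le_map_mul ht (by positivity)).trans (le_of_eq ?_)
      congr 1
      field_simp

/-- Union bound arithmetic: `5 < e ^ 2` beats the net and `e ^ (-4) < 1 / 40` is left over. -/
theorem exp_neg_mul_five_pow_le (m : ℕ) :
    (5 : ℝ) ^ m * Real.exp (-(4 + 2 * m)) ≤ 1 / 40 := by
  have h1 : (5 : ℝ) * Real.exp (-2) ≤ 1 := by
    have h := Real.exp_one_gt_d9
    have h2 : (5 : ℝ) ≤ Real.exp 2 := by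
      have : Real.exp 2 = Real.exp 1 * Real.exp 1 := by rw [← Real.exp_add]; norm_num
      rw [this]; nlinarith
    rw [Real.exp_neg]
    exact (mul_inv_le_iff₀ (Real.exp_pos _)).2 (by linarith)
  have h3 : Real.exp (-4) ≤ 1 / 40 := by
    have h := Real.exp_one_gt_d9
    have : Real.exp 4 = (Real.exp 1 * Real.exp 1) * (Real.exp 1 * Real.exp 1) := by
      rw [← Real.exp_add, ← Real.exp_add]; norm_num
    rw [Real.exp_neg, inv_le_comm₀ (Real.exp_pos _) (by norm_num), this]
    have h4 : (7 : ℝ) ≤ Real.exp 1 * Real.exp 1 := by nlinarith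
    nlinarith
  have h4 : Real.exp (-(4 + 2 * m : ℝ)) = Real.exp (-4) * Real.exp (-2) ^ m := by
    rw [← Real.exp_nat_mul, ← Real.exp_add]; congr 1; ring
  rw [h4]
  calc (5 : ℝ) ^ m * (Real.exp (-4) * Real.exp (-2) ^ m) =
      Real.exp (-4) * (5 * Real.exp (-2)) ^ m := by rw [mul_pow]; ring
    _ ≤ Real.exp (-4) * 1 := by
      gcongr
      exact pow_le_one₀ (by positivity) h1
    _ ≤ 1 / 40 := by linarith

/-- Union bound over a net of the sup-norm unit ball of `V`. Passing from a net point to a nearby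
unit vector costs a factor `n` in the Orlicz norm and `40 n` in `D⁻¹`, so mesh `1 / (320 n t)`
suffices. There is no circularity: `t` is linear in the net exponent `k`, while the mesh `2 ^ (-k)`
shrinks exponentially. -/
theorem exists_no_contraction (hG : PropertyP G) {n : ℕ} (hn : 0 < n)
    (V : Submodule ℝ (Fin n → ℝ)) : ∃ E : Set (Fin n → ℝ), MeasurableSet E ∧
      Measure.pi (fun _ : Fin n => orliczLaw hG) Eᶜ ≤ ENNReal.ofReal (1 / 20) ∧
      ∀ u ∈ E, ∀ x ∈ V, orliczNorm G x ≤
        8 * (4 + 40 * (Nat.log 2 n + 1) * Module.finrank ℝ V) * ‖fun i => (u i)⁻¹ * x i‖ := by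
  classical
  have := isProbabilityMeasure_orliczLaw hG
  set μ := Measure.pi (fun _ : Fin n => orliczLaw hG)
  set L := Nat.log 2 n + 1 with hL
  set r := Module.finrank ℝ V with hr
  set k := 20 * L with hk
  set t : ℝ := 4 + 2 * (k * r : ℕ) with ht
  have ht4 : 4 ≤ t := by rw [ht]; linarith [show (0 : ℝ) ≤ (k * r : ℕ) from Nat.cast_nonneg _]
  have hn' : (1 : ℝ) ≤ n := by exact_mod_cast hn
  have hrn : r ≤ n := by
    have := Submodule.finrank_le V
    simpa using this
  have hη : (320 * n * t : ℝ) ≤ 2 ^ k := by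
    have h1 : n < 2 ^ L := Nat.lt_pow_succ_log_self (by norm_num) n
    have h2 : L < 2 ^ L := Nat.lt_two_pow_self
    have h3 : 320 * n * (4 + 2 * (k * r)) ≤ 2 ^ k := by
      have h4 : k * r ≤ 20 * (2 ^ L * 2 ^ L) := by
        rw [hk, mul_assoc]
        exact Nat.mul_le_mul le_rfl (Nat.mul_le_mul h2.le (hrn.trans h1.le))
      have h5 : 2 ≤ 2 ^ L := by
        have : 1 ≤ L := by omega
        calc 2 = 2 ^ 1 := rfl
          _ ≤ 2 ^ L := Nat.pow_le_pow_right (by norm_num) this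
      have h6 : 2 ^ k = (2 ^ L) ^ 20 := by rw [← pow_mul, hk, mul_comm]
      rw [h6]
      generalize 2 ^ L = q at *
      calc 320 * n * (4 + 2 * (k * r)) ≤ 320 * q * (4 + 2 * (20 * (q * q))) := by gcongr
        _ ≤ 320 * q * (q * q + 2 * (20 * (q * q))) := by gcongr; nlinarith
        _ = 13120 * q ^ 3 := by ring
        _ ≤ 2 ^ 17 * q ^ 3 := by gcongr; norm_num
        _ ≤ q ^ 17 * q ^ 3 := by gcongr
        _ = q ^ 20 := by ring
    rw [ht]
    exact_mod_cast h3
  obtain ⟨F, hF, hFnet⟩ := exists_net V k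
  let F' := F.filter fun x : V => 0 < orliczNorm G (x : Fin n → ℝ)
  let B : Set (Fin n → ℝ) := ⋃ x ∈ F',
    {u | ∀ i, 2 * t * |(x : Fin n → ℝ) i| / orliczNorm G (x : Fin n → ℝ) < u i}
  have hBm : MeasurableSet B := by
    refine F'.measurableSet_biUnion fun x _ => ?_
    rw [Set.ofPred_forall]
    exact MeasurableSet.iInter fun i => measurableSet_lt measurable_const (measurable_pi_apply i)
  have hBμ : μ B ≤ ENNReal.ofReal (1 / 40) := by
    calc μ B ≤ ∑ _x ∈ F', ENNReal.ofReal (Real.exp (-t)) :=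
          (measure_biUnion_finset_le _ _).trans (Finset.sum_le_sum fun x hx =>
            pi_orliczLaw_contract_le hG (by linarith) (Finset.mem_filter.1 hx).2)
      _ = ENNReal.ofReal (F'.card * Real.exp (-t)) := by
          rw [Finset.sum_const, nsmul_eq_mul, ENNReal.ofReal_mul (Nat.cast_nonneg _),
            ENNReal.ofReal_natCast]
      _ ≤ ENNReal.ofReal (1 / 40) := by
          refine ENNReal.ofReal_le_ofReal (le_trans ?_ (exp_neg_mul_five_pow_le (k * r)))
          rw [ht]
          gcongr
          exact_mod_cast (Finset.card_filter_le _ _).trans hF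
  refine ⟨Bᶜ ∩ {u | ∀ i, 1 / (40 * n : ℝ) < u i}, hBm.compl.inter ?_, ?_, ?_⟩
  · rw [Set.ofPred_forall]
    exact MeasurableSet.iInter fun i => measurableSet_lt measurable_const (measurable_pi_apply i)
  · have h1 : μ {u | ∃ i, u i ≤ 1 / (40 * n : ℝ)} ≤ ENNReal.ofReal (1 / 40) := by
      refine (pi_orliczLaw_exists_le hG (a := fun _ => 1 / (40 * n : ℝ))
        fun i => by positivity).trans ?_
      refine ENNReal.ofReal_le_ofReal ?_
      have h2 : G (1 / (40 * n : ℝ)) ≤ 1 / (40 * n : ℝ) := by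
        refine hG.map_le_self (by positivity) ?_
        rw [div_le_one (by positivity)]; linarith
      rw [Finset.sum_const, Finset.card_univ, Fintype.card_fin, nsmul_eq_mul]
      calc n * G (1 / (40 * n : ℝ)) ≤ n * (1 / (40 * n : ℝ)) := by gcongr
        _ = 1 / 40 := by field_simp
    calc _ ≤ μ (B ∪ {u | ∃ i, u i ≤ 1 / (40 * n : ℝ)}) := by
          refine measure_mono fun u hu => ?_
          simp only [Set.mem_compl_iff, Set.mem_inter_iff, Set.mem_ofPred_eq, not_and_or,
            not_forall, not_lt, not_not] at hu
          exact hu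
      _ ≤ ENNReal.ofReal (1 / 40) + ENNReal.ofReal (1 / 40) :=
          (measure_union_le _ _).trans (add_le_add hBμ h1)
      _ = ENNReal.ofReal (1 / 20) := by
          rw [← ENNReal.ofReal_add (by norm_num) (by norm_num)]; norm_num
  · rintro u ⟨huB, hu⟩
    have hu0 : ∀ i, 0 < u i := fun i => lt_trans (by positivity) (hu i)
    have hunit : ∀ x : V, ‖x‖ = 1 →
        orliczNorm G (x : Fin n → ℝ) ≤ 8 * t * ‖fun i => (u i)⁻¹ * (x : Fin n → ℝ) i‖ := by
      intro x hx
      obtain ⟨y, hyF, hxy⟩ := hFnet x hx.le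
      have hxy' : ‖(x : Fin n → ℝ) - y‖ ≤ 1 / 2 ^ k := hxy
      have hx1 : 1 ≤ orliczNorm G (x : Fin n → ℝ) := by
        have := norm_le_orliczNorm hG (x : Fin n → ℝ)
        rwa [show ‖(x : Fin n → ℝ)‖ = 1 from hx] at this
      have hε : (1 : ℝ) / 2 ^ k ≤ 1 / (320 * n * t) :=
        one_div_le_one_div_of_le (by positivity) hη
      -- The additive error is absorbed since `‖x‖_G ≥ ‖x‖_∞ = 1`; the same fact absorbs the `1 / 4`
      -- at the end.
      have hNy : orliczNorm G (x : Fin n → ℝ) / 2 ≤ orliczNorm G (y : Fin n → ℝ) := by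
        have h1 := orliczNorm_sub_le_add hG (x : Fin n → ℝ) (y : Fin n → ℝ)
        have h2 := orliczNorm_le_mul_norm hG ((x : Fin n → ℝ) - (y : Fin n → ℝ))
        have h3 : n * ‖(x : Fin n → ℝ) - y‖ ≤ 1 / 2 := by
          calc n * ‖(x : Fin n → ℝ) - y‖ ≤ n * (1 / (320 * n * t)) := by gcongr; linarith
            _ = 1 / (320 * t) := by field_simp
            _ ≤ 1 / 2 := one_div_le_one_div_of_le (by norm_num) (by linarith)
        linarith
      have hNy0 : 0 < orliczNorm G (y : Fin n → ℝ) := by linarith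
      -- Outside the bad event of the net point `y`, some coordinate of `D⁻¹ y` is large.
      obtain ⟨i, hi⟩ : ∃ i, u i ≤ 2 * t * |(y : Fin n → ℝ) i| / orliczNorm G (y : Fin n → ℝ) := by
        by_contra! hcon
        exact huB (Set.mem_biUnion (Finset.mem_filter.2 ⟨hyF, hNy0⟩) hcon)
      have h1 : orliczNorm G (y : Fin n → ℝ) ≤ 2 * t * ((u i)⁻¹ * |(y : Fin n → ℝ) i|) := by
        rw [le_div_iff₀ hNy0] at hi
        rw [← mul_assoc, mul_comm (2 * t), mul_assoc, ← div_eq_inv_mul, le_div_iff₀ (hu0 i)]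
        linarith
      have h2 : |(y : Fin n → ℝ) i| ≤ |(x : Fin n → ℝ) i| + 1 / (320 * n * t) := by
        have h3 := norm_le_pi_norm ((x : Fin n → ℝ) - (y : Fin n → ℝ)) i
        rw [Real.norm_eq_abs, Pi.sub_apply] at h3
        have h4 := abs_sub_abs_le_abs_sub ((y : Fin n → ℝ) i) ((x : Fin n → ℝ) i)
        rw [abs_sub_comm] at h4
        linarith
      have h5 : (u i)⁻¹ ≤ 40 * n := by
        rw [inv_le_comm₀ (hu0 i) (by positivity), ← one_div]
        exact (hu i).le
      have h6 : (u i)⁻¹ * |(x : Fin n → ℝ) i| ≤ ‖fun i => (u i)⁻¹ * (x : Fin n → ℝ) i‖ := by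
        have := norm_le_pi_norm (fun i => (u i)⁻¹ * (x : Fin n → ℝ) i) i
        rwa [Real.norm_eq_abs, abs_mul, abs_of_pos (inv_pos.2 (hu0 i))] at this
      have h7 : (u i)⁻¹ * |(y : Fin n → ℝ) i| ≤
          ‖fun i => (u i)⁻¹ * (x : Fin n → ℝ) i‖ + 1 / (8 * t) := by
        calc (u i)⁻¹ * |(y : Fin n → ℝ) i| ≤
            (u i)⁻¹ * (|(x : Fin n → ℝ) i| + 1 / (320 * n * t)) :=
              mul_le_mul_of_nonneg_left h2 (inv_pos.2 (hu0 i)).le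
          _ = (u i)⁻¹ * |(x : Fin n → ℝ) i| + (u i)⁻¹ * (1 / (320 * n * t)) := mul_add _ _ _
          _ ≤ ‖fun i => (u i)⁻¹ * (x : Fin n → ℝ) i‖ + 40 * n * (1 / (320 * n * t)) := by
              gcongr
          _ = ‖fun i => (u i)⁻¹ * (x : Fin n → ℝ) i‖ + 1 / (8 * t) := by
              congr 1; field_simp; norm_num
      have h8 : orliczNorm G (y : Fin n → ℝ) ≤
          2 * t * ‖fun i => (u i)⁻¹ * (x : Fin n → ℝ) i‖ + 1 / 4 := by
        calc _ ≤ _ := h1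
          _ ≤ 2 * t * (‖fun i => (u i)⁻¹ * (x : Fin n → ℝ) i‖ + 1 / (8 * t)) := by gcongr
          _ = _ := by field_simp; ring
      have h9 : (0 : ℝ) ≤ t * ‖fun i => (u i)⁻¹ * (x : Fin n → ℝ) i‖ := by positivity
      linarith
    intro x hx
    have hgoal : orliczNorm G x ≤ 8 * t * ‖fun i => (u i)⁻¹ * x i‖ := by
      rcases eq_or_ne x 0 with rfl | hx0
      · have := orliczNorm_le_mul_norm hG (0 : Fin n → ℝ)
        rw [norm_zero, mul_zero] at this
        exact this.trans (by positivity)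
      have hxn : 0 < ‖x‖ := norm_pos_iff.2 hx0
      have h1 := hunit (‖x‖⁻¹ • ⟨x, hx⟩) (by
        rw [norm_smul, norm_inv, norm_norm]
        exact inv_mul_cancel₀ hxn.ne')
      have h2 := orliczNorm_smul_le hG ‖x‖ (‖x‖⁻¹ • x)
      rw [smul_smul, mul_inv_cancel₀ hxn.ne', one_smul, abs_of_pos hxn] at h2
      have h3 : (fun i => (u i)⁻¹ * (((‖x‖⁻¹ • (⟨x, hx⟩ : V)) : V) : Fin n → ℝ) i) =
          ‖x‖⁻¹ • fun i => (u i)⁻¹ * x i := by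
        ext i
        simp only [Submodule.coe_smul, Pi.smul_apply, smul_eq_mul]
        ring
      rw [h3, norm_smul, norm_inv, norm_norm] at h1
      calc orliczNorm G x ≤ ‖x‖ * orliczNorm G (‖x‖⁻¹ • x) := h2
        _ ≤ ‖x‖ * (8 * t * (‖x‖⁻¹ * ‖fun i => (u i)⁻¹ * x i‖)) := by gcongr; exact h1
        _ = 8 * t * ‖fun i => (u i)⁻¹ * x i‖ := by field_simp
    refine hgoal.trans (le_of_eq ?_)
    rw [ht, hk, hL]
    push_cast
    ring

end Contraction

/-! ## Uniform measures on finite products -/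

section Uniform

/-- Hashes and signs together are uniform on a finite set, so their expectations can be computed as
finite sums. -/
theorem pi_uniformOn_univ {n : ℕ} {α : Type*} [Fintype α] [MeasurableSpace α]
    [MeasurableSingletonClass α] [Nonempty α] :
    Measure.pi (fun _ : Fin n => uniformOn (Set.univ : Set α)) = uniformOn Set.univ := by
  have : IsProbabilityMeasure (uniformOn (Set.univ : Set α)) :=
    isProbabilityMeasure_uniformOn Set.finite_univ Set.univ_nonempty
  refine Measure.ext_of_singleton fun x => ?_
  rw [← Set.univ_pi_singleton x, Measure.pi_pi, Set.univ_pi_singleton x]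
  simp only [uniformOn_univ, Measure.count_singleton]
  simp [ENNReal.inv_pow]

theorem prod_uniformOn_univ {α β : Type*} [Fintype α] [MeasurableSpace α]
    [MeasurableSingletonClass α] [Nonempty α] [Fintype β] [MeasurableSpace β]
    [MeasurableSingletonClass β] [Nonempty β] :
    (uniformOn (Set.univ : Set α)).prod (uniformOn (Set.univ : Set β)) = uniformOn Set.univ := by
  have : IsProbabilityMeasure (uniformOn (Set.univ : Set α)) :=
    isProbabilityMeasure_uniformOn Set.finite_univ Set.univ_nonempty
  have : IsProbabilityMeasure (uniformOn (Set.univ : Set β)) :=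
    isProbabilityMeasure_uniformOn Set.finite_univ Set.univ_nonempty
  refine Measure.ext_of_singleton fun x => ?_
  rw [← Set.singleton_prod_singleton (a := x.1) (b := x.2), Measure.prod_prod,
    Set.singleton_prod_singleton]
  simp only [uniformOn_univ, Measure.count_singleton, one_div, Fintype.card_prod, Nat.cast_mul]
  rw [ENNReal.mul_inv (by simp) (by simp)]

theorem uniformOn_univ_le_of_sum_le {α : Type*} [Fintype α] [MeasurableSpace α]
    [MeasurableSingletonClass α] [Nonempty α] {f : α → ℝ} (hf : ∀ x, 0 ≤ f x) {a c : ℝ}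
    (ha : 0 < a) (h : ∑ x, f x ≤ c * Fintype.card α) :
    uniformOn (Set.univ : Set α) {x | a ≤ f x} ≤ ENNReal.ofReal (c / a) := by
  classical
  rw [uniformOn_univ, Measure.count_apply (Set.toFinite _).measurableSet,
    Set.encard_eq_coe_toFinset_card]
  have h1 : ({x | a ≤ f x} : Set α).toFinset.card * a ≤ c * Fintype.card α := by
    refine le_trans ?_ h
    calc _ = ∑ _x ∈ ({x | a ≤ f x} : Set α).toFinset, a := by
          rw [Finset.sum_const, nsmul_eq_mul]
      _ ≤ ∑ x ∈ ({x | a ≤ f x} : Set α).toFinset, f x :=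
          Finset.sum_le_sum fun x hx => by simpa using hx
      _ ≤ ∑ x, f x := Finset.sum_le_univ_sum_of_nonneg hf
  have hcard : (0 : ℝ) < Fintype.card α := by exact_mod_cast Fintype.card_pos
  rw [ENNReal.div_le_iff (by simp) (by simp)]
  have h2 : (({x | a ≤ f x} : Set α).toFinset.card : ℝ) ≤ c / a * Fintype.card α := by
    rw [div_mul_eq_mul_div, le_div_iff₀ ha]; exact h1
  have h3 := ENNReal.ofReal_le_ofReal h2
  rw [ENNReal.ofReal_mul' hcard.le, ENNReal.ofReal_natCast, ENNReal.ofReal_natCast] at h3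
  simpa using h3

/-- Resampling one coordinate: exchanging `h i` with a fresh value is an involution on pairs. -/
theorem card_mul_sum_eq_sum_update {ι α : Type*} [Fintype ι] [DecidableEq ι] [Fintype α]
    (i : ι) (f : (ι → α) → ℝ) :
    Fintype.card α * ∑ h, f h = ∑ h : ι → α, ∑ x, f (Function.update h i x) := by
  classical
  let e : (ι → α) × α ≃ (ι → α) × α :=
    { toFun := fun p => (Function.update p.1 i p.2, p.1 i)
      invFun := fun p => (Function.update p.1 i p.2, p.1 i)
      left_inv := fun p => by simp
      right_inv := fun p => by simp }
  calc (Fintype.card α : ℝ) * ∑ h, f h = ∑ p : (ι → α) × α, f p.1 := by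
        rw [Fintype.sum_prod_type]
        simp only [Finset.sum_const, Finset.card_univ, nsmul_eq_mul, Finset.mul_sum]
    _ = ∑ p : (ι → α) × α, f (e p).1 := (e.sum_comp fun p => f p.1).symm
    _ = _ := by rw [Fintype.sum_prod_type]; rfl

/-- The collision probability is `1 / card α`: resample `h i` with `h j` fixed. -/
theorem sum_ite_apply_eq_apply {ι α : Type*} [Fintype ι] [DecidableEq ι] [Fintype α]
    [DecidableEq α] {i j : ι} (hij : i ≠ j) :
    (Fintype.card α : ℝ) * ∑ h : ι → α, (if h i = h j then (1 : ℝ) else 0) =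
      Fintype.card (ι → α) := by
  rw [card_mul_sum_eq_sum_update i]
  simp [Function.update_self, Function.update_of_ne hij.symm]

end Uniform

/-! ## The sparse embedding -/

section SparseEmbedding

variable {n t : ℕ}

theorem signValue_mul_self (s : Bool) : signValue s * signValue s = 1 := by
  cases s <;> simp [signValue]

theorem signValue_not (s : Bool) : signValue (!s) = -signValue s := by
  cases s <;> simp [signValue]

theorem sparseEmbedding_mulVec (h : Fin n → Fin t) (σ : Fin n → Bool) (z : Fin n → ℝ)
    (k : Fin t) : (sparseEmbedding h σ *ᵥ z) k =
      ∑ i, if h i = k then signValue (σ i) * z i else 0 := by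
  rw [sparseEmbedding, ← Matrix.mulVec_mulVec]
  simp [Matrix.mulVec, dotProduct, Matrix.diagonal_apply]

theorem sparseEmbedding_dotProduct (h : Fin n → Fin t) (σ : Fin n → Bool) (u v : Fin n → ℝ) :
    (sparseEmbedding h σ *ᵥ u) ⬝ᵥ (sparseEmbedding h σ *ᵥ v) =
      ∑ i, ∑ j, if h i = h j then signValue (σ i) * signValue (σ j) * (u i * v j) else 0 := by
  simp only [dotProduct, sparseEmbedding_mulVec, Finset.sum_mul_sum]
  rw [Finset.sum_comm]
  refine Finset.sum_congr rfl fun i _ => ?_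
  rw [Finset.sum_comm]
  refine Finset.sum_congr rfl fun j _ => ?_
  simp only [ite_mul, zero_mul, mul_ite, mul_zero, Finset.sum_ite_eq, Finset.mem_univ, if_true]
  by_cases hij : h i = h j
  · simp [hij]; ring
  · simp [hij]

theorem sum_sum_eq_diag_add_lt (f : Fin n → Fin n → ℝ) :
    ∑ i, ∑ j, f i j = ∑ i, f i i +
      ∑ p : Fin n × Fin n with p.1 < p.2, (f p.1 p.2 + f p.2 p.1) := by
  have h1 : ∀ i j, f i j = (if i = j then f i j else 0) + (if i < j then f i j else 0) +
      (if j < i then f i j else 0) := by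
    intro i j
    rcases lt_trichotomy i j with h | h | h
    · simp [h, h.ne, h.not_gt]
    · simp [h]
    · simp [h, h.ne', h.not_gt]
  rw [Finset.sum_filter, Fintype.sum_prod_type]
  calc ∑ i, ∑ j, f i j = ∑ i, ∑ j, ((if i = j then f i j else 0) + (if i < j then f i j else 0) +
      (if j < i then f i j else 0)) :=
        Finset.sum_congr rfl fun i _ => Finset.sum_congr rfl fun j _ => h1 i j
    _ = ∑ i, f i i + (∑ i, ∑ j, (if i < j then f i j else 0) +
          ∑ i, ∑ j, (if j < i then f i j else 0)) := by
        simp only [Finset.sum_add_distrib]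
        simp [add_assoc]
    _ = _ := by
        rw [Finset.sum_comm (f := fun i j => if j < i then f i j else 0)]
        rw [← Finset.sum_add_distrib]
        congr 1
        refine Finset.sum_congr rfl fun i _ => ?_
        rw [← Finset.sum_add_distrib]
        refine Finset.sum_congr rfl fun j _ => ?_
        split_ifs <;> simp

/-- The deviation of the sparse embedding from an isometry, as a bilinear form. -/
noncomputable def embeddingDefect (h : Fin n → Fin t) (σ : Fin n → Bool) (u v : Fin n → ℝ) : ℝ :=
  (sparseEmbedding h σ *ᵥ u) ⬝ᵥ (sparseEmbedding h σ *ᵥ v) - u ⬝ᵥ v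

/-- The diagonal is reproduced exactly because signs square to `1`. Grouping the two orders of each
pair leaves distinct sign characters, ready for orthogonality. -/
theorem embeddingDefect_eq (h : Fin n → Fin t) (σ : Fin n → Bool) (u v : Fin n → ℝ) :
    embeddingDefect h σ u v = ∑ p : Fin n × Fin n with p.1 < p.2,
      (if h p.1 = h p.2 then (1 : ℝ) else 0) * (u p.1 * v p.2 + u p.2 * v p.1) *
        (signValue (σ p.1) * signValue (σ p.2)) := by
  rw [embeddingDefect, sparseEmbedding_dotProduct, sum_sum_eq_diag_add_lt]
  simp only [if_true, signValue_mul_self, one_mul]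
  rw [dotProduct, add_sub_cancel_left]
  refine Finset.sum_congr rfl fun p _ => ?_
  by_cases hp : h p.1 = h p.2
  · simp only [hp, if_true]; ring
  · simp [hp, Ne.symm hp]

/-- For two different increasing pairs some index occurs exactly once among the four; flipping its
sign negates the summand. -/
theorem sum_signs_eq_zero {p q : Fin n × Fin n} (hp : p.1 < p.2) (hq : q.1 < q.2) (hpq : p ≠ q) :
    ∑ σ : Fin n → Bool, (signValue (σ p.1) * signValue (σ p.2)) *
      (signValue (σ q.1) * signValue (σ q.2)) = 0 := by
  have key : ∀ (a : Fin n) (f : (Fin n → Bool) → ℝ),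
      (∀ σ, f (Function.update σ a (!σ a)) = -f σ) → ∑ σ, f σ = 0 := by
    intro a f hf
    have hinv : Function.Involutive fun σ : Fin n → Bool => Function.update σ a (!σ a) := by
      intro σ; simp
    have h1 := Equiv.sum_comp (hinv.toPerm _) f
    have h2 : ∑ σ, f (hinv.toPerm _ σ) = -∑ σ, f σ := by
      rw [← Finset.sum_neg_distrib]
      exact Finset.sum_congr rfl fun σ _ => hf σ
    linarith
  obtain ⟨i, j⟩ := p
  obtain ⟨k, l⟩ := q
  simp only at hp hq ⊢
  by_cases h1 : i = k
  · have h2 : j ≠ l := fun h => hpq (by rw [h1, h])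
    have h3 : j ≠ k := h1 ▸ hp.ne'
    refine key j _ fun σ => ?_
    rw [Function.update_self, Function.update_of_ne hp.ne, Function.update_of_ne h2.symm,
      Function.update_of_ne h3.symm, signValue_not]
    ring
  · by_cases h2 : i = l
    · have h3 : j ≠ l := h2 ▸ hp.ne'
      have h4 : j ≠ k := by rintro rfl; exact absurd (h2 ▸ hp) (not_lt.2 hq.le)
      refine key j _ fun σ => ?_
      rw [Function.update_self, Function.update_of_ne hp.ne, Function.update_of_ne h3.symm,
        Function.update_of_ne h4.symm, signValue_not]
      ring
    · refine key i _ fun σ => ?_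
      rw [Function.update_self, Function.update_of_ne hp.ne', Function.update_of_ne (Ne.symm h1),
        Function.update_of_ne (Ne.symm h2), signValue_not]
      ring

/-- Orthogonality of the characters kills all cross terms of the square; each remaining pair
survives only on a collision, with probability `1 / t`. -/
theorem sum_embeddingDefect_sq_le (ht : 0 < t) (u v : Fin n → ℝ) :
    ∑ ω : (Fin n → Fin t) × (Fin n → Bool), embeddingDefect ω.1 ω.2 u v ^ 2 ≤
      2 / t * ((u ⬝ᵥ u) * (v ⬝ᵥ v)) * Fintype.card ((Fin n → Fin t) × (Fin n → Bool)) := by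
  set T : Finset (Fin n × Fin n) := {p | p.1 < p.2} with hT
  let c : Fin n × Fin n → ℝ := fun p => u p.1 * v p.2 + u p.2 * v p.1
  let e : (Fin n → Fin t) → Fin n × Fin n → ℝ := fun h p => if h p.1 = h p.2 then 1 else 0
  let χ : (Fin n → Bool) → Fin n × Fin n → ℝ := fun σ p => signValue (σ p.1) * signValue (σ p.2)
  have hmem : ∀ p ∈ T, p.1 < p.2 := fun p hp => (Finset.mem_filter.1 hp).2
  have h1 : ∀ h : Fin n → Fin t, ∑ σ, embeddingDefect h σ u v ^ 2 =
      ∑ p ∈ T, e h p * c p ^ 2 * Fintype.card (Fin n → Bool) := by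
    intro h
    calc ∑ σ, embeddingDefect h σ u v ^ 2 =
        ∑ σ, ∑ p ∈ T, ∑ q ∈ T, (e h p * c p) * (e h q * c q) * (χ σ p * χ σ q) := by
          refine Finset.sum_congr rfl fun σ _ => ?_
          rw [embeddingDefect_eq, sq, Finset.sum_mul_sum]
          refine Finset.sum_congr rfl fun p _ => Finset.sum_congr rfl fun q _ => ?_
          simp only [e, c, χ]; ring
      _ = ∑ p ∈ T, ∑ q ∈ T, (e h p * c p) * (e h q * c q) * ∑ σ, χ σ p * χ σ q := by
          rw [Finset.sum_comm]
          refine Finset.sum_congr rfl fun p _ => ?_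
          rw [Finset.sum_comm]
          exact Finset.sum_congr rfl fun q _ => (Finset.mul_sum _ _ _).symm
      _ = ∑ p ∈ T, e h p * c p ^ 2 * Fintype.card (Fin n → Bool) := by
          refine Finset.sum_congr rfl fun p hp => ?_
          rw [Finset.sum_eq_single p]
          · have h2 : ∀ σ, χ σ p * χ σ p = 1 := fun σ => by
              have := signValue_mul_self (σ p.1)
              have := signValue_mul_self (σ p.2)
              simp only [χ]
              linear_combination (signValue (σ p.2)) ^ 2 * signValue_mul_self (σ p.1) +
                signValue_mul_self (σ p.2)
            have h3 : e h p * e h p = e h p := by simp [e]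
            simp only [h2, Finset.sum_const, Finset.card_univ, nsmul_eq_mul, mul_one]
            linear_combination (c p ^ 2 * Fintype.card (Fin n → Bool)) * h3
          · intro q hq hqp
            rw [sum_signs_eq_zero (hmem p hp) (hmem q hq) hqp.symm, mul_zero]
          · exact fun h' => absurd hp h'
  have ht' : (0 : ℝ) < t := by exact_mod_cast ht
  have h2 : ∀ p ∈ T, (t : ℝ) * ∑ h : Fin n → Fin t, e h p = Fintype.card (Fin n → Fin t) := by
    intro p hp
    have := sum_ite_apply_eq_apply (α := Fin t) (hmem p hp).ne
    rwa [Fintype.card_fin] at this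
  have h3 : ∑ p ∈ T, c p ^ 2 ≤ 2 * ((u ⬝ᵥ u) * (v ⬝ᵥ v)) := by
    have h4 : (u ⬝ᵥ u) * (v ⬝ᵥ v) = ∑ i, u i * u i * (v i * v i) +
        ∑ p ∈ T, (u p.1 * u p.1 * (v p.2 * v p.2) + u p.2 * u p.2 * (v p.1 * v p.1)) := by
      rw [hT, ← sum_sum_eq_diag_add_lt fun i j => u i * u i * (v j * v j), dotProduct,
        dotProduct, Finset.sum_mul_sum]
    have h5 : 0 ≤ ∑ i, u i * u i * (v i * v i) := Finset.sum_nonneg fun i _ => by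
      nlinarith [sq_nonneg (u i * v i)]
    rw [h4, mul_add, Finset.mul_sum (s := T)]
    refine le_trans (Finset.sum_le_sum fun p _ => ?_) (le_add_of_nonneg_left (mul_nonneg zero_le_two h5))
    simp only [c]
    nlinarith [sq_nonneg (u p.1 * v p.2 - u p.2 * v p.1)]
  rw [Fintype.sum_prod_type]
  calc ∑ h : Fin n → Fin t, ∑ σ, embeddingDefect h σ u v ^ 2 =
      ∑ p ∈ T, c p ^ 2 * Fintype.card (Fin n → Bool) * ∑ h, e h p := by
        simp only [h1]
        rw [Finset.sum_comm]
        refine Finset.sum_congr rfl fun p _ => ?_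
        rw [Finset.mul_sum]
        exact Finset.sum_congr rfl fun h _ => by ring
    _ = ∑ p ∈ T, c p ^ 2 * (Fintype.card ((Fin n → Fin t) × (Fin n → Bool)) / t) := by
        refine Finset.sum_congr rfl fun p hp => ?_
        rw [Fintype.card_prod, Nat.cast_mul, ← h2 p hp]
        field_simp
    _ ≤ 2 * ((u ⬝ᵥ u) * (v ⬝ᵥ v)) * (Fintype.card ((Fin n → Fin t) × (Fin n → Bool)) / t) := by
        rw [← Finset.sum_mul]
        gcongr
    _ = _ := by ring

/-- `Fin n → ℝ` carries the sup norm, so the basis is taken in `EuclideanSpace` and transported back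
to dot products. -/
theorem exists_orthonormal_spanning (V : Submodule ℝ (Fin n → ℝ)) :
    ∃ b : Fin (Module.finrank ℝ V) → Fin n → ℝ, (∀ a, b a ⬝ᵥ b a = 1) ∧
      ∀ x ∈ V, ∃ c : Fin (Module.finrank ℝ V) → ℝ, x = ∑ a, c a • b a ∧
        ∑ a, c a ^ 2 = x ⬝ᵥ x := by
  let e : (Fin n → ℝ) ≃ₗ[ℝ] EuclideanSpace ℝ (Fin n) := (WithLp.linearEquiv 2 ℝ _).symm
  let V' := V.map (e : (Fin n → ℝ) →ₗ[ℝ] EuclideanSpace ℝ (Fin n))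
  have hr : Module.finrank ℝ V' = Module.finrank ℝ V := LinearEquiv.finrank_map_eq e V
  let B : OrthonormalBasis (Fin (Module.finrank ℝ V)) ℝ V' :=
    (stdOrthonormalBasis ℝ V').reindex (finCongr hr)
  have hin : ∀ x y : EuclideanSpace ℝ (Fin n), inner ℝ x y = (x.ofLp ⬝ᵥ y.ofLp) := by
    intro x y
    simp [PiLp.inner_apply, dotProduct, mul_comm]
  refine ⟨fun a => (B a : EuclideanSpace ℝ (Fin n)).ofLp, fun a => ?_, fun x hx => ?_⟩
  · rw [← hin, ← Submodule.coe_inner, real_inner_self_eq_norm_sq, B.norm_eq_one, one_pow]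
  · have hx' : e x ∈ V' := Submodule.mem_map_of_mem hx
    refine ⟨fun a => B.repr ⟨e x, hx'⟩ a, ?_, ?_⟩
    · have h1 := congrArg (fun z : V' => (z : EuclideanSpace ℝ (Fin n)).ofLp)
        (B.sum_repr ⟨e x, hx'⟩)
      simp only [Submodule.coe_sum, Submodule.coe_smul, WithLp.ofLp_sum, WithLp.ofLp_smul] at h1
      exact h1.symm
    · have h2 := B.repr.norm_map ⟨e x, hx'⟩
      have h3 : ‖B.repr ⟨e x, hx'⟩‖ ^ 2 = ∑ a, B.repr ⟨e x, hx'⟩ a ^ 2 := by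
        rw [EuclideanSpace.norm_sq_eq]
        simp only [Real.norm_eq_abs, sq_abs]
      rw [← h3, h2, ← real_inner_self_eq_norm_sq, Submodule.coe_inner, hin]
      rfl

theorem embeddingDefect_eq_toLinearMap₂' (h : Fin n → Fin t) (σ : Fin n → Bool)
    (u v : Fin n → ℝ) : embeddingDefect h σ u v =
      Matrix.toLinearMap₂' ℝ ((sparseEmbedding h σ)ᵀ * sparseEmbedding h σ - 1) u v := by
  rw [Matrix.toLinearMap₂'_apply', embeddingDefect, Matrix.sub_mulVec, dotProduct_sub,
    Matrix.one_mulVec, ← Matrix.mulVec_mulVec, Matrix.dotProduct_mulVec u, Matrix.vecMul_transpose]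

/-- The sparse embedding is a subspace embedding with constant probability. -/
theorem sparseEmbedding_subspace (ht : 0 < t) {m : ℕ} (W : Matrix (Fin n) (Fin m) ℝ) :
    ((Measure.pi fun _ : Fin n => uniformOn (Set.univ : Set (Fin t))).prod
      (Measure.pi fun _ : Fin n => uniformOn (Set.univ : Set Bool)))
      {ω | ∃ y : Fin m → ℝ,
        (sparseEmbedding ω.1 ω.2 *ᵥ (W *ᵥ y)) ⬝ᵥ (sparseEmbedding ω.1 ω.2 *ᵥ (W *ᵥ y)) <
          1 / 2 * ((W *ᵥ y) ⬝ᵥ (W *ᵥ y)) ∨ 3 / 2 * ((W *ᵥ y) ⬝ᵥ (W *ᵥ y)) <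
          (sparseEmbedding ω.1 ω.2 *ᵥ (W *ᵥ y)) ⬝ᵥ (sparseEmbedding ω.1 ω.2 *ᵥ (W *ᵥ y))} ≤
      ENNReal.ofReal (8 * m ^ 2 / t) := by
  have : Nonempty (Fin t) := ⟨⟨0, ht⟩⟩
  rw [pi_uniformOn_univ, pi_uniformOn_univ, prod_uniformOn_univ]
  set V := LinearMap.range W.mulVecLin
  set r := Module.finrank ℝ V with hr
  have hrm : r ≤ m := by
    have := LinearMap.finrank_range_le W.mulVecLin
    simpa using this
  obtain ⟨b, hb1, hbV⟩ := exists_orthonormal_spanning V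
  -- `F` is the squared Frobenius norm of the defect in an orthonormal basis of the range of `W`.
  -- Its mean is at most `2 m ^ 2 / t`, and Markov at `1 / 4` gives `8 m ^ 2 / t`.
  let F : (Fin n → Fin t) × (Fin n → Bool) → ℝ := fun ω =>
    ∑ p : Fin r × Fin r, embeddingDefect ω.1 ω.2 (b p.1) (b p.2) ^ 2
  have hFsum : ∑ ω, F ω ≤ 2 * m ^ 2 / t * Fintype.card ((Fin n → Fin t) × (Fin n → Bool)) := by
    rw [Finset.sum_comm]
    calc _ ≤ ∑ _p : Fin r × Fin r,
          2 / (t : ℝ) * Fintype.card ((Fin n → Fin t) × (Fin n → Bool)) := by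
          refine Finset.sum_le_sum fun p _ => ?_
          refine (sum_embeddingDefect_sq_le ht (b p.1) (b p.2)).trans (le_of_eq ?_)
          rw [hb1, hb1]; ring
      _ = r ^ 2 * (2 / (t : ℝ) * Fintype.card ((Fin n → Fin t) × (Fin n → Bool))) := by
          rw [Finset.sum_const, nsmul_eq_mul, Finset.card_univ, Fintype.card_prod,
            Fintype.card_fin]
          push_cast; ring
      _ ≤ m ^ 2 * (2 / (t : ℝ) * Fintype.card ((Fin n → Fin t) × (Fin n → Bool))) := by
          gcongr
      _ = _ := by ring
  have hmarkov := uniformOn_univ_le_of_sum_le (f := F)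
    (fun ω => Finset.sum_nonneg fun p _ => sq_nonneg _) (a := 1 / 4) (by norm_num) hFsum
  refine le_trans (measure_mono ?_) (hmarkov.trans (le_of_eq (by congr 1; ring)))
  rintro ω ⟨y, hy⟩
  by_contra hF
  have hF : F ω < 1 / 4 := not_le.1 hF
  obtain ⟨c, hc, hcs⟩ := hbV (W *ᵥ y) ⟨y, rfl⟩
  have h1 : embeddingDefect ω.1 ω.2 (W *ᵥ y) (W *ᵥ y) =
      ∑ p : Fin r × Fin r, (c p.1 * c p.2) * embeddingDefect ω.1 ω.2 (b p.1) (b p.2) := by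
    simp only [embeddingDefect_eq_toLinearMap₂']
    rw [hc]
    simp only [map_sum, LinearMap.sum_apply, map_smul, LinearMap.smul_apply, smul_eq_mul]
    rw [Fintype.sum_prod_type, Finset.sum_comm]
    refine Finset.sum_congr rfl fun i _ => ?_
    rw [Finset.mul_sum]
    refine Finset.sum_congr rfl fun j _ => ?_
    ring
  set N := (W *ᵥ y) ⬝ᵥ (W *ᵥ y) with hN
  -- Cauchy-Schwarz: the Frobenius norm dominates the quadratic form, so `F < 1 / 4` means relative
  -- error at most `1 / 2`.
  have h2 : embeddingDefect ω.1 ω.2 (W *ᵥ y) (W *ᵥ y) ^ 2 ≤ N ^ 2 * F ω := by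
    rw [h1]
    refine (Finset.sum_mul_sq_le_sq_mul_sq _ _ _).trans (le_of_eq ?_)
    congr 1
    rw [← hcs, sq, Finset.sum_mul_sum, Fintype.sum_prod_type]
    simp only [mul_pow]
    rfl
  have hN0 : 0 ≤ N := by rw [← hcs]; exact Finset.sum_nonneg fun _ _ => sq_nonneg _
  have h3 : embeddingDefect ω.1 ω.2 (W *ᵥ y) (W *ᵥ y) ^ 2 ≤ (1 / 2 * N) ^ 2 := by
    nlinarith [sq_nonneg N]
  have h4 := abs_le_of_sq_le_sq h3 (by positivity)
  rw [abs_le, embeddingDefect, ← hN] at h4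
  rcases hy with hy | hy <;> linarith [h4.1, h4.2]

end SparseEmbedding

/-! ## Gaussian sketching matrices -/

section Gaussian

/-- Negative `b > -1/2` is allowed, so one formula serves both tails. -/
theorem lintegral_exp_neg_mul_sq_gaussianReal {b : ℝ} (hb : 0 < 1 + 2 * b) :
    ∫⁻ x, ENNReal.ofReal (Real.exp (-b * x ^ 2)) ∂gaussianReal 0 1 =
      ENNReal.ofReal (Real.sqrt (1 / (1 + 2 * b))) := by
  have hb' : 0 < b + 1 / 2 := by linarith
  rw [gaussianReal_of_var_ne_zero _ one_ne_zero,
    lintegral_withDensity_eq_lintegral_mul _ (measurable_gaussianPDF _ _) (by fun_prop)]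
  have h1 : ∀ x : ℝ, (gaussianPDF 0 1 * fun x => ENNReal.ofReal (Real.exp (-b * x ^ 2))) x =
      ENNReal.ofReal ((Real.sqrt (2 * Real.pi))⁻¹ * Real.exp (-(b + 1 / 2) * x ^ 2)) := by
    intro x
    rw [Pi.mul_apply, gaussianPDF_def, ← ENNReal.ofReal_mul (gaussianPDFReal_nonneg _ _ _),
      gaussianPDFReal_def]
    simp only [NNReal.coe_one, mul_one, sub_zero]
    rw [mul_assoc, ← Real.exp_add]
    congr 3
    ring
  simp only [h1]
  rw [← ofReal_integral_eq_lintegral_ofReal ((integrable_exp_neg_mul_sq hb').const_mul _)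
    (ae_of_all _ fun x => by positivity), integral_const_mul, integral_gaussian]
  congr 1
  rw [← Real.sqrt_inv, ← Real.sqrt_mul (by positivity)]
  congr 1
  have := Real.pi_pos
  have := hb.ne'
  field_simp
  rw [add_comm (2 * b), div_self this]

/-- Rotation invariance: a linear functional of unit norm maps the standard Gaussian measure to the
standard normal law. -/
theorem map_dotProduct_pi_gaussianReal {t : ℕ} {x : Fin t → ℝ} (hx : x ⬝ᵥ x = 1) :
    (Measure.pi fun _ : Fin t => gaussianReal 0 1).map (fun g => g ⬝ᵥ x) = gaussianReal 0 1 := by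
  let L : StrongDual ℝ (EuclideanSpace ℝ (Fin t)) := innerSL ℝ (WithLp.toLp 2 x)
  have h1 : (fun g : Fin t → ℝ => g ⬝ᵥ x) = L ∘ WithLp.toLp 2 := by
    ext g
    simp [L, PiLp.inner_apply, dotProduct]
  have hL : ‖L‖ ^ 2 = 1 := by
    rw [innerSL_apply_norm, EuclideanSpace.norm_sq_eq]
    simpa [dotProduct, sq] using hx
  rw [h1, ← Measure.map_map (by fun_prop) (by fun_prop), map_pi_eq_stdGaussian,
    IsGaussian.map_eq_gaussianReal, variance_dual_stdGaussian, hL,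
    integral_strongDual_stdGaussian]
  simp

/-- The law of a matrix with independent standard Gaussian entries. -/
noncomputable abbrev gaussianLaw (t₁ t₂ : ℕ) : Measure (Fin t₂ → Fin t₁ → ℝ) :=
  Measure.pi fun _ => Measure.pi fun _ => gaussianReal 0 1

theorem lintegral_exp_neg_mul_sum_sq {t₁ t₂ : ℕ} {x : Fin t₁ → ℝ} (hx : x ⬝ᵥ x = 1) {b : ℝ}
    (hb : 0 < 1 + 2 * b) :
    ∫⁻ g, ENNReal.ofReal (Real.exp (-b * ∑ i, (g i ⬝ᵥ x) ^ 2)) ∂gaussianLaw t₁ t₂ =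
      ENNReal.ofReal (Real.sqrt (1 / (1 + 2 * b)) ^ t₂) := by
  let X : (Fin t₁ → ℝ) → ENNReal := fun h => ENNReal.ofReal (Real.exp (-b * (h ⬝ᵥ x) ^ 2))
  have hdot : Measurable fun h : Fin t₁ → ℝ => h ⬝ᵥ x := by
    unfold dotProduct; fun_prop
  have hX : Measurable X := by
    have : Measurable fun y : ℝ => ENNReal.ofReal (Real.exp (-b * y ^ 2)) := by fun_prop
    exact this.comp hdot
  have h1 : ∀ g : Fin t₂ → Fin t₁ → ℝ,
      ENNReal.ofReal (Real.exp (-b * ∑ i, (g i ⬝ᵥ x) ^ 2)) = ∏ i, X (g i) := by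
    intro g
    rw [Finset.mul_sum, Real.exp_sum, ENNReal.ofReal_prod_of_nonneg fun i _ => (Real.exp_pos _).le]
  simp only [h1]
  rw [lintegral_prod_eq_prod_lintegral_of_indepFun Finset.univ
    (fun (i : Fin t₂) (g : Fin t₂ → Fin t₁ → ℝ) => X (g i))
    (iIndepFun_pi fun _ => hX.aemeasurable) fun i => hX.comp (measurable_pi_apply i)]
  have h2 : ∀ i : Fin t₂, ∫⁻ g, X (g i) ∂gaussianLaw t₁ t₂ =
      ENNReal.ofReal (Real.sqrt (1 / (1 + 2 * b))) := by
    intro i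
    rw [(measurePreserving_eval (fun _ : Fin t₂ => Measure.pi fun _ : Fin t₁ =>
      gaussianReal 0 1) i).lintegral_comp hX, ← lintegral_exp_neg_mul_sq_gaussianReal hb]
    conv_rhs => rw [← map_dotProduct_pi_gaussianReal hx, lintegral_map (by fun_prop) hdot]
  simp only [h2, Finset.prod_const, Finset.card_univ, Fintype.card_fin]
  rw [ENNReal.ofReal_pow (Real.sqrt_nonneg _)]

/-- Chernoff bound; the sign of `b` selects the lower or the upper tail. -/
theorem gaussianLaw_exp_markov {t₁ t₂ : ℕ} {x : Fin t₁ → ℝ} (hx : x ⬝ᵥ x = 1) {b a : ℝ}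
    (hb : 0 < 1 + 2 * b) :
    gaussianLaw t₁ t₂ {g | b * ∑ i, (g i ⬝ᵥ x) ^ 2 ≤ a * t₂} ≤
      ENNReal.ofReal ((Real.exp a * Real.sqrt (1 / (1 + 2 * b))) ^ t₂) := by
  have hm : Measurable fun g : Fin t₂ → Fin t₁ → ℝ =>
      ENNReal.ofReal (Real.exp (-b * ∑ i, (g i ⬝ᵥ x) ^ 2)) := by
    unfold dotProduct; fun_prop
  have h1 : {g : Fin t₂ → Fin t₁ → ℝ | b * ∑ i, (g i ⬝ᵥ x) ^ 2 ≤ a * t₂} ⊆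
      {g | ENNReal.ofReal (Real.exp (-(a * t₂))) ≤
        ENNReal.ofReal (Real.exp (-b * ∑ i, (g i ⬝ᵥ x) ^ 2))} := by
    intro g hg
    refine ENNReal.ofReal_le_ofReal (Real.exp_le_exp.2 ?_)
    have : b * ∑ i, (g i ⬝ᵥ x) ^ 2 ≤ a * t₂ := hg
    linarith
  refine (measure_mono h1).trans ((meas_ge_le_lintegral_div hm.aemeasurable
    (by simp [Real.exp_pos]) ENNReal.ofReal_ne_top).trans ?_)
  rw [lintegral_exp_neg_mul_sum_sq hx hb, ← ENNReal.ofReal_div_of_pos (Real.exp_pos _)]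
  refine ENNReal.ofReal_le_ofReal (le_of_eq ?_)
  rw [Real.exp_neg, div_inv_eq_mul, mul_pow, ← Real.exp_nat_mul, mul_comm a, mul_comm]

theorem gaussianLaw_deviation_le {t₁ t₂ : ℕ} {x : Fin t₁ → ℝ} (hx : x ⬝ᵥ x = 1) :
    gaussianLaw t₁ t₂ {g | ∑ i, (g i ⬝ᵥ x) ^ 2 < 1 / 4 * t₂ ∨
      9 * t₂ < ∑ i, (g i ⬝ᵥ x) ^ 2} ≤ ENNReal.ofReal (2 * (3 / 4) ^ t₂) := by
  -- Both parameter choices make the base at most `3 / 4`: `exp (3/8) / 2` for the lower tail and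
  -- `exp (-9/4) * √2` for the upper one.
  have h1 := gaussianLaw_exp_markov (t₂ := t₂) hx (b := 3 / 2) (a := 3 / 8) (by norm_num)
  have h2 := gaussianLaw_exp_markov (t₂ := t₂) hx (b := -1 / 4) (a := -9 / 4) (by norm_num)
  have he1 : Real.exp (3 / 8) * Real.sqrt (1 / (1 + 2 * (3 / 2))) ≤ 3 / 4 := by
    have h3 : Real.sqrt (1 / (1 + 2 * (3 / 2))) = 1 / 2 := by
      rw [show (1 : ℝ) / (1 + 2 * (3 / 2)) = (1 / 2) ^ 2 by norm_num]
      exact Real.sqrt_sq (by norm_num)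
    have h4 : Real.exp (3 / 8) ≤ 3 / 2 := by
      refine le_of_pow_le_pow_left₀ (n := 8) (by norm_num) (by norm_num) ?_
      rw [← Real.exp_nat_mul]
      have h5 : Real.exp ((8 : ℕ) * (3 / 8)) = Real.exp 1 ^ 3 := by
        rw [← Real.exp_nat_mul]; norm_num
      have h6 := Real.exp_one_lt_d9
      rw [h5]
      calc Real.exp 1 ^ 3 ≤ 2.72 ^ 3 := by gcongr; linarith
        _ ≤ _ := by norm_num
    rw [h3]; linarith
  have he2 : Real.exp (-9 / 4) * Real.sqrt (1 / (1 + 2 * (-1 / 4))) ≤ 3 / 4 := by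
    have h3 : Real.sqrt (1 / (1 + 2 * (-1 / 4))) ≤ 3 / 2 := by
      rw [Real.sqrt_le_left (by norm_num)]; norm_num
    have h4 : Real.exp (-9 / 4) ≤ 1 / 2 := by
      rw [neg_div, Real.exp_neg, inv_le_comm₀ (Real.exp_pos _) (by norm_num)]
      have := Real.add_one_le_exp (9 / 4 : ℝ)
      linarith
    have h5 := Real.exp_pos (-9 / 4)
    nlinarith [Real.sqrt_nonneg (1 / (1 + 2 * (-1 / 4) : ℝ))]
  calc _ ≤ gaussianLaw t₁ t₂ ({g | 3 / 2 * ∑ i, (g i ⬝ᵥ x) ^ 2 ≤ 3 / 8 * t₂} ∪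
        {g | -1 / 4 * ∑ i, (g i ⬝ᵥ x) ^ 2 ≤ -9 / 4 * t₂}) := by
        refine measure_mono fun g hg => ?_
        rcases hg with hg | hg
        · left; simp only [Set.mem_ofPred_eq]; linarith
        · right; simp only [Set.mem_ofPred_eq]; linarith
    _ ≤ ENNReal.ofReal ((3 / 4) ^ t₂) + ENNReal.ofReal ((3 / 4) ^ t₂) := by
        refine (measure_union_le _ _).trans (add_le_add (h1.trans ?_) (h2.trans ?_)) <;>
        exact ENNReal.ofReal_le_ofReal (pow_le_pow_left₀ (by positivity) (by assumption) _)
    _ = _ := by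
        rw [← ENNReal.ofReal_add (by positivity) (by positivity)]
        congr 1; ring

/-- Bootstrap: the approximation error involves `‖T‖` itself, but with factor `1 / 32`, so the upper
bound on unit vectors can be solved for `‖T‖`; the lower bound follows. -/
theorem norm_bounds_of_net {V E : Type*} [NormedAddCommGroup V] [NormedSpace ℝ V]
    [NormedAddCommGroup E] [NormedSpace ℝ E] (T : V →L[ℝ] E) {F : Finset V}
    (hF : ∀ x : V, ‖x‖ ≤ 1 → ∃ y ∈ F, ‖x - y‖ ≤ 1 / 2 ^ 5)
    (hT : ∀ y ∈ F, 1 / 2 * ‖y‖ ≤ ‖T y‖ ∧ ‖T y‖ ≤ 3 * ‖y‖) (x : V) :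
    1 / 4 * ‖x‖ ≤ ‖T x‖ ∧ ‖T x‖ ≤ 4 * ‖x‖ := by
  have hunit : ∀ x : V, ‖x‖ = 1 → 31 / 64 - ‖T‖ / 32 ≤ ‖T x‖ ∧ ‖T x‖ ≤ 99 / 32 + ‖T‖ / 32 := by
    intro x hx
    obtain ⟨y, hy, hxy⟩ := hF x hx.le
    obtain ⟨h1, h2⟩ := hT y hy
    have h3 : ‖T x - T y‖ ≤ ‖T‖ / 32 := by
      rw [← map_sub]
      refine (T.le_opNorm _).trans ?_
      have := mul_le_mul_of_nonneg_left hxy (norm_nonneg T)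
      linarith
    have h4 := norm_sub_norm_le (T x) (T y)
    have h5 := norm_sub_norm_le (T y) (T x)
    rw [norm_sub_rev] at h5
    have h6 := norm_sub_norm_le x y
    have h7 := norm_sub_norm_le y x
    rw [norm_sub_rev] at h7
    norm_num at hxy
    constructor <;> linarith
  have hK : ‖T‖ ≤ 99 / 31 := by
    have := ContinuousLinearMap.opNorm_le_of_unit_norm (by positivity)
      fun x hx => (hunit x hx).2
    linarith
  refine ⟨?_, (T.le_opNorm x).trans (by gcongr; linarith)⟩
  rcases eq_or_ne x 0 with rfl | hx0
  · simp
  have hxn : 0 < ‖x‖ := norm_pos_iff.2 hx0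
  have h1 := (hunit (‖x‖⁻¹ • x) (by rw [norm_smul, norm_inv, norm_norm,
    inv_mul_cancel₀ hxn.ne'])).1
  rw [map_smul, norm_smul, norm_inv, norm_norm, ← div_eq_inv_mul] at h1
  have h2 : 1 / 4 ≤ ‖T x‖ / ‖x‖ := by linarith
  rwa [le_div_iff₀ hxn] at h2

/-- The constant `50` makes `5 ^ 5 * (3 / 4) ^ 50 ≤ 1 / 80`, so the Chernoff bound beats a net of
mesh `1 / 32`. -/
theorem three_quarters_pow_le {d m t : ℕ} (hd : 1 ≤ d) (hm : m ≤ d) (ht : 50 * d ≤ t) :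
    (5 : ℝ) ^ (5 * m) * (2 * (3 / 4) ^ t) ≤ 1 / 40 := by
  have h1 : (5 : ℝ) ^ (5 * m) ≤ (5 ^ 5) ^ d := by
    rw [← pow_mul]
    exact pow_le_pow_right₀ (by norm_num) (by omega)
  have h2 : ((3 : ℝ) / 4) ^ t ≤ ((3 / 4) ^ 50) ^ d := by
    rw [← pow_mul]
    exact pow_le_pow_of_le_one (by norm_num) (by norm_num) ht
  calc (5 : ℝ) ^ (5 * m) * (2 * (3 / 4) ^ t) ≤ (5 ^ 5) ^ d * (2 * ((3 / 4) ^ 50) ^ d) := by gcongr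
    _ = 2 * (5 ^ 5 * (3 / 4) ^ 50) ^ d := by rw [mul_pow]; ring
    _ ≤ 2 * (1 / 80) ^ d := by gcongr; norm_num
    _ ≤ 2 * (1 / 80) ^ 1 := by
        gcongr 2 * ?_
        exact pow_le_pow_of_le_one (by norm_num) (by norm_num) hd
    _ = 1 / 40 := by norm_num

theorem gaussianMatrix_dotProduct_self {t₁ t₂ : ℕ} (g : Fin t₂ → Fin t₁ → ℝ) (z : Fin t₁ → ℝ) :
    (gaussianMatrix g *ᵥ z) ⬝ᵥ (gaussianMatrix g *ᵥ z) = (∑ i, (g i ⬝ᵥ z) ^ 2) / t₂ := by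
  have h : ∀ i, (gaussianMatrix g *ᵥ z) i = 1 / Real.sqrt t₂ * (g i ⬝ᵥ z) := by
    intro i
    rw [gaussianMatrix, Matrix.smul_mulVec]
    rfl
  have h0 : (gaussianMatrix g *ᵥ z) ⬝ᵥ (gaussianMatrix g *ᵥ z) =
      ∑ i, (gaussianMatrix g *ᵥ z) i * (gaussianMatrix g *ᵥ z) i := rfl
  simp only [h0, h]
  rw [Finset.sum_div]
  refine Finset.sum_congr rfl fun i _ => ?_
  have := Real.mul_self_sqrt (Nat.cast_nonneg (α := ℝ) t₂)
  rw [mul_mul_mul_comm, div_mul_div_comm, this]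
  ring

/-- A Gaussian matrix is a subspace embedding with constant probability. -/
theorem gaussianMatrix_subspace {t₁ t₂ m d : ℕ} (hd : 1 ≤ d) (hm : m ≤ d) (ht : 50 * d ≤ t₂)
    (W : Matrix (Fin t₁) (Fin m) ℝ) :
    gaussianLaw t₁ t₂ {g | ∃ y : Fin m → ℝ,
        (gaussianMatrix g *ᵥ (W *ᵥ y)) ⬝ᵥ (gaussianMatrix g *ᵥ (W *ᵥ y)) <
          1 / 16 * ((W *ᵥ y) ⬝ᵥ (W *ᵥ y)) ∨ 16 * ((W *ᵥ y) ⬝ᵥ (W *ᵥ y)) <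
          (gaussianMatrix g *ᵥ (W *ᵥ y)) ⬝ᵥ (gaussianMatrix g *ᵥ (W *ᵥ y))} ≤
      ENNReal.ofReal (1 / 40) := by
  classical
  let e : (Fin t₁ → ℝ) ≃ₗ[ℝ] EuclideanSpace ℝ (Fin t₁) := (WithLp.linearEquiv 2 ℝ _).symm
  let V := LinearMap.range ((e : (Fin t₁ → ℝ) →ₗ[ℝ] EuclideanSpace ℝ (Fin t₁)) ∘ₗ W.mulVecLin)
  have ht2 : (0 : ℝ) < t₂ := by exact_mod_cast (by omega : 0 < t₂)
  have hr : Module.finrank ℝ V ≤ m := by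
    have := LinearMap.finrank_range_le
      ((e : (Fin t₁ → ℝ) →ₗ[ℝ] EuclideanSpace ℝ (Fin t₁)) ∘ₗ W.mulVecLin)
    simpa using this
  have hnorm : ∀ {t : ℕ} (x : EuclideanSpace ℝ (Fin t)), ‖x‖ ^ 2 = x.ofLp ⬝ᵥ x.ofLp := by
    intro t x
    rw [EuclideanSpace.norm_sq_eq]
    simp [dotProduct, sq]
  obtain ⟨F, hFcard, hF⟩ := exists_net V 5
  let F' := F.filter fun y => y ≠ 0
  let v : V → Fin t₁ → ℝ := fun y => ‖y‖⁻¹ • (y : EuclideanSpace ℝ (Fin t₁)).ofLp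
  have hv : ∀ y : V, y ≠ 0 → v y ⬝ᵥ v y = 1 := by
    intro y hy
    have h1 := hnorm (y : EuclideanSpace ℝ (Fin t₁))
    have h2 : ‖y‖ ≠ 0 := norm_ne_zero_iff.2 hy
    simp only [v, smul_dotProduct, dotProduct_smul, smul_eq_mul]
    rw [← h1, Submodule.coe_norm]
    have h3 : ‖(y : EuclideanSpace ℝ (Fin t₁))‖ ≠ 0 := h2
    field_simp
  let B : Set (Fin t₂ → Fin t₁ → ℝ) := ⋃ y ∈ F', {g | ∑ i, (g i ⬝ᵥ v y) ^ 2 < 1 / 4 * t₂ ∨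
      9 * t₂ < ∑ i, (g i ⬝ᵥ v y) ^ 2}
  have hB : gaussianLaw t₁ t₂ B ≤ ENNReal.ofReal (1 / 40) := by
    calc gaussianLaw t₁ t₂ B ≤ ∑ _y ∈ F', ENNReal.ofReal (2 * (3 / 4) ^ t₂) :=
          (measure_biUnion_finset_le _ _).trans (Finset.sum_le_sum fun y hy =>
            gaussianLaw_deviation_le (hv y (Finset.mem_filter.1 hy).2))
      _ = ENNReal.ofReal (F'.card * (2 * (3 / 4) ^ t₂)) := by
          rw [Finset.sum_const, nsmul_eq_mul, ENNReal.ofReal_mul (Nat.cast_nonneg _),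
            ENNReal.ofReal_natCast]
      _ ≤ ENNReal.ofReal (1 / 40) := by
          refine ENNReal.ofReal_le_ofReal (le_trans ?_ (three_quarters_pow_le hd (hr.trans hm) ht))
          gcongr
          exact_mod_cast (Finset.card_filter_le _ _).trans hFcard
  refine le_trans (measure_mono ?_) hB
  rintro g ⟨y, hy⟩
  by_contra hg
  let T : V →L[ℝ] EuclideanSpace ℝ (Fin t₂) := LinearMap.toContinuousLinearMap
    (((WithLp.linearEquiv 2 ℝ (Fin t₂ → ℝ)).symm : (Fin t₂ → ℝ) →ₗ[ℝ] _) ∘ₗ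
      (gaussianMatrix g).mulVecLin ∘ₗ (e.symm : EuclideanSpace ℝ (Fin t₁) →ₗ[ℝ] _) ∘ₗ V.subtype)
  have hTsq : ∀ x : V, ‖T x‖ ^ 2 =
      (∑ i, (g i ⬝ᵥ (x : EuclideanSpace ℝ (Fin t₁)).ofLp) ^ 2) / t₂ := by
    intro x
    rw [hnorm, ← gaussianMatrix_dotProduct_self]
    rfl
  have hTF : ∀ y ∈ F, 1 / 2 * ‖y‖ ≤ ‖T y‖ ∧ ‖T y‖ ≤ 3 * ‖y‖ := by
    intro y hyF
    rcases eq_or_ne y 0 with rfl | hy0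
    · simp
    have h1 : ¬ (∑ i, (g i ⬝ᵥ v y) ^ 2 < 1 / 4 * t₂ ∨ 9 * t₂ < ∑ i, (g i ⬝ᵥ v y) ^ 2) :=
      fun h => hg (Set.mem_biUnion (Finset.mem_filter.2 ⟨hyF, hy0⟩) h)
    push Not at h1
    have hyn : 0 < ‖y‖ := norm_pos_iff.2 hy0
    have h2 : ‖T y‖ ^ 2 = ‖y‖ ^ 2 * ((∑ i, (g i ⬝ᵥ v y) ^ 2) / t₂) := by
      rw [hTsq, ← mul_div_assoc, Finset.mul_sum]
      congr 1
      refine Finset.sum_congr rfl fun i _ => ?_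
      simp only [v, dotProduct_smul, smul_eq_mul]
      field_simp
    have h3 : 1 / 4 ≤ (∑ i, (g i ⬝ᵥ v y) ^ 2) / t₂ := by rw [le_div_iff₀ ht2]; exact h1.1
    have h4 : (∑ i, (g i ⬝ᵥ v y) ^ 2) / t₂ ≤ 9 := by rw [div_le_iff₀ ht2]; exact h1.2
    have h5 : (0 : ℝ) < ‖y‖ ^ 2 := by positivity
    constructor
    · refine le_of_sq_le_sq ?_ (norm_nonneg _)
      rw [h2]; nlinarith
    · refine le_of_sq_le_sq ?_ (by positivity)
      rw [h2]; nlinarith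
  have hmem : e (W *ᵥ y) ∈ V := ⟨y, rfl⟩
  have key := norm_bounds_of_net T hF hTF ⟨e (W *ᵥ y), hmem⟩
  have h1 : ‖T ⟨e (W *ᵥ y), hmem⟩‖ ^ 2 =
      (gaussianMatrix g *ᵥ (W *ᵥ y)) ⬝ᵥ (gaussianMatrix g *ᵥ (W *ᵥ y)) := by
    rw [hnorm]; rfl
  have h2 : ‖(⟨e (W *ᵥ y), hmem⟩ : V)‖ ^ 2 = (W *ᵥ y) ⬝ᵥ (W *ᵥ y) := by
    rw [Submodule.coe_norm, hnorm]; rfl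
  rw [← h1, ← h2] at hy
  have h3 := norm_nonneg (⟨e (W *ᵥ y), hmem⟩ : V)
  have h4 := norm_nonneg (T ⟨e (W *ᵥ y), hmem⟩)
  rcases hy with hy | hy
  · nlinarith [key.1]
  · nlinarith [key.2]

end Gaussian

/-! ## Measurability and fibrewise bounds -/

section Measurability

/-- A strict inequality between functions continuous in `y` may be tested on a countable dense set.
The bad events quantify over all vectors, and Fubini needs them measurable. -/
theorem measurableSet_exists_lt {α Y : Type*} [MeasurableSpace α] [TopologicalSpace Y]
    [SecondCountableTopology Y] {f g : Y → α → ℝ} (hf : ∀ y, Measurable (f y))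
    (hg : ∀ y, Measurable (g y)) (hfc : ∀ ω, Continuous fun y => f y ω)
    (hgc : ∀ ω, Continuous fun y => g y ω) : MeasurableSet {ω | ∃ y, f y ω < g y ω} := by
  obtain ⟨s, hs, hd⟩ := TopologicalSpace.exists_countable_dense Y
  have : {ω | ∃ y, f y ω < g y ω} = ⋃ y ∈ s, {ω | f y ω < g y ω} := by
    ext ω
    simp only [Set.mem_ofPred_eq, Set.mem_iUnion, exists_prop]
    constructor
    · rintro ⟨y, hy⟩
      obtain ⟨z, hz, hzs⟩ := hd.exists_mem_open (isOpen_lt (hfc ω) (hgc ω)) ⟨y, hy⟩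
      exact ⟨z, hz, hzs⟩
    · rintro ⟨y, _, hy⟩
      exact ⟨y, hy⟩
  rw [this]
  exact MeasurableSet.biUnion hs fun y _ => measurableSet_lt (hf y) (hg y)

/-- Lets each stage of randomness be analysed with the earlier stages frozen. -/
theorem measure_prod_le_of_forall {α β : Type*} [MeasurableSpace α] [MeasurableSpace β]
    {μ : Measure α} {ν : Measure β} [IsProbabilityMeasure μ] [SFinite ν] {S : Set (α × β)}
    (hS : MeasurableSet S) {c : ENNReal} (h : ∀ a, ν (Prod.mk a ⁻¹' S) ≤ c) :
    μ.prod ν S ≤ c := by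
  rw [Measure.prod_apply hS]
  calc ∫⁻ a, ν (Prod.mk a ⁻¹' S) ∂μ ≤ ∫⁻ _, c ∂μ := lintegral_mono h
    _ = c := by simp

theorem isProbabilityMeasure_uniformOn_univ {α : Type*} [Finite α] [MeasurableSpace α]
    [MeasurableSingletonClass α] [Nonempty α] :
    IsProbabilityMeasure (uniformOn (Set.univ : Set α)) :=
  isProbabilityMeasure_uniformOn Set.finite_univ Set.univ_nonempty

variable {n t₁ t₂ : ℕ}

theorem measurable_dotProduct_self {α : Type*} [MeasurableSpace α] {k : ℕ}
    {f : α → Fin k → ℝ} (hf : ∀ i, Measurable fun a => f a i) :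
    Measurable fun a => f a ⬝ᵥ f a := by
  unfold dotProduct
  exact Finset.measurable_sum _ fun i _ => (hf i).mul (hf i)

theorem diagInv_mulVec (u z : Fin n → ℝ) : diagInv u *ᵥ z = fun i => (u i)⁻¹ * z i := by
  ext i
  rw [diagInv, Matrix.mulVec_diagonal]

theorem measurable_diagInv_mulVec (z : Fin n → ℝ) (i : Fin n) :
    Measurable fun ω : Sample n t₁ t₂ => (diagInv ω.1 *ᵥ z) i := by
  simp only [diagInv_mulVec]
  fun_prop

theorem measurable_sparseEmbedding_mulVec (z : Fin n → ℝ) (k : Fin t₁) :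
    Measurable fun ω : Sample n t₁ t₂ =>
      (sparseEmbedding ω.2.1 ω.2.2.1 *ᵥ (diagInv ω.1 *ᵥ z)) k := by
  simp only [sparseEmbedding_mulVec]
  refine Finset.measurable_sum _ fun i _ => Measurable.ite ?_ ?_ measurable_const
  · have h : Measurable fun ω : Sample n t₁ t₂ => ω.2.1 i := by fun_prop
    exact h (measurableSet_singleton k)
  · have h : Measurable fun ω : Sample n t₁ t₂ => signValue (ω.2.2.1 i) :=
      (measurable_of_countable signValue).comp (by fun_prop)
    exact h.mul (measurable_diagInv_mulVec z i)

theorem measurable_gaussianMatrix_mulVec (z : Fin n → ℝ) (k : Fin t₂) :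
    Measurable fun ω : Sample n t₁ t₂ => (gaussianMatrix ω.2.2.2 *ᵥ
      (sparseEmbedding ω.2.1 ω.2.2.1 *ᵥ (diagInv ω.1 *ᵥ z))) k := by
  have h : ∀ ω : Sample n t₁ t₂, (gaussianMatrix ω.2.2.2 *ᵥ
      (sparseEmbedding ω.2.1 ω.2.2.1 *ᵥ (diagInv ω.1 *ᵥ z))) k = 1 / Real.sqrt t₂ *
        ∑ j, ω.2.2.2 k j * (sparseEmbedding ω.2.1 ω.2.2.1 *ᵥ (diagInv ω.1 *ᵥ z)) j := by
    intro ω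
    rw [gaussianMatrix, Matrix.smul_mulVec]
    rfl
  simp only [h]
  refine measurable_const.mul (Finset.measurable_sum _ fun j _ => Measurable.mul ?_ ?_)
  · fun_prop
  · exact measurable_sparseEmbedding_mulVec z j

end Measurability

/-! ## The sketch is a subspace embedding -/

section Sketch

variable {G : ℝ → ℝ} {n t₁ t₂ m : ℕ}

theorem sketchMatrix_mulVec (ω : Sample n t₁ t₂) (z : Fin n → ℝ) : sketchMatrix ω *ᵥ z =
    gaussianMatrix ω.2.2.2 *ᵥ (sparseEmbedding ω.2.1 ω.2.2.1 *ᵥ (diagInv ω.1 *ᵥ z)) := by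
  rw [sketchMatrix, Matrix.mulVec_mulVec, Matrix.mulVec_mulVec]

theorem isProbabilityMeasure_sketchLaw (ht₁ : 0 < t₁) :
    IsProbabilityMeasure ((Measure.pi fun _ : Fin n => uniformOn (Set.univ : Set (Fin t₁))).prod
      ((Measure.pi fun _ : Fin n => uniformOn (Set.univ : Set Bool)).prod
        (Measure.pi fun _ : Fin t₂ => Measure.pi fun _ : Fin t₁ => gaussianReal 0 1))) := by
  have : Nonempty (Fin t₁) := ⟨⟨0, ht₁⟩⟩
  have := isProbabilityMeasure_uniformOn_univ (α := Fin t₁)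
  have := isProbabilityMeasure_uniformOn_univ (α := Bool)
  infer_instance

theorem sFinite_sketchLaw (ht₁ : 0 < t₁) :
    SFinite ((Measure.pi fun _ : Fin n => uniformOn (Set.univ : Set (Fin t₁))).prod
      ((Measure.pi fun _ : Fin n => uniformOn (Set.univ : Set Bool)).prod
        (Measure.pi fun _ : Fin t₂ => Measure.pi fun _ : Fin t₁ => gaussianReal 0 1))) := by
  have := isProbabilityMeasure_sketchLaw (n := n) (t₂ := t₂) ht₁
  have : SigmaFinite
      ((Measure.pi fun _ : Fin n => uniformOn (Set.univ : Set (Fin t₁))).prod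
      ((Measure.pi fun _ : Fin n => uniformOn (Set.univ : Set Bool)).prod
        (Measure.pi fun _ : Fin t₂ => Measure.pi fun _ : Fin t₁ => gaussianReal 0 1))) :=
    IsFiniteMeasure.toSigmaFinite _
  infer_instance

theorem isProbabilityMeasure_sampleLaw (hG : PropertyP G) (ht₁ : 0 < t₁) :
    IsProbabilityMeasure (sampleLaw hG n t₁ t₂) := by
  have := isProbabilityMeasure_orliczLaw hG
  have := isProbabilityMeasure_sketchLaw (n := n) (t₂ := t₂) ht₁
  unfold sampleLaw
  infer_instance

theorem sampleLaw_fst_le (hG : PropertyP G) (ht₁ : 0 < t₁) {S : Set (Fin n → ℝ)}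
    (hS : MeasurableSet S) :
    sampleLaw hG n t₁ t₂ {ω | ω.1 ∈ S} = Measure.pi (fun _ : Fin n => orliczLaw hG) S := by
  have : Nonempty (Fin t₁) := ⟨⟨0, ht₁⟩⟩
  have := isProbabilityMeasure_orliczLaw hG
  have := isProbabilityMeasure_uniformOn_univ (α := Fin t₁)
  have := isProbabilityMeasure_uniformOn_univ (α := Bool)
  have := sFinite_sketchLaw (n := n) (t₂ := t₂) ht₁
  unfold sampleLaw
  exact measurePreserving_fst.measure_preimage hS.nullMeasurableSet

theorem sampleLaw_sparseEmbedding (hG : PropertyP G) (ht₁ : 0 < t₁)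
    (A : Matrix (Fin n) (Fin m) ℝ) :
    sampleLaw hG n t₁ t₂ {ω | ∃ y : Fin m → ℝ,
      (sparseEmbedding ω.2.1 ω.2.2.1 *ᵥ (diagInv ω.1 *ᵥ (A *ᵥ y))) ⬝ᵥ
          (sparseEmbedding ω.2.1 ω.2.2.1 *ᵥ (diagInv ω.1 *ᵥ (A *ᵥ y))) <
        1 / 2 * ((diagInv ω.1 *ᵥ (A *ᵥ y)) ⬝ᵥ (diagInv ω.1 *ᵥ (A *ᵥ y))) ∨
      3 / 2 * ((diagInv ω.1 *ᵥ (A *ᵥ y)) ⬝ᵥ (diagInv ω.1 *ᵥ (A *ᵥ y))) <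
        (sparseEmbedding ω.2.1 ω.2.2.1 *ᵥ (diagInv ω.1 *ᵥ (A *ᵥ y))) ⬝ᵥ
          (sparseEmbedding ω.2.1 ω.2.2.1 *ᵥ (diagInv ω.1 *ᵥ (A *ᵥ y)))} ≤
      ENNReal.ofReal (8 * m ^ 2 / t₁) := by
  have : Nonempty (Fin t₁) := ⟨⟨0, ht₁⟩⟩
  have := isProbabilityMeasure_orliczLaw hG
  have := isProbabilityMeasure_uniformOn_univ (α := Fin t₁)
  have := isProbabilityMeasure_uniformOn_univ (α := Bool)
  have := sFinite_sketchLaw (n := n) (t₂ := t₂) ht₁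
  refine measure_prod_le_of_forall ?_ fun u => ?_
  · simp only [exists_or, Set.ofPred_or]
    refine MeasurableSet.union ?_ ?_
    · refine measurableSet_exists_lt (fun y => ?_) (fun y => ?_) (fun ω => ?_) fun ω => ?_
      · exact measurable_dotProduct_self fun k => measurable_sparseEmbedding_mulVec _ k
      · exact (measurable_dotProduct_self fun k => measurable_diagInv_mulVec _ k).const_mul _
      · fun_prop
      · fun_prop
    · refine measurableSet_exists_lt (fun y => ?_) (fun y => ?_) (fun ω => ?_) fun ω => ?_
      · exact (measurable_dotProduct_self fun k => measurable_diagInv_mulVec _ k).const_mul _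
      · exact measurable_dotProduct_self fun k => measurable_sparseEmbedding_mulVec _ k
      · fun_prop
      · fun_prop
  · have hmp : MeasurePreserving
        (Prod.map id Prod.fst :
          (Fin n → Fin t₁) × ((Fin n → Bool) × (Fin t₂ → Fin t₁ → ℝ)) → _)
        ((Measure.pi fun _ : Fin n => uniformOn (Set.univ : Set (Fin t₁))).prod
          ((Measure.pi fun _ : Fin n => uniformOn (Set.univ : Set Bool)).prod
            (gaussianLaw t₁ t₂)))
        ((Measure.pi fun _ : Fin n => uniformOn (Set.univ : Set (Fin t₁))).prod
          (Measure.pi fun _ : Fin n => uniformOn (Set.univ : Set Bool))) :=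
      (MeasurePreserving.id _).prod measurePreserving_fst
    have h := sparseEmbedding_subspace ht₁ (diagInv u * A)
    -- With `D` frozen, the Gaussian coordinates are projected away; the event depends only on
    -- hashes and signs.
    rw [← hmp.measure_preimage (Set.toFinite _).measurableSet.nullMeasurableSet] at h
    simp only [← Matrix.mulVec_mulVec] at h
    exact h

theorem sampleLaw_gaussianMatrix (hG : PropertyP G) (ht₁ : 0 < t₁) {d : ℕ} (hd : 1 ≤ d)
    (hm : m ≤ d) (ht₂ : 50 * d ≤ t₂) (A : Matrix (Fin n) (Fin m) ℝ) :
    sampleLaw hG n t₁ t₂ {ω | ∃ y : Fin m → ℝ,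
      (gaussianMatrix ω.2.2.2 *ᵥ (sparseEmbedding ω.2.1 ω.2.2.1 *ᵥ (diagInv ω.1 *ᵥ (A *ᵥ y)))) ⬝ᵥ
        (gaussianMatrix ω.2.2.2 *ᵥ
          (sparseEmbedding ω.2.1 ω.2.2.1 *ᵥ (diagInv ω.1 *ᵥ (A *ᵥ y)))) <
        1 / 16 * ((sparseEmbedding ω.2.1 ω.2.2.1 *ᵥ (diagInv ω.1 *ᵥ (A *ᵥ y))) ⬝ᵥ
          (sparseEmbedding ω.2.1 ω.2.2.1 *ᵥ (diagInv ω.1 *ᵥ (A *ᵥ y)))) ∨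
      16 * ((sparseEmbedding ω.2.1 ω.2.2.1 *ᵥ (diagInv ω.1 *ᵥ (A *ᵥ y))) ⬝ᵥ
          (sparseEmbedding ω.2.1 ω.2.2.1 *ᵥ (diagInv ω.1 *ᵥ (A *ᵥ y)))) <
        (gaussianMatrix ω.2.2.2 *ᵥ
          (sparseEmbedding ω.2.1 ω.2.2.1 *ᵥ (diagInv ω.1 *ᵥ (A *ᵥ y)))) ⬝ᵥ
        (gaussianMatrix ω.2.2.2 *ᵥ
          (sparseEmbedding ω.2.1 ω.2.2.1 *ᵥ (diagInv ω.1 *ᵥ (A *ᵥ y))))} ≤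
      ENNReal.ofReal (1 / 40) := by
  have : Nonempty (Fin t₁) := ⟨⟨0, ht₁⟩⟩
  have := isProbabilityMeasure_orliczLaw hG
  have := isProbabilityMeasure_uniformOn_univ (α := Fin t₁)
  have := isProbabilityMeasure_uniformOn_univ (α := Bool)
  have := sFinite_sketchLaw (n := n) (t₂ := t₂) ht₁
  have hmeas : MeasurableSet {ω : Sample n t₁ t₂ | ∃ y : Fin m → ℝ,
      (gaussianMatrix ω.2.2.2 *ᵥ (sparseEmbedding ω.2.1 ω.2.2.1 *ᵥ (diagInv ω.1 *ᵥ (A *ᵥ y)))) ⬝ᵥ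
        (gaussianMatrix ω.2.2.2 *ᵥ
          (sparseEmbedding ω.2.1 ω.2.2.1 *ᵥ (diagInv ω.1 *ᵥ (A *ᵥ y)))) <
        1 / 16 * ((sparseEmbedding ω.2.1 ω.2.2.1 *ᵥ (diagInv ω.1 *ᵥ (A *ᵥ y))) ⬝ᵥ
          (sparseEmbedding ω.2.1 ω.2.2.1 *ᵥ (diagInv ω.1 *ᵥ (A *ᵥ y)))) ∨
      16 * ((sparseEmbedding ω.2.1 ω.2.2.1 *ᵥ (diagInv ω.1 *ᵥ (A *ᵥ y))) ⬝ᵥ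
          (sparseEmbedding ω.2.1 ω.2.2.1 *ᵥ (diagInv ω.1 *ᵥ (A *ᵥ y)))) <
        (gaussianMatrix ω.2.2.2 *ᵥ
          (sparseEmbedding ω.2.1 ω.2.2.1 *ᵥ (diagInv ω.1 *ᵥ (A *ᵥ y)))) ⬝ᵥ
        (gaussianMatrix ω.2.2.2 *ᵥ
          (sparseEmbedding ω.2.1 ω.2.2.1 *ᵥ (diagInv ω.1 *ᵥ (A *ᵥ y))))} := by
    simp only [exists_or, Set.ofPred_or]
    refine MeasurableSet.union ?_ ?_
    · refine measurableSet_exists_lt (fun y => ?_) (fun y => ?_) (fun ω => ?_) fun ω => ?_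
      · exact measurable_dotProduct_self fun k => measurable_gaussianMatrix_mulVec _ k
      · exact (measurable_dotProduct_self fun k =>
          measurable_sparseEmbedding_mulVec _ k).const_mul _
      · fun_prop
      · fun_prop
    · refine measurableSet_exists_lt (fun y => ?_) (fun y => ?_) (fun ω => ?_) fun ω => ?_
      · exact (measurable_dotProduct_self fun k =>
          measurable_sparseEmbedding_mulVec _ k).const_mul _
      · exact measurable_dotProduct_self fun k => measurable_gaussianMatrix_mulVec _ k
      · fun_prop
      · fun_prop
  -- Freeze `D`, the hashes and the signs in turn, until only the Gaussian matrix is random.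
  refine measure_prod_le_of_forall hmeas fun u => ?_
  have hmeas' := hmeas.preimage (measurable_prodMk_left (x := u))
  refine measure_prod_le_of_forall hmeas' fun h => ?_
  have hmeas'' := hmeas'.preimage (measurable_prodMk_left (x := h))
  refine measure_prod_le_of_forall hmeas'' fun σ => ?_
  have key := gaussianMatrix_subspace (t₂ := t₂) hd hm ht₂ (sparseEmbedding h σ * (diagInv u * A))
  simp only [← Matrix.mulVec_mulVec] at key
  exact key

/-- The sketch is a subspace embedding for the range of `D⁻¹ A`, with constant probability. -/
theorem exists_sketch_subspace (hG : PropertyP G) {d : ℕ} (hd : 1 ≤ d) (hm : m ≤ d)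
    (ht₁ : 320 * d ^ 2 ≤ t₁) (ht₂ : 50 * d ≤ t₂) (A : Matrix (Fin n) (Fin m) ℝ) :
    ∃ B : Set (Sample n t₁ t₂), sampleLaw hG n t₁ t₂ B ≤ ENNReal.ofReal (1 / 20) ∧
      ∀ ω ∉ B, ∀ y : Fin m → ℝ,
        1 / 32 * ((diagInv ω.1 *ᵥ (A *ᵥ y)) ⬝ᵥ (diagInv ω.1 *ᵥ (A *ᵥ y))) ≤
          (sketchMatrix ω *ᵥ (A *ᵥ y)) ⬝ᵥ (sketchMatrix ω *ᵥ (A *ᵥ y)) ∧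
        (sketchMatrix ω *ᵥ (A *ᵥ y)) ⬝ᵥ (sketchMatrix ω *ᵥ (A *ᵥ y)) ≤
          24 * ((diagInv ω.1 *ᵥ (A *ᵥ y)) ⬝ᵥ (diagInv ω.1 *ᵥ (A *ᵥ y))) := by
  have hd2 : 0 < d ^ 2 := by positivity
  have ht₁0 : 0 < t₁ := by omega
  have h1 := sampleLaw_sparseEmbedding (t₂ := t₂) hG ht₁0 A
  have h2 := sampleLaw_gaussianMatrix hG ht₁0 hd hm ht₂ A
  refine ⟨_, (measure_union_le _ _).trans ((add_le_add
    (h1.trans (?_ : _ ≤ ENNReal.ofReal (1 / 40))) h2).trans (le_of_eq ?_)), fun ω hω y => ?_⟩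
  -- The constant `320` comes from `8 * 40`: failure probability `8 m ^ 2 / t₁` at most `1 / 40`.
  · refine ENNReal.ofReal_le_ofReal ?_
    have ht : (320 : ℝ) * d ^ 2 ≤ t₁ := by exact_mod_cast ht₁
    have hm' : (m : ℝ) ^ 2 ≤ d ^ 2 := by gcongr
    rw [div_le_div_iff₀ (by exact_mod_cast ht₁0) (by norm_num)]
    linarith
  · rw [← ENNReal.ofReal_add (by norm_num) (by norm_num)]; norm_num
  · simp only [Set.mem_union, Set.mem_ofPred_eq, not_or, not_exists, not_lt] at hω
    have h3 := hω.1 y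
    have h4 := hω.2 y
    -- The distortions multiply: `1/2 * 1/16 = 1/32` and `3/2 * 16 = 24`.
    rw [sketchMatrix_mulVec]
    constructor <;> linarith [h3.1, h3.2, h4.1, h4.2]

end Sketch

/-! ## Accuracy of the sketched solution -/

section Accuracy

theorem isMoorePenrose_pinv {m n : ℕ} (M : Matrix (Fin m) (Fin n) ℝ) :
    IsMoorePenrose M (pinv M) :=
  (exists_isMoorePenrose M).choose_spec

/-- `Q = M M†` is an orthogonal projection and `M (M† y - x) = -Q (M x - y)`; projections do not
lengthen vectors. -/
theorem pinv_mulVec_sub_le {m n : ℕ} (M : Matrix (Fin m) (Fin n) ℝ) (y : Fin m → ℝ)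
    (x : Fin n → ℝ) :
    (M *ᵥ (pinv M *ᵥ y - x)) ⬝ᵥ (M *ᵥ (pinv M *ᵥ y - x)) ≤ (M *ᵥ x - y) ⬝ᵥ (M *ᵥ x - y) := by
  have hM := isMoorePenrose_pinv M
  set Q := M * pinv M with hQ
  have hQQ : Qᵀ * Q = Q := by
    rw [hM.symm_left, hQ, ← Matrix.mul_assoc, hM.mul_mul_left]
  have h1 : M *ᵥ (pinv M *ᵥ y - x) = -(Q *ᵥ (M *ᵥ x - y)) := by
    rw [Matrix.mulVec_sub, Matrix.mulVec_sub, Matrix.mulVec_mulVec, Matrix.mulVec_mulVec,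
      hQ, hM.mul_mul_left]
    abel
  generalize M *ᵥ x - y = v at h1 ⊢
  have h2 : (Q *ᵥ v) ⬝ᵥ (Q *ᵥ v) = v ⬝ᵥ (Q *ᵥ v) := by
    conv_rhs => rw [← hQQ, ← Matrix.mulVec_mulVec, Matrix.dotProduct_mulVec,
      Matrix.vecMul_transpose]
  have h3 : 0 ≤ (v - Q *ᵥ v) ⬝ᵥ (v - Q *ᵥ v) := by
    simpa using dotProduct_star_self_nonneg (v - Q *ᵥ v)
  rw [h1, neg_dotProduct_neg]
  rw [sub_dotProduct, dotProduct_sub, dotProduct_sub, dotProduct_comm (Q *ᵥ v) v] at h3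
  linarith

theorem norm_le_sqrt_dotProduct_self {n : ℕ} (z : Fin n → ℝ) : ‖z‖ ≤ Real.sqrt (z ⬝ᵥ z) := by
  refine (pi_norm_le_iff_of_nonneg (Real.sqrt_nonneg _)).2 fun i => ?_
  rw [Real.norm_eq_abs]
  refine Real.abs_le_sqrt ?_
  rw [sq]
  exact Finset.single_le_sum (f := fun i => z i * z i) (fun j _ => mul_self_nonneg _)
    (Finset.mem_univ i)

theorem natLog_add_one_le {n : ℕ} (hn : 2 ≤ n) : (Nat.log 2 n + 1 : ℝ) ≤ 3 * Real.log n := by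
  have h2 : (0 : ℝ) < n := by positivity
  have h1 : (Nat.log 2 n : ℝ) * Real.log 2 ≤ Real.log n := by
    rw [← Real.log_pow]
    refine Real.log_le_log (by positivity) ?_
    exact_mod_cast Nat.pow_log_le_self 2 (by omega)
  have h3 : Real.log 2 ≤ Real.log n := Real.log_le_log (by norm_num) (by exact_mod_cast hn)
  have h4 := Real.log_two_gt_d9
  have h5 : (0 : ℝ) ≤ Nat.log 2 n := Nat.cast_nonneg _
  nlinarith

theorem one_le_natLog_add_one (n : ℕ) : (1 : ℝ) ≤ Nat.log 2 n + 1 := by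
  linarith [show (0 : ℝ) ≤ Nat.log 2 n from Nat.cast_nonneg _]

variable {G : ℝ → ℝ}

/-- Split `A x̂ - b = A (x̂ - x) + (A x - b)`. The first summand is bounded through the sup norm and
the `ℓ₂` norm after `D⁻¹`, the sketch, and the projection bound. Only a lower bound on the column
space and an upper bound on a single residual enter. -/
theorem orliczNorm_sketchedSolution_le (hG : PropertyP G) {n d t₁ t₂ : ℕ}
    {A : Matrix (Fin n) (Fin d) ℝ} {b : Fin n → ℝ} {ω : Sample n t₁ t₂} (x : Fin d → ℝ)
    {κ δ : ℝ} (hκ : 0 ≤ κ)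
    (hcontr : ∀ y, orliczNorm G (A *ᵥ y) ≤ κ * ‖diagInv ω.1 *ᵥ (A *ᵥ y)‖)
    (hlow : ∀ y, 1 / 32 * ((diagInv ω.1 *ᵥ (A *ᵥ y)) ⬝ᵥ (diagInv ω.1 *ᵥ (A *ᵥ y))) ≤
      (sketchMatrix ω *ᵥ (A *ᵥ y)) ⬝ᵥ (sketchMatrix ω *ᵥ (A *ᵥ y)))
    (hup : (sketchMatrix ω *ᵥ (A *ᵥ x - b)) ⬝ᵥ (sketchMatrix ω *ᵥ (A *ᵥ x - b)) ≤ δ) :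
    orliczNorm G (A *ᵥ sketchedSolution A b ω - b) ≤
      κ * Real.sqrt (32 * δ) + orliczNorm G (A *ᵥ x - b) := by
  set xhat := sketchedSolution A b ω with hx
  have h1 : A *ᵥ xhat - b = A *ᵥ (xhat - x) + (A *ᵥ x - b) := by
    rw [Matrix.mulVec_sub]; abel
  have h2 := pinv_mulVec_sub_le (sketchMatrix ω * A) (sketchMatrix ω *ᵥ b) x
  rw [← Matrix.mulVec_mulVec, ← Matrix.mulVec_mulVec, ← Matrix.mulVec_sub (sketchMatrix ω)] at h2
  have h3 := hlow (xhat - x)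
  have h4 : ‖diagInv ω.1 *ᵥ (A *ᵥ (xhat - x))‖ ≤ Real.sqrt (32 * δ) := by
    refine (norm_le_sqrt_dotProduct_self _).trans (Real.sqrt_le_sqrt ?_)
    have h5 := h3.trans (h2.trans hup)
    linarith
  rw [h1]
  refine (orliczNorm_add_le hG _ _).trans (add_le_add ((hcontr _).trans ?_) le_rfl)
  gcongr

theorem sketchedSolution_accuracy (hG : PropertyP G) : ∃ β : ℝ, 0 < β ∧
    ∀ n d k₁ k₂ : ℕ, 2 ≤ n → 1 ≤ d → 320 ≤ k₁ → 50 ≤ k₂ →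
    ∀ (A : Matrix (Fin n) (Fin d) ℝ) (b : Fin n → ℝ) (x : Fin d → ℝ),
      ∃ E : Set (Sample n (k₁ * d ^ 2) (k₂ * d)), MeasurableSet E ∧
        4 / 5 ≤ sampleLaw hG n (k₁ * d ^ 2) (k₂ * d) E ∧
        ∀ ω ∈ E, orliczNorm G (A *ᵥ sketchedSolution A b ω - b) ≤
          β * d * Real.log n ^ 2 * orliczNorm G (A *ᵥ x - b) := by
  obtain ⟨K, hK, hdil⟩ := exists_dilation hG
  -- `352 = 8 * (4 + 40)` is the no-contraction constant, `768 = 32 * 24` the sketch distortion, and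
  -- `9` comes from `log₂ n + 1 ≤ 3 log n`, squared.
  refine ⟨9 * (352 * Real.sqrt (768 * K) + 1), by positivity,
    fun n d k₁ k₂ hn hd hk₁ hk₂ A b x => ?_⟩
  set t₁ := k₁ * d ^ 2
  set t₂ := k₂ * d
  have ht₁ : 320 * d ^ 2 ≤ t₁ := Nat.mul_le_mul_right _ hk₁
  have ht₂ : 50 * d ≤ t₂ := Nat.mul_le_mul_right _ hk₂
  have ht₁0 : 0 < t₁ := by have : 0 < d ^ 2 := by positivity
                           omega
  have := isProbabilityMeasure_sampleLaw (n := n) (t₂ := t₂) hG ht₁0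
  set μ := sampleLaw hG n t₁ t₂
  set r := A *ᵥ x - b with hr
  obtain ⟨E₁, hE₁m, hE₁μ, hE₁⟩ := hdil n (by omega) r
  obtain ⟨E₂, hE₂m, hE₂μ, hE₂⟩ := exists_no_contraction hG (show 0 < n by omega)
    (LinearMap.range A.mulVecLin)
  obtain ⟨B₁, hB₁μ, hB₁⟩ := exists_sketch_subspace hG hd le_rfl ht₁ ht₂ A
  -- The residual is embedded as the range of a one-column matrix.
  obtain ⟨B₂, hB₂μ, hB₂⟩ := exists_sketch_subspace hG hd hd ht₁ ht₂
    (Matrix.of fun (i : Fin n) (_ : Fin 1) => r i)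
  have hr1 : (Matrix.of fun (i : Fin n) (_ : Fin 1) => r i) *ᵥ (fun _ => 1) = r := by
    ext i; simp [Matrix.mulVec, dotProduct]
  let B : Set (Sample n t₁ t₂) := ({ω | ω.1 ∈ E₁ᶜ} ∪ {ω | ω.1 ∈ E₂ᶜ}) ∪ (B₁ ∪ B₂)
  have hB : μ B ≤ 1 / 5 := by
    calc μ B ≤ (ENNReal.ofReal (1 / 20) + ENNReal.ofReal (1 / 20)) +
        (ENNReal.ofReal (1 / 20) + ENNReal.ofReal (1 / 20)) := by
          refine (measure_union_le _ _).trans (add_le_add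
            ((measure_union_le _ _).trans (add_le_add ?_ ?_))
            ((measure_union_le _ _).trans (add_le_add hB₁μ hB₂μ)))
          · rw [sampleLaw_fst_le hG ht₁0 hE₁m.compl]; exact hE₁μ
          · rw [sampleLaw_fst_le hG ht₁0 hE₂m.compl]; exact hE₂μ
      _ = 1 / 5 := by
          rw [← ENNReal.ofReal_add (by norm_num) (by norm_num),
            ← ENNReal.ofReal_add (by norm_num) (by norm_num)]
          norm_num
          rw [one_div, ENNReal.ofReal_inv_of_pos (by norm_num)]
          norm_num
  -- `B` is not known to be measurable; its measurable hull has the same measure.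
  refine ⟨(toMeasurable μ B)ᶜ, (measurableSet_toMeasurable _ _).compl, ?_, fun ω hω => ?_⟩
  · rw [prob_compl_eq_one_sub (measurableSet_toMeasurable _ _), measure_toMeasurable]
    refine le_trans ?_ (tsub_le_tsub_left hB 1)
    refine ENNReal.le_sub_of_add_le_right (by norm_num) (le_of_eq ?_)
    rw [← ENNReal.add_div]
    norm_num
    exact ENNReal.div_self (by norm_num) (by norm_num)
  have hωB : ω ∉ B := fun h => hω (subset_toMeasurable μ B h)
  simp only [B, Set.mem_union, Set.mem_ofPred_eq, Set.mem_compl_iff, not_or, not_not] at hωB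
  obtain ⟨⟨h₁, h₂⟩, h₃, h₄⟩ := hωB
  set L : ℝ := Nat.log 2 n + 1 with hL
  have hL1 : 1 ≤ L := one_le_natLog_add_one n
  have hL3 : L ≤ 3 * Real.log n := natLog_add_one_le hn
  have hd' : (1 : ℝ) ≤ d := by exact_mod_cast hd
  have hN := orliczNorm_nonneg (G := G) r
  have hfin : (Module.finrank ℝ (LinearMap.range A.mulVecLin) : ℝ) ≤ d := by
    have := LinearMap.finrank_range_le A.mulVecLin
    rw [Module.finrank_pi, Fintype.card_fin] at this
    exact_mod_cast this
  have hup : (sketchMatrix ω *ᵥ r) ⬝ᵥ (sketchMatrix ω *ᵥ r) ≤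
      24 * (K * L * orliczNorm G r ^ 2) := by
    have h5 := (hB₂ ω h₄ fun _ => 1).2
    rw [hr1] at h5
    refine h5.trans ?_
    gcongr
    refine le_trans (le_of_eq ?_) (hE₁ ω.1 h₁)
    simp only [diagInv_mulVec, dotProduct, sq]
  have hκ : ∀ y, orliczNorm G (A *ᵥ y) ≤ 352 * L * d * ‖diagInv ω.1 *ᵥ (A *ᵥ y)‖ := by
    intro y
    have h6 := hE₂ ω.1 h₂ (A *ᵥ y) ⟨y, rfl⟩
    rw [diagInv_mulVec]
    refine h6.trans ?_
    refine mul_le_mul_of_nonneg_right ?_ (norm_nonneg _)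
    have h7 : L * (Module.finrank ℝ (LinearMap.range A.mulVecLin) : ℝ) ≤ L * d := by gcongr
    nlinarith
  have key := orliczNorm_sketchedSolution_le hG x (by positivity) hκ
    (fun y => (hB₁ ω h₃ y).1) hup
  rw [← hr] at key
  have h8 : Real.sqrt (32 * (24 * (K * L * orliczNorm G r ^ 2))) ≤
      Real.sqrt (768 * K) * L * orliczNorm G r := by
    have h9 : 32 * (24 * (K * L * orliczNorm G r ^ 2)) = 768 * K * L * orliczNorm G r ^ 2 := by
      ring
    rw [h9, Real.sqrt_mul (by positivity), Real.sqrt_mul (by positivity), Real.sqrt_sq hN]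
    gcongr
    -- Here `√L` is rounded up to `L`, which turns `log^{3/2} n` into `log² n`.
    exact Real.sqrt_le_iff.2 ⟨by positivity, by nlinarith⟩
  have h10 : L ^ 2 ≤ 9 * Real.log n ^ 2 := by nlinarith
  calc _ ≤ _ := key
    _ ≤ 352 * L * d * (Real.sqrt (768 * K) * L * orliczNorm G r) + orliczNorm G r := by gcongr
    _ ≤ 352 * L * d * (Real.sqrt (768 * K) * L * orliczNorm G r) +
        d * L ^ 2 * orliczNorm G r := by
        have : 1 ≤ d * L ^ 2 := by nlinarith
        nlinarith
    _ = (352 * Real.sqrt (768 * K) + 1) * d * orliczNorm G r * L ^ 2 := by ring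
    _ ≤ (352 * Real.sqrt (768 * K) + 1) * d * orliczNorm G r * (9 * Real.log n ^ 2) := by gcongr
    _ = _ := by ring

end Accuracy

/-! ## Computing the pseudoinverse by conjugate directions -/

section ConjugateDirections

variable {d : ℕ}

/-- The conjugate direction obtained from `v`, given the partial inverse `P` of `B`. -/
def conjugateDirection (B P : Matrix (Fin d) (Fin d) ℝ) (v : Fin d → ℝ) : Fin d → ℝ :=
  v - P *ᵥ (B *ᵥ v)

/-- Extend the partial inverse `P` of `B` by the conjugate direction of `v`. -/
noncomputable def extendInverse (B P : Matrix (Fin d) (Fin d) ℝ) (v : Fin d → ℝ) :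
    Matrix (Fin d) (Fin d) ℝ :=
  let u := conjugateDirection B P v
  P + Matrix.of fun i j => u i * u j / (u ⬝ᵥ (B *ᵥ u))

/-- The partial inverse of `B` on the span of its first `k` columns. -/
noncomputable def partialInverse (B : Matrix (Fin d) (Fin d) ℝ) : ℕ → Matrix (Fin d) (Fin d) ℝ
  | 0 => 0
  | k + 1 => if h : k < d then extendInverse B (partialInverse B k) (fun i => B i ⟨k, h⟩)
      else partialInverse B k

variable {B P : Matrix (Fin d) (Fin d) ℝ}

theorem dotProduct_mulVec_comm (hB : Bᵀ = B) (x y : Fin d → ℝ) :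
    x ⬝ᵥ (B *ᵥ y) = (B *ᵥ x) ⬝ᵥ y := by
  rw [Matrix.dotProduct_mulVec, ← Matrix.mulVec_transpose, hB]

theorem extendInverse_mulVec (v x : Fin d → ℝ) : extendInverse B P v *ᵥ x = P *ᵥ x +
    (conjugateDirection B P v ⬝ᵥ x /
      (conjugateDirection B P v ⬝ᵥ (B *ᵥ conjugateDirection B P v))) •
      conjugateDirection B P v := by
  rw [extendInverse, Matrix.add_mulVec]
  congr 1
  ext i
  simp only [Matrix.mulVec, dotProduct, Matrix.of_apply, Pi.smul_apply, smul_eq_mul]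
  rw [Finset.sum_div, Finset.sum_mul]
  refine Finset.sum_congr rfl fun j _ => ?_
  ring

/-- `P` acts as an inverse of the positive semidefinite matrix `B` on the vectors `v j`. -/
structure IsPartialInverse (B P : Matrix (Fin d) (Fin d) ℝ) (S : Set (Fin d → ℝ)) : Prop where
  symm : Pᵀ = P
  mem_range : ∀ x, ∃ w, P *ᵥ x = B *ᵥ w
  mul_mul : ∀ x, P *ᵥ (B *ᵥ (P *ᵥ x)) = P *ᵥ x
  inverse : ∀ v ∈ S, P *ᵥ (B *ᵥ v) = v

/-- Gram-Schmidt for the form `x ⬝ᵥ B y`. The direction `u` is `B`-orthogonal to the range of `P`,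
so the rank-one term repairs `v` without disturbing `S`. If `u ⬝ᵥ B u = 0`, then `B u = 0`; as `u`
lies in the range of the symmetric `B`, it vanishes, and the term divided by zero is harmless. -/
theorem IsPartialInverse.extend {S : Set (Fin d → ℝ)} (hP : IsPartialInverse B P S)
    (hB : Bᵀ = B) (hpsd : ∀ x, x ⬝ᵥ (B *ᵥ x) = 0 → B *ᵥ x = 0) {v : Fin d → ℝ}
    (hv : ∃ w, v = B *ᵥ w) : IsPartialInverse B (extendInverse B P v) (insert v S) := by
  set u := conjugateDirection B P v with hu
  set q := u ⬝ᵥ (B *ᵥ u) with hq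
  have hu' : u = v - P *ᵥ (B *ᵥ v) := rfl
  have hPBu : P *ᵥ (B *ᵥ u) = 0 := by
    rw [hu', Matrix.mulVec_sub, Matrix.mulVec_sub, hP.mul_mul, sub_self]
  have hur : ∃ w, u = B *ᵥ w := by
    obtain ⟨w, hw⟩ := hv
    obtain ⟨w', hw'⟩ := hP.mem_range (B *ᵥ v)
    exact ⟨w - w', by rw [Matrix.mulVec_sub, ← hw, ← hw', hu']⟩
  have hortho : ∀ x, u ⬝ᵥ (B *ᵥ (P *ᵥ x)) = 0 := by
    intro x
    rw [dotProduct_mulVec_comm hB, dotProduct_mulVec_comm hP.symm, hPBu, zero_dotProduct]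
  have hu0 : q = 0 → u = 0 := by
    intro h
    have h1 := hpsd u h
    obtain ⟨w, hw⟩ := hur
    have h2 : u ⬝ᵥ u = 0 := by
      conv_lhs => rw [hw]
      rw [dotProduct_comm, ← hw, hw, dotProduct_mulVec_comm hB, ← hw, h1, zero_dotProduct]
    exact dotProduct_self_eq_zero.1 h2
  have hqv : u ⬝ᵥ (B *ᵥ v) = q := by
    have : v = u + P *ᵥ (B *ᵥ v) := by rw [hu']; abel
    rw [this, Matrix.mulVec_add, dotProduct_add, hortho, add_zero]
  refine ⟨?_, fun x => ?_, fun x => ?_, ?_⟩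
  · rw [extendInverse, Matrix.transpose_add, hP.symm]
    congr 1
    ext i j
    simp only [Matrix.transpose_apply, Matrix.of_apply]
    ring
  · obtain ⟨w, hw⟩ := hP.mem_range x
    obtain ⟨w', hw'⟩ := hur
    rw [extendInverse_mulVec, ← hu, ← hq, hw]
    refine ⟨w + (u ⬝ᵥ x / q) • w', ?_⟩
    rw [Matrix.mulVec_add, Matrix.mulVec_smul, ← hw']
  · rw [extendInverse_mulVec, extendInverse_mulVec, ← hu, ← hq]
    have h1 : u ⬝ᵥ (B *ᵥ (P *ᵥ x + (u ⬝ᵥ x / q) • u)) = u ⬝ᵥ x / q * q := by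
      rw [Matrix.mulVec_add, dotProduct_add, hortho, Matrix.mulVec_smul, dotProduct_smul,
        zero_add, smul_eq_mul]
    rw [h1, Matrix.mulVec_add, Matrix.mulVec_smul, Matrix.mulVec_add, hP.mul_mul,
      Matrix.mulVec_smul, hPBu, smul_zero, add_zero]
    congr 1
    by_cases h : q = 0
    · simp [h]
    · rw [div_mul_cancel₀ _ h]
  · intro y hy
    rw [extendInverse_mulVec, ← hu, ← hq]
    rcases hy with rfl | hy
    · rw [hqv]
      by_cases h : q = 0
      · have := hu0 h
        rw [this, smul_zero, add_zero]
        rw [hu', sub_eq_zero] at this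
        exact this.symm
      · rw [div_self h, one_smul, hu']; abel
    · have h1 := hP.inverse y hy
      rw [h1]
      have h2 : u ⬝ᵥ (B *ᵥ y) = 0 := by rw [← h1, hortho]
      rw [h2, zero_div, zero_smul, add_zero]

theorem isPartialInverse_partialInverse (hB : Bᵀ = B)
    (hpsd : ∀ x, x ⬝ᵥ (B *ᵥ x) = 0 → B *ᵥ x = 0) (k : ℕ) :
    IsPartialInverse B (partialInverse B k) {v | ∃ j : Fin d, (j : ℕ) < k ∧ v = fun i => B i j} := by
  induction k with
  | zero =>
    refine ⟨by simp [partialInverse], fun x => ⟨0, by simp [partialInverse]⟩,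
      fun x => by simp [partialInverse], ?_⟩
    rintro v ⟨j, hj, _⟩
    exact absurd hj (Nat.not_lt_zero _)
  | succ k ih =>
    rw [partialInverse]
    split_ifs with h
    · have h1 := ih.extend hB hpsd (v := fun i => B i ⟨k, h⟩)
        ⟨Pi.single ⟨k, h⟩ 1, by ext i; simp⟩
      refine ⟨h1.symm, h1.mem_range, h1.mul_mul, ?_⟩
      rintro v ⟨j, hj, rfl⟩
      rcases Nat.lt_succ_iff_lt_or_eq.1 hj with hj | hj
      · exact h1.inverse _ (Set.mem_insert_of_mem _ ⟨j, hj, rfl⟩)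
      · have : j = ⟨k, h⟩ := Fin.ext hj
        subst this
        exact h1.inverse _ (Set.mem_insert _ _)
    · refine ⟨ih.symm, ih.mem_range, ih.mul_mul, ?_⟩
      rintro v ⟨j, hj, rfl⟩
      exact ih.inverse _ ⟨j, by omega, rfl⟩

/-- The minimum-norm least-squares solution is determined by the normal equations and membership in
the row space: the difference of two candidates lies in both the kernel of `M` and its orthogonal
complement. -/
theorem eq_pinv_mulVec_of_normal {m n : ℕ} {M : Matrix (Fin m) (Fin n) ℝ} {y : Fin m → ℝ}
    {x : Fin n → ℝ} (hx : ∃ w, x = Mᵀ *ᵥ w) (hn : Mᵀ *ᵥ (M *ᵥ x) = Mᵀ *ᵥ y) :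
    x = pinv M *ᵥ y := by
  have hM := isMoorePenrose_pinv M
  obtain ⟨w, hw⟩ := hx
  have h1 : pinv M = Mᵀ * ((pinv M)ᵀ * pinv M) := by
    rw [← Matrix.mul_assoc, ← Matrix.transpose_mul, hM.symm_right, hM.mul_mul_right]
  have h2 : Mᵀ *ᵥ (M *ᵥ (pinv M *ᵥ y)) = Mᵀ *ᵥ y := by
    rw [Matrix.mulVec_mulVec, Matrix.mulVec_mulVec]
    congr 1
    rw [Matrix.mul_assoc, ← hM.symm_left, ← Matrix.transpose_mul, hM.mul_mul_left]
  have h3 : Mᵀ *ᵥ (M *ᵥ (x - pinv M *ᵥ y)) = 0 := by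
    rw [Matrix.mulVec_sub, Matrix.mulVec_sub, hn, h2, sub_self]
  have h4 : M *ᵥ (x - pinv M *ᵥ y) = 0 := by
    rw [← dotProduct_self_eq_zero, Matrix.dotProduct_mulVec, ← Matrix.mulVec_transpose, h3,
      zero_dotProduct]
  have h5 : x - pinv M *ᵥ y = Mᵀ *ᵥ (w - ((pinv M)ᵀ * pinv M) *ᵥ y) := by
    rw [Matrix.mulVec_sub, ← hw, Matrix.mulVec_mulVec, ← h1]
  have h6 : (x - pinv M *ᵥ y) ⬝ᵥ (x - pinv M *ᵥ y) = 0 := by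
    conv_lhs => rw [h5]
    rw [Matrix.mulVec_transpose, ← Matrix.dotProduct_mulVec, ← Matrix.mulVec_transpose, ← h5, h4,
      dotProduct_zero]
  exact sub_eq_zero.1 (dotProduct_self_eq_zero.1 h6)

/-- After all `d` columns `P B B = B`. Transposing and cancelling Gram factors gives `B P B = B`,
then `B P Mᵀ = Mᵀ`, which is the normal equation; the range of `P` lies in that of `B`, hence in the
row space. The free factor `c` shows that the scaling `1 / √t₂` need not be computed. -/
theorem partialInverse_mulVec_eq_pinv {m : ℕ} {M : Matrix (Fin m) (Fin d) ℝ} {y : Fin m → ℝ}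
    {c : ℝ} (hc : c ≠ 0) :
    partialInverse (Mᵀ * M) d *ᵥ (Mᵀ *ᵥ y) = pinv (c • M) *ᵥ (c • y) := by
  have hB : (Mᵀ * M)ᵀ = Mᵀ * M := by rw [Matrix.transpose_mul, Matrix.transpose_transpose]
  have hpsd : ∀ x, x ⬝ᵥ ((Mᵀ * M) *ᵥ x) = 0 → (Mᵀ * M) *ᵥ x = 0 := by
    intro x hx
    rw [← Matrix.mulVec_mulVec] at hx ⊢
    rw [Matrix.mulVec_transpose, dotProduct_comm, ← Matrix.dotProduct_mulVec,
      dotProduct_self_eq_zero] at hx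
    rw [hx, Matrix.mulVec_zero]
  have hP := isPartialInverse_partialInverse hB hpsd d
  obtain ⟨B, hBM⟩ : ∃ B, B = Mᵀ * M := ⟨_, rfl⟩
  rw [← hBM] at hB hpsd hP ⊢
  set P := partialInverse B d
  have hPBB : P * B * B = B := by
    ext i j
    have := congrFun (hP.inverse (fun i => B i j) ⟨j, j.2, rfl⟩) i
    rw [Matrix.mulVec_mulVec] at this
    exact this
  have hBBP : B * B * P = B := by
    have := congrArg Matrix.transpose hPBB
    rwa [Matrix.transpose_mul, Matrix.transpose_mul, hB, hP.symm, ← Matrix.mul_assoc] at this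
  have hcancel : ∀ X : Matrix (Fin d) (Fin d) ℝ, B * X = B → M * X = M := by
    intro X hX
    have h0 : Mᴴ * M * (X - 1) = 0 := by
      rw [conjTranspose_eq_transpose_of_trivial, ← hBM, Matrix.mul_sub, Matrix.mul_one, hX,
        sub_self]
    have h1 := (conjTranspose_mul_self_mul_eq_zero M _).1 h0
    rwa [Matrix.mul_sub, Matrix.mul_one, sub_eq_zero] at h1
  have hBPB : B * (P * B) = B := by
    have h0 : Bᴴ * B * (P * B - 1) = 0 := by
      rw [conjTranspose_eq_transpose_of_trivial, hB, Matrix.mul_sub, Matrix.mul_one,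
        ← Matrix.mul_assoc, hBBP, sub_self]
    have h1 := (conjTranspose_mul_self_mul_eq_zero B _).1 h0
    rwa [Matrix.mul_sub, Matrix.mul_one, sub_eq_zero] at h1
  have hBPM : B * P * Mᵀ = Mᵀ := by
    have := congrArg Matrix.transpose (hcancel _ hBPB)
    rwa [Matrix.transpose_mul, Matrix.transpose_mul, hB, hP.symm] at this
  refine eq_pinv_mulVec_of_normal ?_ ?_
  · obtain ⟨w, hw⟩ := hP.mem_range (Mᵀ *ᵥ y)
    refine ⟨c⁻¹ • (M *ᵥ w), ?_⟩
    rw [hw, hBM, Matrix.transpose_smul, Matrix.mulVec_smul, Matrix.smul_mulVec, smul_smul,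
      inv_mul_cancel₀ hc, one_smul, Matrix.mulVec_mulVec]
  · have h1 : Mᵀ *ᵥ (M *ᵥ (P *ᵥ (Mᵀ *ᵥ y))) = Mᵀ *ᵥ y := by
      rw [Matrix.mulVec_mulVec, Matrix.mulVec_mulVec, Matrix.mulVec_mulVec, ← hBM, hBPM]
    rw [Matrix.transpose_smul, Matrix.smul_mulVec, Matrix.smul_mulVec, Matrix.smul_mulVec,
      Matrix.mulVec_smul, Matrix.mulVec_smul, h1]

end ConjugateDirections

/-! ## Reasoning about programs -/

section Programs

variable (ρ : RandomTape)

/-- The memories agree outside the natural-number arrays `N` and the real arrays `R`. -/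
structure AgreeOff (N R : List ℕ) (s s' : Memory) : Prop where
  nat : ∀ a, a ∉ N → s'.nat a = s.nat a
  real : ∀ a, a ∉ R → s'.real a = s.real a

namespace AgreeOff

variable {N R N' R' : List ℕ} {s s' s'' : Memory}

theorem refl (N R : List ℕ) (s : Memory) : AgreeOff N R s s :=
  ⟨fun _ _ => rfl, fun _ _ => rfl⟩

theorem trans (h : AgreeOff N R s s') (h' : AgreeOff N R s' s'') : AgreeOff N R s s'' :=
  ⟨fun a ha => (h'.nat a ha).trans (h.nat a ha), fun a ha => (h'.real a ha).trans (h.real a ha)⟩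

theorem mono (h : AgreeOff N R s s') (hN : N ⊆ N') (hR : R ⊆ R') : AgreeOff N' R' s s' :=
  ⟨fun a ha => h.nat a fun h => ha (hN h), fun a ha => h.real a fun h => ha (hR h)⟩

theorem writeNat (s : Memory) {a : ℕ} (i v : ℕ) (ha : a ∈ N) : AgreeOff N R s (s.writeNat a i v) :=
  ⟨fun b hb => by
    have : b ≠ a := fun h => hb (h ▸ ha)
    ext j
    simp [Memory.writeNat, this], fun _ _ => rfl⟩

theorem writeReal (s : Memory) {a : ℕ} (i j : ℕ) (v : ℝ) (ha : a ∈ R) :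
    AgreeOff N R s (s.writeReal a i j v) :=
  ⟨fun _ _ => rfl, fun b hb => by
    have : b ≠ a := fun h => hb (h ▸ ha)
    ext j
    simp [Memory.writeReal, this]⟩

end AgreeOff

@[simp] theorem Memory.nat_writeNat_self (s : Memory) (a i v : ℕ) :
    (s.writeNat a i v).nat a i = v := by simp [Memory.writeNat]

theorem Memory.nat_writeNat_of_ne (s : Memory) {a b : ℕ} (i v : ℕ) (h : b ≠ a) :
    (s.writeNat a i v).nat b = s.nat b := by ext; simp [Memory.writeNat, h]

theorem Memory.real_writeReal_self (s : Memory) (a i j : ℕ) (v : ℝ) (i' j' : ℕ) :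
    (s.writeReal a i j v).real a i' j' = if i' = i ∧ j' = j then v else s.real a i' j' := by
  simp [Memory.writeReal]

/-- Invariant rule: `Inv i` concerns the memory before the counter is set to `i`, and `T` bounds
every iteration. -/
theorem loop_run {x : ℕ} {E : NatExpr} {c : Program} {s : Memory} {N : ℕ} (hN : E.eval ρ s = N)
    (Inv : ℕ → Memory → Prop) (T : ℕ) (h0 : Inv 0 s)
    (hstep : ∀ i < N, ∀ s', Inv i s' → Inv (i + 1) (c.run ρ (s'.writeNat x 0 i)).1 ∧
      (c.run ρ (s'.writeNat x 0 i)).2 ≤ T) :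
    Inv N ((Program.loop x E c).run ρ s).1 ∧
      ((Program.loop x E c).run ρ s).2 ≤ E.cost + 1 + N * (1 + T) := by
  have key : ∀ M ≤ N, Inv M (Nat.rec (motive := fun _ => Memory × ℕ) (s, E.cost + 1)
        (fun i r =>
          let r' := c.run ρ (r.1.writeNat x 0 i)
          (r'.1, r.2 + 1 + r'.2)) M).1 ∧
      (Nat.rec (motive := fun _ => Memory × ℕ) (s, E.cost + 1)
        (fun i r =>
          let r' := c.run ρ (r.1.writeNat x 0 i)
          (r'.1, r.2 + 1 + r'.2)) M).2 ≤ E.cost + 1 + M * (1 + T) := by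
    intro M
    induction M with
    | zero => intro _; exact ⟨h0, by simp⟩
    | succ M ih =>
      intro hM
      obtain ⟨h1, h2⟩ := ih (by omega)
      obtain ⟨h3, h4⟩ := hstep M (by omega) _ h1
      refine ⟨h3, ?_⟩
      have : E.cost + 1 + (M + 1) * (1 + T) = E.cost + 1 + M * (1 + T) + 1 + T := by ring
      rw [this]
      exact Nat.add_le_add (Nat.add_le_add h2 le_rfl) h4
  have := key N le_rfl
  rw [Program.run, hN]
  exact this

theorem seq_run {c₁ c₂ : Program} {s : Memory} {Q : Memory → Prop} {T₁ T₂ : ℕ}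
    (h₁ : (c₁.run ρ s).2 ≤ T₁)
    (h₂ : Q (c₂.run ρ (c₁.run ρ s).1).1 ∧ (c₂.run ρ (c₁.run ρ s).1).2 ≤ T₂) :
    Q ((Program.seq c₁ c₂).run ρ s).1 ∧ ((Program.seq c₁ c₂).run ρ s).2 ≤ T₁ + T₂ := by
  rw [Program.run]
  exact ⟨h₂.1, Nat.add_le_add h₁ h₂.2⟩

/-- The current value of the loop counter `x`. -/
abbrev NatExpr.counter (x : ℕ) : NatExpr := .cell x (.const 0)

/-- For all `i < E₁` and `j < E₂`, store `∑ k < E₃, e` in the cell `i, j` of the real array `a`;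
the expression `e` may use `i`, `j`, `k` as the counters `10`, `11`, `12`. -/
def Program.sumFill (a : ℕ) (E₁ E₂ E₃ : NatExpr) (e : RealExpr) : Program :=
  .loop 10 E₁ <| .loop 11 E₂ <|
    .seq (.setReal a (.counter 10) (.counter 11) (.const 0)) <|
      .loop 12 E₃ <| .setReal a (.counter 10) (.counter 11)
        (.add (.cell a (.counter 10) (.counter 11)) e)

variable {ρ}

/-- Three nested invariants: finished rows, finished cells of the current row, partial sum of the
current cell. The hypotheses demand that the bounds and the summand be insensitive to array `a`,
which is being overwritten. -/
theorem sumFill_run_nat {a : ℕ} {E₁ E₂ E₃ : NatExpr} {e : RealExpr} {s : Memory} {I J K : ℕ}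
    {f : ℕ → ℕ → ℕ → ℝ}
    (hE : ∀ s', AgreeOff [10, 11, 12] [a] s s' →
      E₁.eval ρ s' = I ∧ E₂.eval ρ s' = J ∧ E₃.eval ρ s' = K)
    (he : ∀ s', AgreeOff [10, 11, 12] [a] s s' → ∀ i < I, ∀ j < J, ∀ k < K,
      s'.nat 10 0 = i → s'.nat 11 0 = j → s'.nat 12 0 = k → e.eval ρ s' = f i j k) :
    (AgreeOff [10, 11, 12] [a] s ((Program.sumFill a E₁ E₂ E₃ e).run ρ s).1 ∧
      ∀ i < I, ∀ j < J, ((Program.sumFill a E₁ E₂ E₃ e).run ρ s).1.real a i j =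
        ∑ k ∈ Finset.range K, f i j k) ∧
    ((Program.sumFill a E₁ E₂ E₃ e).run ρ s).2 ≤
      E₁.cost + 1 + I * (1 + (E₂.cost + 1 + J * (1 + (6 + (E₃.cost + 1 + K * (1 +
        (e.cost + 11))))))) := by
  let A := AgreeOff [10, 11, 12] [a]
  let S : ℕ → ℕ → ℝ := fun i j => ∑ k ∈ Finset.range K, f i j k
  refine loop_run ρ (hE s (AgreeOff.refl _ _ _)).1
    (fun i s' => A s s' ∧ ∀ i' < i, ∀ j < J, s'.real a i' j = S i' j) _
    ⟨AgreeOff.refl _ _ _, fun _ h => absurd h (Nat.not_lt_zero _)⟩ ?_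
  rintro i hi s₁ ⟨hA₁, hrows⟩
  have hA₁' : A s (s₁.writeNat 10 0 i) := hA₁.trans (AgreeOff.writeNat _ _ _ (by simp))
  have hmid := loop_run ρ (x := 11) (c := .seq (.setReal a (.counter 10) (.counter 11) (.const 0)) <|
      .loop 12 E₃ <| .setReal a (.counter 10) (.counter 11)
        (.add (.cell a (.counter 10) (.counter 11)) e)) (hE _ hA₁').2.1
    (fun j s' => A s s' ∧ s'.nat 10 0 = i ∧ (∀ i' < i, ∀ j < J, s'.real a i' j = S i' j) ∧
      ∀ j' < j, s'.real a i j' = S i j') (6 + (E₃.cost + 1 + K * (1 + (e.cost + 11))))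
    ⟨hA₁', by simp, hrows, fun _ h => absurd h (Nat.not_lt_zero _)⟩ ?_
  · refine ⟨⟨hmid.1.1, fun i' hi' j hj => ?_⟩, hmid.2⟩
    rcases Nat.lt_succ_iff_lt_or_eq.1 hi' with h | h
    · exact hmid.1.2.2.1 i' h j hj
    · rw [h]; exact hmid.1.2.2.2 j hj
  rintro j hj s₂ ⟨hA₂, h10, hrows₂, hrow⟩
  have h10' : (s₂.writeNat 11 0 j).nat 10 0 = i := by
    rw [Memory.nat_writeNat_of_ne _ _ _ (by norm_num), h10]
  set s₃ := s₂.writeNat 11 0 j with hs₃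
  have h11 : s₃.nat 11 0 = j := by simp [hs₃]
  have hA₃ : A s s₃ := hA₂.trans (AgreeOff.writeNat _ _ _ (by simp))
  have hrun : (Program.setReal a (.counter 10) (.counter 11) (.const 0)).run ρ s₃ =
      (s₃.writeReal a i j 0, 6) := by
    simp [Program.run, NatExpr.eval, RealExpr.eval, NatExpr.cost, RealExpr.cost, h10', h11]
  refine seq_run ρ (T₁ := 6) (Q := fun s' => A s s' ∧ s'.nat 10 0 = i ∧
    (∀ i' < i, ∀ j < J, s'.real a i' j = S i' j) ∧ ∀ j' < j + 1, s'.real a i j' = S i j')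
    (by rw [hrun]) ?_
  rw [hrun]
  set s₄ := s₃.writeReal a i j 0 with hs₄
  have hA₄ : A s s₄ := hA₃.trans (AgreeOff.writeReal _ _ _ _ (by simp))
  have hin := loop_run ρ (x := 12) (c := .setReal a (.counter 10) (.counter 11)
        (.add (.cell a (.counter 10) (.counter 11)) e)) (hE _ hA₄).2.2
    (fun k s' => A s s' ∧ s'.nat 10 0 = i ∧ s'.nat 11 0 = j ∧
      (∀ i' < i, ∀ j < J, s'.real a i' j = S i' j) ∧ (∀ j' < j, s'.real a i j' = S i j') ∧
      s'.real a i j = ∑ k ∈ Finset.range k, f i j k) (e.cost + 11)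
    ⟨hA₄, h10', h11, fun i' hi' j' hj' => ?_, fun j' hj' => ?_, ?_⟩ ?_
  · refine ⟨⟨hin.1.1, hin.1.2.1, hin.1.2.2.2.1, fun j' hj' => ?_⟩, hin.2⟩
    rcases Nat.lt_succ_iff_lt_or_eq.1 hj' with h | h
    · exact hin.1.2.2.2.2.1 j' h
    · rw [h]; exact hin.1.2.2.2.2.2
  · rw [hs₄, Memory.real_writeReal_self, if_neg (by omega)]
    exact hrows₂ i' hi' j' hj'
  · rw [hs₄, Memory.real_writeReal_self, if_neg (by omega)]
    exact hrow j' hj'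
  · rw [hs₄, Memory.real_writeReal_self]; simp
  rintro k hk s₅ ⟨hA₅, h10₅, h11₅, hrows₅, hrow₅, hcell⟩
  set s₆ := s₅.writeNat 12 0 k with hs₆
  have hA₆ : A s s₆ := hA₅.trans (AgreeOff.writeNat _ _ _ (by simp))
  have h10₆ : s₆.nat 10 0 = i := by
    rw [hs₆, Memory.nat_writeNat_of_ne _ _ _ (by norm_num), h10₅]
  have h11₆ : s₆.nat 11 0 = j := by
    rw [hs₆, Memory.nat_writeNat_of_ne _ _ _ (by norm_num), h11₅]
  have hev := he s₆ hA₆ i hi j hj k hk h10₆ h11₆ (by simp [hs₆])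
  have hrun₆ : (Program.setReal a (.counter 10) (.counter 11)
        (.add (.cell a (.counter 10) (.counter 11)) e)).run ρ s₆ =
      (s₆.writeReal a i j (s₅.real a i j + f i j k), e.cost + 11) := by
    simp only [Program.run, NatExpr.eval, RealExpr.eval, NatExpr.cost, RealExpr.cost, h10₆, h11₆,
      hev]
    refine Prod.ext rfl ?_
    simp only
    omega
  rw [hrun₆]
  refine ⟨⟨hA₆.trans (AgreeOff.writeReal _ _ _ _ (by simp)), h10₆, h11₆, fun i' hi' j' hj' => ?_,
    fun j' hj' => ?_, ?_⟩, le_rfl⟩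
  · rw [Memory.real_writeReal_self, if_neg (by omega)]
    exact hrows₅ i' hi' j' hj'
  · rw [Memory.real_writeReal_self, if_neg (by omega)]
    exact hrow₅ j' hj'
  · rw [Memory.real_writeReal_self, if_pos ⟨rfl, rfl⟩, hcell, Finset.sum_range_succ]

theorem sumFill_run {a : ℕ} {E₁ E₂ E₃ : NatExpr} {e : RealExpr} {s : Memory} {I J K : ℕ}
    (f : Fin I → Fin J → Fin K → ℝ)
    (hE : ∀ s', AgreeOff [10, 11, 12] [a] s s' →
      E₁.eval ρ s' = I ∧ E₂.eval ρ s' = J ∧ E₃.eval ρ s' = K)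
    (he : ∀ s', AgreeOff [10, 11, 12] [a] s s' → ∀ i j k,
      s'.nat 10 0 = (i : Fin I) → s'.nat 11 0 = (j : Fin J) → s'.nat 12 0 = (k : Fin K) →
      e.eval ρ s' = f i j k) :
    (AgreeOff [10, 11, 12] [a] s ((Program.sumFill a E₁ E₂ E₃ e).run ρ s).1 ∧
      ∀ i j, ((Program.sumFill a E₁ E₂ E₃ e).run ρ s).1.real a (i : Fin I) (j : Fin J) =
        ∑ k, f i j k) ∧
    ((Program.sumFill a E₁ E₂ E₃ e).run ρ s).2 ≤
      (E₁.cost + E₂.cost + E₃.cost + e.cost + 22) * ((I + 1) * (J + 1) * (K + 1)) := by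
  let g : ℕ → ℕ → ℕ → ℝ := fun i j k =>
    if h : i < I ∧ j < J ∧ k < K then f ⟨i, h.1⟩ ⟨j, h.2.1⟩ ⟨k, h.2.2⟩ else 0
  obtain ⟨⟨h1, h2⟩, h3⟩ := sumFill_run_nat (f := g) hE (fun s' hA i hi j hj k hk h10 h11 h12 => by
    rw [he s' hA ⟨i, hi⟩ ⟨j, hj⟩ ⟨k, hk⟩ h10 h11 h12]
    simp [g, hi, hj, hk])
  refine ⟨⟨h1, fun i j => ?_⟩, h3.trans ?_⟩
  · rw [h2 i i.2 j j.2, Finset.sum_range]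
    refine Finset.sum_congr rfl fun k _ => ?_
    simp [g]
  · generalize E₁.cost = c₁
    generalize E₂.cost = c₂
    generalize E₃.cost = c₃
    generalize e.cost = c₄
    have h4 : c₃ + 1 + K * (1 + (c₄ + 11)) ≤ (c₃ + c₄ + 13) * (K + 1) := by nlinarith
    have h5 : c₂ + 1 + J * (1 + (6 + (c₃ + 1 + K * (1 + (c₄ + 11))))) ≤
        (c₂ + c₃ + c₄ + 21) * ((J + 1) * (K + 1)) := by
      calc _ ≤ c₂ + 1 + J * (7 + (c₃ + c₄ + 13) * (K + 1)) := by
            have := Nat.mul_le_mul_left J h4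
            nlinarith
        _ ≤ (c₂ + 1) * ((J + 1) * (K + 1)) + (J + 1) * ((c₃ + c₄ + 20) * (K + 1)) := by
            refine Nat.add_le_add ?_ ?_
            · exact Nat.le_mul_of_pos_right _ (by positivity)
            · exact Nat.mul_le_mul (by omega) (by nlinarith)
        _ = _ := by ring
    calc _ ≤ c₁ + 1 + I * (1 + (c₂ + c₃ + c₄ + 21) * ((J + 1) * (K + 1))) := by
          have := Nat.mul_le_mul_left I h5
          nlinarith
      _ ≤ c₁ * ((I + 1) * (J + 1) * (K + 1)) +
          (c₂ + c₃ + c₄ + 22) * ((I + 1) * (J + 1) * (K + 1)) := by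
          have h6 : 1 ≤ (J + 1) * (K + 1) := Nat.one_le_iff_ne_zero.2 (by positivity)
          have h7 : 1 ≤ (I + 1) * (J + 1) * (K + 1) := Nat.one_le_iff_ne_zero.2 (by positivity)
          have h8 : c₁ ≤ c₁ * ((I + 1) * (J + 1) * (K + 1)) := Nat.le_mul_of_pos_right _ (by omega)
          have h9 : 1 + (c₂ + c₃ + c₄ + 21) * ((J + 1) * (K + 1)) ≤
              (c₂ + c₃ + c₄ + 22) * ((J + 1) * (K + 1)) := by nlinarith
          have h10 := Nat.mul_le_mul_left I h9
          have h11 : (c₂ + c₃ + c₄ + 22) * ((I + 1) * (J + 1) * (K + 1)) =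
              I * ((c₂ + c₃ + c₄ + 22) * ((J + 1) * (K + 1))) +
                (c₂ + c₃ + c₄ + 22) * ((J + 1) * (K + 1)) := by ring
          have h12 : 1 ≤ (c₂ + c₃ + c₄ + 22) * ((J + 1) * (K + 1)) :=
            Nat.one_le_iff_ne_zero.2 (by positivity)
          omega
      _ = _ := by ring

/-- For all `k < E`, add `e` to the cell `ei, ej` of the real array `a`, where the expressions
may use `k` as the counter `10`. -/
def Program.scatter (a : ℕ) (E ei ej : NatExpr) (e : RealExpr) : Program :=
  .loop 10 E <| .setReal a ei ej (.add (.cell a ei ej) e)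

/-- Target cells may repeat, so the invariant follows every cell: old content plus the contributions
so far. The cost is linear in the number of entries, which yields the input-sparsity term. -/
theorem scatter_run {a : ℕ} {E ei ej : NatExpr} {e : RealExpr} {s : Memory} {N : ℕ}
    (p q : Fin N → ℕ) (v : Fin N → ℝ) (hE : E.eval ρ s = N)
    (he : ∀ s', AgreeOff [10] [a] s s' → ∀ k, s'.nat 10 0 = (k : Fin N) →
      ei.eval ρ s' = p k ∧ ej.eval ρ s' = q k ∧ e.eval ρ s' = v k) :
    (AgreeOff [10] [a] s ((Program.scatter a E ei ej e).run ρ s).1 ∧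
      ∀ i j, ((Program.scatter a E ei ej e).run ρ s).1.real a i j =
        s.real a i j + ∑ k, if p k = i ∧ q k = j then v k else 0) ∧
    ((Program.scatter a E ei ej e).run ρ s).2 ≤
      (E.cost + 1) + N * (2 * ei.cost + 2 * ej.cost + e.cost + 4) := by
  let g : ℕ → ℕ → ℕ → ℝ := fun i j k =>
    if h : k < N then (if p ⟨k, h⟩ = i ∧ q ⟨k, h⟩ = j then v ⟨k, h⟩ else 0) else 0
  have key := loop_run ρ (x := 10) (c := .setReal a ei ej (.add (.cell a ei ej) e)) hE
    (fun k s' => AgreeOff [10] [a] s s' ∧ ∀ i j, s'.real a i j =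
      s.real a i j + ∑ k ∈ Finset.range k, g i j k) (2 * ei.cost + 2 * ej.cost + e.cost + 3)
    ⟨AgreeOff.refl _ _ _, by simp⟩ ?_
  · refine ⟨⟨key.1.1, fun i j => ?_⟩, key.2.trans (le_of_eq (by ring))⟩
    rw [show (Program.scatter a E ei ej e) =
      .loop 10 E (.setReal a ei ej (.add (.cell a ei ej) e)) from rfl, key.1.2 i j,
      Finset.sum_range]
    congr 1
    refine Finset.sum_congr rfl fun k _ => ?_
    simp [g]
  rintro k hk s₁ ⟨hA, hcell⟩
  set s₂ := s₁.writeNat 10 0 k with hs₂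
  have hA₂ : AgreeOff [10] [a] s s₂ := hA.trans (AgreeOff.writeNat _ _ _ (by simp))
  obtain ⟨h1, h2, h3⟩ := he s₂ hA₂ ⟨k, hk⟩ (by simp [hs₂])
  simp only [Program.run, RealExpr.eval, RealExpr.cost, h1, h2, h3]
  refine ⟨⟨hA₂.trans (AgreeOff.writeReal _ _ _ _ (by simp)), fun i j => ?_⟩, by omega⟩
  rw [Memory.real_writeReal_self, Finset.sum_range_succ, ← add_assoc]
  have hg : g i j k = if p ⟨k, hk⟩ = i ∧ q ⟨k, hk⟩ = j then v ⟨k, hk⟩ else 0 := by simp [g, hk]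
  rw [hg, ← hcell i j]
  by_cases hij : i = p ⟨k, hk⟩ ∧ j = q ⟨k, hk⟩
  · rw [if_pos hij, if_pos ⟨hij.1.symm, hij.2.symm⟩, hij.1, hij.2]
    rfl
  · rw [if_neg hij, if_neg fun h => hij ⟨h.1.symm, h.2.symm⟩, add_zero]
    rfl

end Programs

/-! ### Composition rules for postconditions with step bounds -/

section ProgramLogic

variable {ρ : RandomTape}

/-- Started in the memory `s`, the program `c` reaches a memory that satisfies `Q` in at most `T`
steps. -/
def Program.Achieves (ρ : RandomTape) (c : Program) (s : Memory) (Q : Memory → Prop) (T : ℕ) :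
    Prop :=
  Q (c.run ρ s).1 ∧ (c.run ρ s).2 ≤ T

namespace Program

theorem Achieves.weaken {c : Program} {s : Memory} {Q Q' : Memory → Prop} {T T' : ℕ}
    (h : c.Achieves ρ s Q T) (hQ : ∀ s', Q s' → Q' s') (hT : T ≤ T') : c.Achieves ρ s Q' T' :=
  ⟨hQ _ h.1, h.2.trans hT⟩

theorem Achieves.seq {c₁ c₂ : Program} {s : Memory} {Q₁ Q : Memory → Prop} {T₁ T₂ : ℕ}
    (h₁ : c₁.Achieves ρ s Q₁ T₁) (h₂ : ∀ s', Q₁ s' → c₂.Achieves ρ s' Q T₂) :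
    (Program.seq c₁ c₂).Achieves ρ s Q (T₁ + T₂) :=
  seq_run ρ h₁.2 (h₂ _ h₁.1)

/-- The cap `38` covers every expression of the program, and `38 + 22 = 60`, so each stage costs at
most `60 W ^ 3`. -/
theorem achieves_sumFill {a : ℕ} {E₁ E₂ E₃ : NatExpr} {e : RealExpr} {s : Memory} {I J K W : ℕ}
    (f : Fin I → Fin J → Fin K → ℝ)
    (hcost : E₁.cost + E₂.cost + E₃.cost + e.cost ≤ 38)
    (hI : I + 1 ≤ W) (hJ : J + 1 ≤ W) (hK : K + 1 ≤ W)
    (hE : ∀ s', AgreeOff [10, 11, 12] [a] s s' →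
      E₁.eval ρ s' = I ∧ E₂.eval ρ s' = J ∧ E₃.eval ρ s' = K)
    (he : ∀ s', AgreeOff [10, 11, 12] [a] s s' → ∀ i j k,
      s'.nat 10 0 = (i : Fin I) → s'.nat 11 0 = (j : Fin J) → s'.nat 12 0 = (k : Fin K) →
      e.eval ρ s' = f i j k) :
    (sumFill a E₁ E₂ E₃ e).Achieves ρ s
      (fun s' => AgreeOff [10, 11, 12] [a] s s' ∧
        ∀ i j, s'.real a (i : Fin I) (j : Fin J) = ∑ k, f i j k) (60 * W ^ 3) := by
  obtain ⟨h1, h2⟩ := sumFill_run f hE he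
  refine ⟨h1, h2.trans ?_⟩
  calc _ ≤ 60 * (W * W * W) :=
        Nat.mul_le_mul (by omega) (Nat.mul_le_mul (Nat.mul_le_mul hI hJ) hK)
    _ = _ := by ring

/-- The case of `achieves_sumFill` where the result is a column vector. -/
theorem achieves_sumFill_vec {a : ℕ} {E₁ E₃ : NatExpr} {e : RealExpr} {s : Memory} {I K W : ℕ}
    (f : Fin I → Fin K → ℝ) (hcost : E₁.cost + E₃.cost + e.cost ≤ 37)
    (hI : I + 1 ≤ W) (hK : K + 1 ≤ W) (hW : 2 ≤ W)
    (hE : ∀ s', AgreeOff [10, 11, 12] [a] s s' → E₁.eval ρ s' = I ∧ E₃.eval ρ s' = K)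
    (he : ∀ s', AgreeOff [10, 11, 12] [a] s s' → ∀ i k,
      s'.nat 10 0 = (i : Fin I) → s'.nat 12 0 = (k : Fin K) → e.eval ρ s' = f i k) :
    (sumFill a E₁ (.const 1) E₃ e).Achieves ρ s
      (fun s' => AgreeOff [10, 11, 12] [a] s s' ∧
        ∀ i, s'.real a (i : Fin I) 0 = ∑ k, f i k) (60 * W ^ 3) := by
  refine (achieves_sumFill (J := 1) (fun i _ k => f i k)
    (by simp only [NatExpr.cost]; omega) hI hW hK (fun s' h => ⟨(hE s' h).1, rfl, (hE s' h).2⟩)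
    (fun s' h i j k h10 _ h12 => he s' h i k h10 h12)).weaken ?_ le_rfl
  exact fun s' h => ⟨h.1, fun i => h.2 i 0⟩

theorem achieves_scatter {a : ℕ} {E ei ej : NatExpr} {e : RealExpr} {s : Memory} {N : ℕ}
    (p q : Fin N → ℕ) (v : Fin N → ℝ)
    (hcost : E.cost ≤ 2 ∧ 2 * ei.cost + 2 * ej.cost + e.cost ≤ 36) (hE : E.eval ρ s = N)
    (he : ∀ s', AgreeOff [10] [a] s s' → ∀ k, s'.nat 10 0 = (k : Fin N) →
      ei.eval ρ s' = p k ∧ ej.eval ρ s' = q k ∧ e.eval ρ s' = v k) :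
    (scatter a E ei ej e).Achieves ρ s
      (fun s' => AgreeOff [10] [a] s s' ∧ ∀ i j, s'.real a i j =
        s.real a i j + ∑ k, if p k = i ∧ q k = j then v k else 0) (3 + N * 40) := by
  obtain ⟨h1, h2⟩ := scatter_run p q v hE he
  exact ⟨h1, h2.trans (Nat.add_le_add (by omega) (Nat.mul_le_mul_left _ (by omega)))⟩

/-- Store the product `E * e` in cell `0` of the natural-number array `x`. -/
def mulNat (x : ℕ) (E e : NatExpr) : Program :=
  .seq (.setNat x (.const 0) (.const 0)) <|
    .loop 10 E <| .setNat x (.const 0) (.add (.cell x (.const 0)) e)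

/-- Expressions have no product of natural numbers, so it is formed by repeated addition, at a cost
linear in the first factor. -/
theorem achieves_mulNat {x : ℕ} {E e : NatExpr} {s : Memory} {N v W : ℕ} (hx : x ≠ 10)
    (hcost : E.cost + e.cost ≤ 10) (hN : N + 1 ≤ W)
    (he : ∀ s', AgreeOff [10, x] [] s s' → E.eval ρ s' = N ∧ e.eval ρ s' = v) :
    (mulNat x E e).Achieves ρ s
      (fun s' => AgreeOff [10, x] [] s s' ∧ s'.nat x 0 = N * v) (20 * W) := by
  have h0 : AgreeOff [10, x] [] s (s.writeNat x 0 0) := AgreeOff.writeNat _ _ _ (by simp)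
  have h1 : (Program.setNat x (.const 0) (.const 0)).Achieves ρ s
      (fun s' => AgreeOff [10, x] [] s s' ∧ s'.nat x 0 = 0) 3 := by
    refine ⟨⟨h0, ?_⟩, le_rfl⟩
    simp [run, NatExpr.eval]
  refine (h1.seq (Q := fun s' => AgreeOff [10, x] [] s s' ∧ s'.nat x 0 = N * v)
    (T₂ := E.cost + 1 + N * (1 + (e.cost + 5))) ?_).weaken (fun _ h => h) ?_
  · rintro s₁ ⟨hA, hz⟩
    refine loop_run ρ (he _ hA).1 (fun i s' => AgreeOff [10, x] [] s s' ∧ s'.nat x 0 = i * v) _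
      ⟨hA, by simp [hz]⟩ ?_
    rintro i - s₂ ⟨hA₂, hi⟩
    have hA₃ : AgreeOff [10, x] [] s (s₂.writeNat 10 0 i) :=
      hA₂.trans (AgreeOff.writeNat _ _ _ (by simp))
    have h2 := (he _ hA₃).2
    refine ⟨⟨hA₃.trans (AgreeOff.writeNat _ _ _ (by simp)), ?_⟩, ?_⟩
    · simp [run, NatExpr.eval, h2, Memory.nat_writeNat_of_ne _ _ _ hx, hi]
      ring
    · simp only [run, NatExpr.cost]
      omega
  · have : N * (1 + (e.cost + 5)) ≤ N * 16 := Nat.mul_le_mul_left _ (by omega)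
    omega

end Program

end ProgramLogic

/-! ## The regression program -/

section RegressionProgram

/-- A bound for the dimensions of all matrices that the program stores. -/
def sizeBound (k₁ k₂ d : ℕ) : ℕ := k₁ * d ^ 2 + k₂ * d + d + 2

/-- The memory holds the numbers of columns and of rows of the sketches. -/
structure HoldsSizes (d t₁ t₂ : ℕ) (s : Memory) : Prop where
  cols : s.nat 0 1 = d
  rows₁ : s.nat 4 0 = t₁
  rows₂ : s.nat 5 0 = t₂

theorem HoldsSizes.of_agreeOff {d t₁ t₂ : ℕ} {N R : List ℕ} {s s' : Memory}
    (h : HoldsSizes d t₁ t₂ s) (hA : AgreeOff N R s s') (h0 : 0 ∉ N) (h4 : 4 ∉ N) (h5 : 5 ∉ N) :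
    HoldsSizes d t₁ t₂ s' :=
  ⟨by rw [hA.nat 0 h0, h.cols], by rw [hA.nat 4 h4, h.rows₁], by rw [hA.nat 5 h5, h.rows₂]⟩

namespace RegressionProgram

/-- The number of columns. -/
abbrev dim : NatExpr := .cell 0 (.const 1)

/-- The number of rows of the sparse sketch. -/
abbrev rows₁ : NatExpr := .cell 4 (.const 0)

/-- The number of rows of the Gaussian sketch. -/
abbrev rows₂ : NatExpr := .cell 5 (.const 0)

/-- The entry of the real array `a` at the loop counters `x`, `y`. -/
abbrev entry (a x y : ℕ) : RealExpr := .cell a (.counter x) (.counter y)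

/-- The entry of the column vector in the real array `a` at the loop counter `x`. -/
abbrev coord (a x : ℕ) : RealExpr := .cell a (.counter x) (.const 0)

/-- Compute the numbers of rows of the two sketches. -/
def computeSizes (k₁ k₂ : ℕ) : Program :=
  .seq (.mulNat 6 dim dim) <|
    .seq (.mulNat 4 (.const k₁) (.cell 6 (.const 0))) (.mulNat 5 (.const k₂) dim)

/-- One step of the conjugate-direction method: extend the partial inverse in the real array `9`
of the matrix in the real array `7` by the column of the loop counter `13`. -/
def extendStep : Program :=
  .seq (.sumFill 10 dim (.const 1) dim (.mul (entry 7 10 12) (entry 7 12 13))) <|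
  .seq (.sumFill 11 dim (.const 1) dim (.mul (entry 9 10 12) (coord 10 12))) <|
  .seq (.sumFill 12 dim (.const 1) (.const 1) (.sub (entry 7 10 13) (coord 11 10))) <|
  .seq (.sumFill 13 dim (.const 1) dim (.mul (entry 7 10 12) (coord 12 12))) <|
  .seq (.sumFill 14 (.const 1) (.const 1) dim (.mul (coord 12 12) (coord 13 12))) <|
  -- `sumFill` clears each target cell before summing, so an update that reads array `9` goes to
  -- array `15` and is copied back. Sums of length `1` serve as assignments.
  .seq (.sumFill 15 dim dim (.const 1) (.add (entry 9 10 11)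
    (.div (.mul (coord 12 10) (coord 12 11)) (.cell 14 (.const 0) (.const 0))))) <|
  .sumFill 9 dim dim (.const 1) (entry 15 10 11)

/-- From the sparse sketch in the real arrays `3`, `4` compute the least-squares solution for the
Gaussian sketch. -/
def solve : Program :=
  .seq (.sumFill 5 rows₂ dim rows₁ (.mul (.gauss (.counter 10) (.counter 12)) (entry 3 12 11))) <|
  .seq (.sumFill 6 rows₂ (.const 1) rows₁
    (.mul (.gauss (.counter 10) (.counter 12)) (coord 4 12))) <|
  .seq (.sumFill 7 dim dim rows₂ (.mul (entry 5 12 10) (entry 5 12 11))) <|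
  .seq (.sumFill 8 dim (.const 1) rows₂ (.mul (entry 5 12 10) (coord 6 12))) <|
  .seq (.sumFill 9 dim dim (.const 0) (.const 0)) <|
  .seq (.loop 13 dim extendStep) <|
  .sumFill 2 dim (.const 1) dim (.mul (entry 9 10 12) (coord 8 12))

/-- The contribution of the nonzero entry number `10` (a loop counter), whose row is in the
natural-number array `r` and whose value is in the real array `a`, to the sparse sketch. -/
def sketchTerm (r a : ℕ) : RealExpr :=
  .div (.mul (.sign (.cell r (.counter 10))) (coord a 10)) (.orlicz (.cell r (.counter 10)))

/-- Store the sparse sketch of the input in the real arrays `3`, `4`. -/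
def sparseSketch : Program :=
  .seq (.sumFill 3 rows₁ dim (.const 0) (.const 0)) <|
  .seq (.sumFill 4 rows₁ (.const 1) (.const 0) (.const 0)) <|
  .seq (.scatter 3 (.cell 0 (.const 2)) (.unif rows₁ (.cell 1 (.counter 10)))
    (.cell 2 (.counter 10)) (sketchTerm 1 0)) <|
  .scatter 4 (.cell 0 (.const 3)) (.unif rows₁ (.cell 3 (.counter 10))) (.const 0)
    (sketchTerm 3 1)

end RegressionProgram

/-- Sketched regression: the program that computes the output of the algorithm. -/
def regressionProgram (k₁ k₂ : ℕ) : Program :=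
  .seq (RegressionProgram.computeSizes k₁ k₂) <|
    .seq RegressionProgram.sparseSketch RegressionProgram.solve

/-! ### Computation of the sizes and one conjugate-direction step -/

namespace RegressionProgram

variable {ρ : RandomTape} {k₁ k₂ d : ℕ} {s : Memory}

theorem achieves_computeSizes (hd : 1 ≤ d) (hs : s.nat 0 1 = d) :
    (computeSizes k₁ k₂).Achieves ρ s
      (fun s' => AgreeOff [4, 5, 6, 10] [] s s' ∧ HoldsSizes d (k₁ * d ^ 2) (k₂ * d) s')
      (60 * sizeBound k₁ k₂ d) := by
  have hk₁ : k₁ ≤ k₁ * d ^ 2 := Nat.le_mul_of_pos_right _ (by positivity)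
  have hk₂ : k₂ ≤ k₂ * d := Nat.le_mul_of_pos_right _ hd
  refine ((Program.achieves_mulNat (x := 6) (N := d) (v := d) (W := sizeBound k₁ k₂ d) (by norm_num)
    (by decide) (by simp only [sizeBound]; omega)
    (fun s' h => by simp [NatExpr.eval, h.nat, hs])).seq (T₂ := 20 * _ + 20 * _)
    fun s₁ ⟨hA₁, h₁⟩ => (Program.achieves_mulNat (x := 4) (N := k₁) (v := d * d)
      (W := sizeBound k₁ k₂ d) (by norm_num) (by simp [NatExpr.cost])
      (by simp only [sizeBound]; omega)
      (fun s' h => by simp [NatExpr.eval, h.nat, h₁])).seq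
    fun s₂ ⟨hA₂, h₂⟩ => (Program.achieves_mulNat (x := 5) (N := k₂) (v := d)
      (W := sizeBound k₁ k₂ d) (by norm_num) (by simp [NatExpr.cost])
      (by simp only [sizeBound]; omega)
      (fun s' h => by simp [NatExpr.eval, h.nat, hA₂.nat, hA₁.nat, hs])).weaken
    (fun s₃ ⟨hA₃, h₃⟩ => ?_) le_rfl).weaken (fun _ h => h) (by omega)
  refine ⟨(hA₁.mono (by simp) (by simp)).trans ((hA₂.mono (by simp) (by simp)).trans
    (hA₃.mono (by simp) (by simp))), ⟨?_, ?_, h₃⟩⟩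
  · simp [hA₃.nat, hA₂.nat, hA₁.nat, hs]
  · simp [hA₃.nat, h₂]; ring_nf; simp

variable {t₁ t₂ W : ℕ}

/-- With `v` the current column and `u` its conjugate direction, arrays `10` to `15` receive `B v`,
`P B v`, `u`, `B u`, `u ⬝ᵥ B u` and the extended inverse; with the copy back to `9` these are seven
stages of cost `60 W ^ 3`. -/
theorem achieves_extendStep (hs : HoldsSizes d t₁ t₂ s) (hd : d + 1 ≤ W) (hW : 2 ≤ W)
    {B P : Matrix (Fin d) (Fin d) ℝ} {k : Fin d} (hk : s.nat 13 0 = k)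
    (hB : ∀ i j : Fin d, s.real 7 i j = B i j) (hP : ∀ i j : Fin d, s.real 9 i j = P i j) :
    extendStep.Achieves ρ s
      (fun s' => AgreeOff [10, 11, 12] [9, 10, 11, 12, 13, 14, 15] s s' ∧
        ∀ i j : Fin d, s'.real 9 i j = extendInverse B P (fun i => B i k) i j)
      (420 * W ^ 3) := by
  have hdim : s.nat 0 1 = d := hs.cols
  refine ((Program.achieves_sumFill_vec (W := W) (fun i j : Fin d => B i j * B j k) (by decide)
    hd hd hW (fun s' h => by simp [NatExpr.eval, h.nat, hdim]) (fun s' h i j h10 h12 => by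
      simp [RealExpr.eval, NatExpr.eval, h.nat, h.real, h10, h12, hk, hB])).seq
    (T₂ := 60 * W ^ 3 + (60 * W ^ 3 + (60 * W ^ 3 + (60 * W ^ 3 + (60 * W ^ 3 + 60 * W ^ 3)))))
    fun s₁ ⟨hA₁, h₁⟩ =>
      (Program.achieves_sumFill_vec (W := W)
        (fun i j : Fin d => P i j * (B *ᵥ fun i => B i k) j) (by decide)
        hd hd hW (fun s' h => by simp [NatExpr.eval, h.nat, hA₁.nat, hdim])
        (fun s' h i j h10 h12 => by
          simp [RealExpr.eval, NatExpr.eval, h.real, hA₁.real, h10, h12, hP, h₁, mulVec,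
            dotProduct])).seq
    fun s₂ ⟨hA₂, h₂⟩ =>
      (Program.achieves_sumFill_vec (W := W) (K := 1)
        (fun (i : Fin d) _ => conjugateDirection B P (fun i => B i k) i) (by decide)
        hd hW hW (fun s' h => by simp [NatExpr.eval, h.nat, hA₂.nat, hA₁.nat, hdim])
        (fun s' h i j h10 h12 => by
          simp [RealExpr.eval, NatExpr.eval, h.real, h.nat, hA₂.real, hA₂.nat, hA₁.nat, hA₁.real,
            h10, hB, hk, h₂, conjugateDirection, mulVec, dotProduct, -mulVec_mulVec])).seq
    fun s₃ ⟨hA₃, h₃⟩ =>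
      (Program.achieves_sumFill_vec (W := W)
        (fun i j : Fin d => B i j * conjugateDirection B P (fun i => B i k) j) (by decide)
        hd hd hW (fun s' h => by simp [NatExpr.eval, h.nat, hA₃.nat, hA₂.nat, hA₁.nat, hdim])
        (fun s' h i j h10 h12 => by
          simp [RealExpr.eval, NatExpr.eval, h.real, hA₃.real, hA₂.real, hA₁.real,
            h10, h12, hB, h₃])).seq
    fun s₄ ⟨hA₄, h₄⟩ =>
      (Program.achieves_sumFill_vec (W := W) (I := 1)
        (fun _ (j : Fin d) => conjugateDirection B P (fun i => B i k) j *
          (B *ᵥ conjugateDirection B P (fun i => B i k)) j) (by decide)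
        hW hd hW (fun s' h => by
          simp [NatExpr.eval, h.nat, hA₄.nat, hA₃.nat, hA₂.nat, hA₁.nat, hdim])
        (fun s' h i j h10 h12 => by
          simp [RealExpr.eval, NatExpr.eval, h.real, hA₄.real, h12, h₃, h₄, mulVec,
            dotProduct])).seq
    fun s₅ ⟨hA₅, h₅⟩ =>
      (Program.achieves_sumFill (W := W) (K := 1)
        (fun (i j : Fin d) _ => extendInverse B P (fun i => B i k) i j) (by decide)
        hd hd hW (fun s' h => by
          simp [NatExpr.eval, h.nat, hA₅.nat, hA₄.nat, hA₃.nat, hA₂.nat, hA₁.nat, hdim])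
        (fun s' h i j l h10 h11 h12 => by
          have h₅' := h₅ 0
          simp at h₅'
          simp [RealExpr.eval, NatExpr.eval, h.real, hA₅.real, hA₄.real, hA₃.real, hA₂.real,
            hA₁.real, h10, h11, hP, h₃, h₅', extendInverse, dotProduct])).seq
    fun s₆ ⟨hA₆, h₆⟩ =>
      (Program.achieves_sumFill (W := W) (K := 1)
        (fun (i j : Fin d) _ => extendInverse B P (fun i => B i k) i j) (by decide)
        hd hd hW (fun s' h => by
          simp [NatExpr.eval, h.nat, hA₆.nat, hA₅.nat, hA₄.nat, hA₃.nat, hA₂.nat, hA₁.nat, hdim])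
        (fun s' h i j l h10 h11 h12 => by
          simp [RealExpr.eval, NatExpr.eval, h.real, h10, h11, h₆])).weaken
    (fun s₇ ⟨hA₇, h₇⟩ => ?_) le_rfl).weaken (fun _ h => h) (by omega)
  refine ⟨?_, fun i j => by simpa using h₇ i j⟩
  have key : ∀ {a : ℕ} {s s' : Memory}, a ∈ [9, 10, 11, 12, 13, 14, 15] →
      AgreeOff [10, 11, 12] [a] s s' → AgreeOff [10, 11, 12] [9, 10, 11, 12, 13, 14, 15] s s' :=
    fun ha h => h.mono (List.Subset.refl _) (by simpa using ha)
  exact (key (by simp) hA₁).trans <| (key (by simp) hA₂).trans <| (key (by simp) hA₃).trans <|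
    (key (by simp) hA₄).trans <| (key (by simp) hA₅).trans <| (key (by simp) hA₆).trans <|
    key (by simp) hA₇

end RegressionProgram

end RegressionProgram

/-! ### Correctness and cost of the sketching and solving stages -/

/-- The input lists nonzero entries in an arbitrary order; since zero entries contribute nothing,
summing over the list equals summing over all positions. -/
theorem sum_equiv_subtype {ι : Type*} [Fintype ι] {N : ℕ} {P : ι → Prop}
    (e : Fin N ≃ {p : ι // P p}) {F : ι → ℝ} (hF : ∀ p, ¬ P p → F p = 0) :
    ∑ k, F (e k) = ∑ p, F p := by
  classical
  rw [e.sum_comp fun x => F x, ← Finset.sum_subtype (Finset.univ.filter P) (by simp)]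
  exact Finset.sum_filter_of_ne fun p _ h => not_imp_comm.1 (hF p) h

theorem EncodesInput.of_agreeOff {n d : ℕ} {A : Matrix (Fin n) (Fin d) ℝ} {b : Fin n → ℝ}
    {N R : List ℕ} {s s' : Memory} (h : EncodesInput A b s) (hA : AgreeOff N R s s')
    (h0 : 0 ∉ N) (h1 : 1 ∉ N) (h2 : 2 ∉ N) (h3 : 3 ∉ N) (r0 : 0 ∉ R) (r1 : 1 ∉ R) :
    EncodesInput A b s' where
  rows := by rw [hA.nat 0 h0, h.rows]
  cols := by rw [hA.nat 0 h0, h.cols]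
  nnzA := by rw [hA.nat 0 h0, h.nnzA]
  nnzb := by rw [hA.nat 0 h0, h.nnzb]
  listA := by
    rw [hA.nat 1 h1, hA.nat 2 h2, hA.real 0 r0]
    exact h.listA
  listb := by
    rw [hA.nat 3 h3, hA.real 1 r1]
    exact h.listb

namespace RegressionProgram

variable {ρ : RandomTape} {k₁ k₂ d t₁ t₂ W : ℕ} {s : Memory}

theorem achieves_loop_extendStep (hs : HoldsSizes d t₁ t₂ s) (hd : d + 1 ≤ W) (hW : 2 ≤ W)
    {B : Matrix (Fin d) (Fin d) ℝ} (hB : ∀ i j : Fin d, s.real 7 i j = B i j)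
    (h0 : ∀ i j : Fin d, s.real 9 i j = 0) :
    (Program.loop 13 dim extendStep).Achieves ρ s
      (fun s' => AgreeOff [10, 11, 12, 13] [9, 10, 11, 12, 13, 14, 15] s s' ∧
        ∀ i j : Fin d, s'.real 9 i j = partialInverse B d i j)
      (3 + d * (1 + 420 * W ^ 3)) := by
  refine loop_run ρ (by simp [NatExpr.eval, hs.cols])
    (fun k s' => AgreeOff [10, 11, 12, 13] [9, 10, 11, 12, 13, 14, 15] s s' ∧
      ∀ i j : Fin d, s'.real 9 i j = partialInverse B k i j) _
    ⟨AgreeOff.refl _ _ _, by simpa [partialInverse] using h0⟩ ?_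
  rintro k hk s₁ ⟨hA₁, h₁⟩
  have hA₂ : AgreeOff [10, 11, 12, 13] [9, 10, 11, 12, 13, 14, 15] s (s₁.writeNat 13 0 k) :=
    hA₁.trans (AgreeOff.writeNat _ _ _ (by simp))
  have hstep := achieves_extendStep (ρ := ρ) (s := s₁.writeNat 13 0 k) (P := partialInverse B k)
    (k := ⟨k, hk⟩) (hs.of_agreeOff hA₂ (by simp) (by simp) (by simp)) hd hW
    (by simp) (fun i j => by rw [hA₂.real 7 (by simp), hB]) h₁
  refine ⟨⟨hA₂.trans (hstep.1.1.mono (by simp) (List.Subset.refl _)), ?_⟩, hstep.2⟩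
  simpa [partialInverse, hk] using hstep.1.2

/-- Arrays `5` to `8` receive the Gaussian sketches of `S` and `z`, the Gram matrix and the
right-hand side of the normal equations. Empty sums clear array `9`, as the initial memory is
arbitrary there. -/
theorem achieves_solve (hs : HoldsSizes d t₁ t₂ s) (hd : d + 1 ≤ W) (ht₁ : t₁ + 1 ≤ W)
    (ht₂ : t₂ + 1 ≤ W) (hW : 2 ≤ W) {g : Matrix (Fin t₂) (Fin t₁) ℝ}
    (hg : ∀ i j, ρ.gauss (i : Fin t₂) (j : Fin t₁) = g i j)
    {S : Matrix (Fin t₁) (Fin d) ℝ} {z : Fin t₁ → ℝ}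
    (hS : ∀ (i : Fin t₁) (j : Fin d), s.real 3 i j = S i j)
    (hz : ∀ i : Fin t₁, s.real 4 i 0 = z i) :
    solve.Achieves ρ s
      (fun s' => ∀ i : Fin d, s'.real 2 i 0 =
        (partialInverse ((g * S)ᵀ * (g * S)) d *ᵥ ((g * S)ᵀ *ᵥ (g *ᵥ z))) i)
      (360 * W ^ 3 + 3 + d * (1 + 420 * W ^ 3)) := by
  refine ((Program.achieves_sumFill (W := W) (fun (i : Fin t₂) (j : Fin d) h => g i h * S h j)
      (by decide) ht₂ hd ht₁
      (fun s' h => by simp [NatExpr.eval, h.nat, hs.cols, hs.rows₁, hs.rows₂])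
      (fun s' h i j k h10 h11 h12 => by
        simp [RealExpr.eval, NatExpr.eval, h.real, h10, h11, h12, hg, hS])).seq
    (T₂ := 60 * W ^ 3 + (60 * W ^ 3 + (60 * W ^ 3 + (60 * W ^ 3 +
      ((3 + d * (1 + 420 * W ^ 3)) + 60 * W ^ 3)))))
    fun s₁ ⟨hA₁, h₁⟩ =>
      have hs₁ := hs.of_agreeOff hA₁ (by simp) (by simp) (by simp)
      (Program.achieves_sumFill_vec (W := W) (fun (i : Fin t₂) h => g i h * z h)
        (by decide) ht₂ ht₁ hW
        (fun s' h => by simp [NatExpr.eval, h.nat, hs₁.rows₁, hs₁.rows₂])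
        (fun s' h i k h10 h12 => by
          simp [RealExpr.eval, NatExpr.eval, h.real, hA₁.real, h10, h12, hg, hz])).seq
    fun s₂ ⟨hA₂, h₂⟩ =>
      have hs₂ := hs₁.of_agreeOff hA₂ (by simp) (by simp) (by simp)
      (Program.achieves_sumFill (W := W)
        (fun (i : Fin d) (j : Fin d) k => (g * S) k i * (g * S) k j)
        (by decide) hd hd ht₂
        (fun s' h => by simp [NatExpr.eval, h.nat, hs₂.rows₂, hs₂.cols])
        (fun s' h i j k h10 h11 h12 => by
          simp [RealExpr.eval, NatExpr.eval, h.real, hA₂.real, h₁, h10, h11, h12,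
            Matrix.mul_apply])).seq
    fun s₃ ⟨hA₃, h₃⟩ =>
      have hs₃ := hs₂.of_agreeOff hA₃ (by simp) (by simp) (by simp)
      (Program.achieves_sumFill_vec (W := W)
        (fun (i : Fin d) k => (g * S) k i * (g *ᵥ z) k)
        (by decide) hd ht₂ hW
        (fun s' h => by simp [NatExpr.eval, h.nat, hs₃.rows₂, hs₃.cols])
        (fun s' h i k h10 h12 => by
          simp [RealExpr.eval, NatExpr.eval, h.real, hA₃.real, hA₂.real, h₁, h₂, h10, h12,
            Matrix.mul_apply, mulVec, dotProduct])).seq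
    fun s₄ ⟨hA₄, h₄⟩ =>
      have hs₄ := hs₃.of_agreeOff hA₄ (by simp) (by simp) (by simp)
      (Program.achieves_sumFill (W := W) (K := 0)
        (fun (i : Fin d) (j : Fin d) _ => 0)
        (by decide) hd hd (by omega)
        (fun s' h => by simp [NatExpr.eval, h.nat, hs₄.cols])
        (fun s' h i j k => k.elim0)).seq
    fun s₅ ⟨hA₅, h₅⟩ =>
      have hs₅ := hs₄.of_agreeOff hA₅ (by simp) (by simp) (by simp)
      (achieves_loop_extendStep hs₅ hd hW (B := (g * S)ᵀ * (g * S))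
        (fun i j => by
          rw [hA₅.real 7 (by simp), hA₄.real 7 (by simp), h₃, Matrix.mul_apply]
          rfl)
        (fun i j => by simp [h₅])).seq
    fun s₆ ⟨hA₆, h₆⟩ =>
      have hs₆ := hs₅.of_agreeOff hA₆ (by simp) (by simp) (by simp)
      (Program.achieves_sumFill_vec (W := W)
        (fun (i j : Fin d) => partialInverse ((g * S)ᵀ * (g * S)) d i j *
          ((g * S)ᵀ *ᵥ (g *ᵥ z)) j)
        (by decide) hd hd hW
        (fun s' h => by simp [NatExpr.eval, h.nat, hs₆.cols])
        (fun s' h i k h10 h12 => by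
          simp [RealExpr.eval, NatExpr.eval, h.real, hA₆.real, hA₅.real, h₄, h₆, h10, h12,
            mulVec, dotProduct, transpose_apply, -mulVec_mulVec])).weaken
    (fun s₇ ⟨_, h₇⟩ => h₇) le_rfl).weaken (fun _ h => h) (by omega)

/-- Draws are indexed by the row, so every entry of a row reads the same scale, sign and hash value.
Nothing is prepared for each row in advance, hence no term in `n` appears in the cost. -/
theorem achieves_sparseSketch {n : ℕ} {A : Matrix (Fin n) (Fin d) ℝ} {b : Fin n → ℝ}
    (hs : HoldsSizes d t₁ t₂ s) (hinput : EncodesInput A b s)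
    (hd : d + 1 ≤ W) (ht₁ : t₁ + 1 ≤ W) (hW : 2 ≤ W) {ω : Sample n t₁ t₂}
    (hω : TapeAgrees ρ ω) :
    sparseSketch.Achieves ρ s
      (fun s' => HoldsSizes d t₁ t₂ s' ∧
        (∀ (i : Fin t₁) (j : Fin d), s'.real 3 i j =
          (sparseEmbedding ω.2.1 ω.2.2.1 * diagInv ω.1 * A) i j) ∧
        ∀ i : Fin t₁, s'.real 4 i 0 =
          (sparseEmbedding ω.2.1 ω.2.2.1 *ᵥ (diagInv ω.1 *ᵥ b)) i)
      (120 * W ^ 3 + 6 + 60 * (nnz A + nnzVec b)) := by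
  obtain ⟨e, he⟩ := hinput.listA
  obtain ⟨f, hf⟩ := hinput.listb
  refine ((Program.achieves_sumFill (W := W) (K := 0) (fun (_ : Fin t₁) (_ : Fin d) _ => 0)
      (by decide) ht₁ hd (by omega)
      (fun s' h => by simp [NatExpr.eval, h.nat, hs.cols, hs.rows₁])
      (fun s' h i j k => k.elim0)).seq
    (T₂ := 60 * W ^ 3 + ((3 + nnz A * 40) + (3 + nnzVec b * 40)))
    fun s₁ ⟨hA₁, h₁⟩ =>
      have hs₁ := hs.of_agreeOff hA₁ (by simp) (by simp) (by simp)
      (Program.achieves_sumFill_vec (W := W) (K := 0) (fun (_ : Fin t₁) _ => 0)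
        (by decide) ht₁ (by omega) hW
        (fun s' h => by simp [NatExpr.eval, h.nat, hs₁.rows₁])
        (fun s' h i k => k.elim0)).seq
    fun s₂ ⟨hA₂, h₂⟩ =>
      have hs₂ := hs₁.of_agreeOff hA₂ (by simp) (by simp) (by simp)
      (Program.achieves_scatter (fun k => (ω.2.1 (e k).1.1 : ℕ)) (fun k => ((e k).1.2 : ℕ))
          (fun k => signValue (ω.2.2.1 (e k).1.1) * A (e k).1.1 (e k).1.2 / ω.1 (e k).1.1)
          (by decide) (by simp [NatExpr.eval, hA₂.nat, hA₁.nat, hinput.nnzA])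
          (fun s' h k h10 => by
            have hr : s'.nat 4 0 = t₁ := by simp [h.nat, hs₂.rows₁]
            have h1 : s'.nat 1 k = (e k).1.1 := by simp [h.nat, hA₂.nat, hA₁.nat, (he k).1]
            have h2 : s'.nat 2 k = (e k).1.2 := by simp [h.nat, hA₂.nat, hA₁.nat, (he k).2.1]
            have h3 : s'.real 0 k 0 = A (e k).1.1 (e k).1.2 := by
              simp [h.real, hA₂.real, hA₁.real, (he k).2.2]
            simp [RealExpr.eval, NatExpr.eval, sketchTerm, h10, hr, h1, h2, h3, hω.unif, hω.sign,
              hω.orlicz])).seq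
    fun s₃ ⟨hA₃, h₃⟩ =>
      (Program.achieves_scatter (fun k => (ω.2.1 (f k).1 : ℕ)) (fun _ => 0)
          (fun k => signValue (ω.2.2.1 (f k).1) * b (f k).1 / ω.1 (f k).1)
          (by decide) (by simp [NatExpr.eval, hA₃.nat, hA₂.nat, hA₁.nat, hinput.nnzb])
          (fun s' h k h10 => by
            have hr : s'.nat 4 0 = t₁ := by simp [h.nat, hA₃.nat, hs₂.rows₁]
            have h1 : s'.nat 3 k = (f k).1 := by
              simp [h.nat, hA₃.nat, hA₂.nat, hA₁.nat, (hf k).1]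
            have h2 : s'.real 1 k 0 = b (f k).1 := by
              simp [h.real, hA₃.real, hA₂.real, hA₁.real, (hf k).2]
            simp [RealExpr.eval, NatExpr.eval, sketchTerm, h10, hr, h1, h2, hω.unif, hω.sign,
              hω.orlicz])).weaken
    (fun s₄ ⟨hA₄, h₄⟩ => ?_) le_rfl).weaken (fun _ h => h) (by omega)
  refine ⟨(hs₂.of_agreeOff hA₃ (by simp) (by simp) (by simp)).of_agreeOff hA₄ (by simp) (by simp)
    (by simp), fun i j => ?_, fun i => ?_⟩
  · have hcol : (sparseEmbedding ω.2.1 ω.2.2.1 * diagInv ω.1 * A) i j =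
        (sparseEmbedding ω.2.1 ω.2.2.1 *ᵥ (diagInv ω.1 *ᵥ fun r => A r j)) i := by
      rw [mulVec_mulVec]
      rfl
    rw [hA₄.real 3 (by simp), h₃, hA₂.real 3 (by simp), h₁, hcol, sparseEmbedding_mulVec]
    rw [sum_equiv_subtype e (F := fun p => if (ω.2.1 p.1 : ℕ) = i ∧ (p.2 : ℕ) = j then
      signValue (ω.2.2.1 p.1) * A p.1 p.2 / ω.1 p.1 else 0) (fun p hp => by
        simp [not_not.1 hp]), Fintype.sum_prod_type]
    simp [Fin.val_inj, ite_and, diagInv_mulVec, div_eq_mul_inv, mul_assoc, mul_comm, mul_left_comm]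
  · rw [h₄, hA₃.real 4 (by simp), h₂, sparseEmbedding_mulVec]
    rw [sum_equiv_subtype f (F := fun p => if (ω.2.1 p : ℕ) = i ∧ 0 = 0 then
      signValue (ω.2.2.1 p) * b p / ω.1 p else 0) (fun p hp => by simp [not_not.1 hp])]
    simp [Fin.val_inj, diagInv_mulVec, div_eq_mul_inv, mul_assoc, mul_comm, mul_left_comm]

end RegressionProgram

/-! ### Assembly of the program and of the final statement -/

theorem sketchedSolution_eq_partialInverse {n d t₁ t₂ : ℕ} (ht₂ : 0 < t₂)
    (A : Matrix (Fin n) (Fin d) ℝ) (b : Fin n → ℝ) (ω : Sample n t₁ t₂)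
    {M : Matrix (Fin t₂) (Fin d) ℝ} {y : Fin t₂ → ℝ}
    (hM : M = Matrix.of ω.2.2.2 * (sparseEmbedding ω.2.1 ω.2.2.1 * diagInv ω.1 * A))
    (hy : y = Matrix.of ω.2.2.2 *ᵥ (sparseEmbedding ω.2.1 ω.2.2.1 *ᵥ (diagInv ω.1 *ᵥ b))) :
    sketchedSolution A b ω = partialInverse (Mᵀ * M) d *ᵥ (Mᵀ *ᵥ y) := by
  have hc : 1 / Real.sqrt t₂ ≠ 0 := by positivity
  rw [partialInverse_mulVec_eq_pinv hc, sketchedSolution, hM, hy, sketchMatrix, gaussianMatrix]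
  simp only [Matrix.smul_mul, Matrix.mul_assoc, Matrix.smul_mulVec, mulVec_mulVec]

theorem achieves_regressionProgram {ρ : RandomTape} {s : Memory} {n d k₁ k₂ : ℕ} (hd : 1 ≤ d)
    (hk₂ : 0 < k₂) {A : Matrix (Fin n) (Fin d) ℝ} {b : Fin n → ℝ}
    {ω : Sample n (k₁ * d ^ 2) (k₂ * d)} (hinput : EncodesInput A b s) (hω : TapeAgrees ρ ω) :
    (regressionProgram k₁ k₂).Achieves ρ s (HoldsOutput (sketchedSolution A b ω))
      (60 * (nnz A + nnzVec b) + (60 * sizeBound k₁ k₂ d + 480 * sizeBound k₁ k₂ d ^ 3 + 9 +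
        d * (1 + 420 * sizeBound k₁ k₂ d ^ 3))) := by
  have hsize : d + 1 ≤ sizeBound k₁ k₂ d ∧ k₁ * d ^ 2 + 1 ≤ sizeBound k₁ k₂ d ∧
      k₂ * d + 1 ≤ sizeBound k₁ k₂ d ∧ 2 ≤ sizeBound k₁ k₂ d := by
    simp only [sizeBound]
    omega
  obtain ⟨hW, hW₁, hW₂, hW'⟩ := hsize
  refine ((RegressionProgram.achieves_computeSizes hd hinput.cols).seq (T₂ := _ + _)
    fun s₁ ⟨hA₁, h₁⟩ => (RegressionProgram.achieves_sparseSketch h₁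
      (hinput.of_agreeOff hA₁ (by simp) (by simp) (by simp) (by simp) (by simp) (by simp))
      hW hW₁ hW' hω).seq
    fun s₂ ⟨h₂, hS, hz⟩ => (RegressionProgram.achieves_solve h₂ hW hW₁ hW₂ hW'
      (g := Matrix.of ω.2.2.2) hω.gauss hS hz).weaken
    (fun s₃ h₃ j => ?_) le_rfl).weaken (fun _ h => h) (by omega)
  rw [h₃, sketchedSolution_eq_partialInverse (Nat.mul_pos hk₂ hd) A b ω rfl rfl]

theorem exists_polynomial_eval_eq_stepBound (k₁ k₂ : ℕ) : ∃ p : Polynomial ℕ, ∀ d, p.eval d =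
    60 * sizeBound k₁ k₂ d + 480 * sizeBound k₁ k₂ d ^ 3 + 9 +
      d * (1 + 420 * sizeBound k₁ k₂ d ^ 3) := by
  let W : Polynomial ℕ :=
    Polynomial.C k₁ * Polynomial.X ^ 2 + Polynomial.C k₂ * Polynomial.X + Polynomial.X +
      Polynomial.C 2
  refine ⟨Polynomial.C 60 * W + Polynomial.C 480 * W ^ 3 + Polynomial.C 9 +
    Polynomial.X * (Polynomial.C 1 + Polynomial.C 420 * W ^ 3), fun d => ?_⟩
  have hW : W.eval d = sizeBound k₁ k₂ d := by
    simp only [W, sizeBound, Polynomial.eval_add, Polynomial.eval_mul, Polynomial.eval_pow,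
      Polynomial.eval_C, Polynomial.eval_X]
  simp only [Polynomial.eval_add, Polynomial.eval_mul, Polynomial.eval_pow, Polynomial.eval_C,
    Polynomial.eval_X, hW]

theorem nnzVec_le {n : ℕ} (b : Fin n → ℝ) : nnzVec b ≤ n :=
  (Nat.card_le_card_of_injective (Subtype.val : {i // b i ≠ 0} → Fin n)
    Subtype.val_injective).trans_eq (Nat.card_fin n)

theorem theorem18 :
    ∃ c₁ c₂ : ℕ,
      -- accuracy
      (∀ (G : ℝ → ℝ) (hG : PropertyP G), ∃ β : ℝ, 0 < β ∧
        ∀ n d k₁ k₂ : ℕ, 2 ≤ n → 1 ≤ d → c₁ ≤ k₁ → c₂ ≤ k₂ →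
        ∀ (A : Matrix (Fin n) (Fin d) ℝ) (b : Fin n → ℝ),
          ∃ xmin : Fin d → ℝ,
            (∀ x, orliczNorm G (A.mulVec xmin - b) ≤ orliczNorm G (A.mulVec x - b)) ∧
            ∃ E : Set (Sample n (k₁ * d ^ 2) (k₂ * d)), MeasurableSet E ∧
              4 / 5 ≤ sampleLaw hG n (k₁ * d ^ 2) (k₂ * d) E ∧
              ∀ ω ∈ E, orliczNorm G (A.mulVec (sketchedSolution A b ω) - b) ≤
                β * d * Real.log n ^ 2 * orliczNorm G (A.mulVec xmin - b)) ∧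
      -- running time
      (∀ k₁ k₂ : ℕ, c₁ ≤ k₁ → c₂ ≤ k₂ →
        ∃ (prog : Program) (C : ℕ) (p : Polynomial ℕ),
          ∀ n d : ℕ, 1 ≤ d → ∀ (A : Matrix (Fin n) (Fin d) ℝ) (b : Fin n → ℝ)
            (ω : Sample n (k₁ * d ^ 2) (k₂ * d)) (ρ : RandomTape) (s : Memory),
            EncodesInput A b s → TapeAgrees ρ ω →
              HoldsOutput (sketchedSolution A b ω) (prog.run ρ s).1 ∧
              (prog.run ρ s).2 ≤ C * (nnz A + nnzVec b) + p.eval d ∧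
              (n ≤ nnz A → (prog.run ρ s).2 ≤ C * nnz A + p.eval d)) := by
  refine ⟨320, 50, fun G hG => ?_, fun k₁ k₂ _ hk₂ => ?_⟩
  · obtain ⟨β, hβ, h⟩ := sketchedSolution_accuracy hG
    refine ⟨β, hβ, fun n d k₁ k₂ hn hd hk₁ hk₂ A b => ?_⟩
    obtain ⟨xmin, hmin⟩ := exists_orliczNorm_minimizer hG A b
    exact ⟨xmin, hmin, h n d k₁ k₂ hn hd hk₁ hk₂ A b xmin⟩
  · obtain ⟨p, hp⟩ := exists_polynomial_eval_eq_stepBound k₁ k₂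
    -- The cost per nonzero entry is `60`; doubling it absorbs `nnz b ≤ n ≤ nnz A` in the last
    -- bound.
    refine ⟨regressionProgram k₁ k₂, 120, p, fun n d hd A b ω ρ s hinput hω => ?_⟩
    obtain ⟨hout, hcost⟩ := achieves_regressionProgram hd (by omega) hinput hω
    rw [← hp d] at hcost
    have hb := nnzVec_le b
    exact ⟨hout, by omega, fun hn => by omega⟩
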